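/- Let $\mathbb T=\mathbb R/2\pi\mathbb Z$, write $\widehat f(n)=\frac1{2\pi}\int_0^{2\pi}f(x)e^{-inx}\,dx$ and $\|f\|_{\mathcal F L^1}=\sum_{n\in\mathbb Z}|\widehat f(n)|\in[0,\infty]$. Let $(g_k)_{k\in\mathbb Z}$ be independent standard complex Gaussian random variables (independent real and imaginary parts with law $N(0,\tfrac12)$, so $\mathbb E g_k=\mathbb E g_k^2=0$ and $\mathbb E|g_k|^2=1$), and let $(c_k)_{k\in\mathbb Z}$ be real numbers with $c_k\ge 0$, not all zero, and $\sum_k c_k^2<\infty$. Let $z_0>0$, and let $\varepsilon\mapsto t(\varepsilon)\ge 0$ $(\varepsilon>0)$ satisfy $t(\varepsilon)=O(\varepsilon^{-1}|\log\varepsilon|)$ as $\varepsilon\to0^+$. For each $\varepsilon>0$ let $u=u^\varepsilon$ be, almost surely, a solution on $[0,t(\varepsilon)]$ of $$i\partial_t u+\partial_x^2u=\varepsilon^2|u|^2u\quad\text{on }\mathbb T,\qquad u|_{t=0}=\sum_{k\in\mathbb Z}c_kg_ke^{ikx},$$ that is, $u\in C([0,t(\varepsilon)];L^2(\mathbb T))\cap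 L^4([0,t(\varepsilon)]\times\mathbb T)$ has this initial value and satisfies, for all $s\in[0,t(\varepsilon)]$ and $k\in\mathbb Z$, Duhamel's formula $$\widehat u(s,k)=e^{-ik^2s}\,\widehat u(0,k)-i\varepsilon^2\int_0^s e^{-ik^2(s-r)}\,\widehat{|u|^2u}(r,k)\,dr .$$ Then $$\lim_{\varepsilon\to0^+}\varepsilon\log\mathbb P\Big(\|u^\varepsilon(t(\varepsilon))\|_{\mathcal F L^1}>z_0\varepsilon^{-1/2}\Big)=-\frac{z_0^2}{\sum_{k}c_k^2}$$ holds if and only if $(c_k)\in\ell^1$, i.e. $\sum_k c_k<\infty$. -/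

import Mathlib

open MeasureTheory ProbabilityTheory Filter Asymptotics
open scoped Topology ENNReal NNReal

noncomputable section

namespace CubicNLS

instance fact_two_pi_pos : Fact (0 < 2 * Real.pi) := ⟨Real.two_pi_pos⟩

/-- The torus `𝕋 = ℝ / 2πℤ`. -/
abbrev Torus : Type := AddCircle (2 * Real.pi)

/-- The normalised Lebesgue measure `dx / 2π` on the torus. With it
`fourierCoeff f n = (2π)⁻¹ ∫ f(x) e^{-inx} dx`. -/
abbrev torusMeasure : Measure Torus := AddCircle.haarAddCircle

/-- The space `L²(𝕋; ℂ)`. -/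
abbrev L2Torus : Type := Lp ℂ 2 torusMeasure

/-- The Fourier-Lebesgue norm `‖f‖_{FL¹} = ∑ₙ |f̂(n)|`, with values in `[0, ∞]`. -/
def fourierLebesgueNorm (f : Torus → ℂ) : ℝ≥0∞ :=
  ∑' n : ℤ, ‖fourierCoeff f n‖ₑ

/-- The standard complex Gaussian law: independent real and imaginary parts with law
`N(0, 1/2)`, so that `E g = 0`, `E g² = 0` and `E |g|² = 1`. -/
def stdComplexGaussian : Measure ℂ :=
  ((gaussianReal 0 (1 / 2)).prod (gaussianReal 0 (1 / 2))).map
    Complex.measurableEquivRealProd.symm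

/-- `u` is a solution on `[0, T]` of `i ∂ₜ u + ∂ₓ² u = ε² |u|² u` on the torus, at the level of
square integrable data: `u` belongs to `C([0, T]; L²(𝕋)) ∩ L⁴([0, T] × 𝕋)` and satisfies
Duhamel's formula
`u(t) = e^{it∂ₓ²} u(0) - i ε² ∫₀ᵗ e^{i(t-s)∂ₓ²} (|u|² u)(s) ds`, written mode by mode. -/
structure IsSolution (ε T : ℝ) (u : ℝ → L2Torus) : Prop where
  continuousOn : ContinuousOn u (Set.Icc 0 T)
  lintegral_pow_four_lt_top :
    ∫⁻ s in Set.Icc 0 T, ∫⁻ x, ‖u s x‖ₑ ^ 4 ∂torusMeasure < ∞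
  duhamel : ∀ t ∈ Set.Icc 0 T, ∀ k : ℤ,
    fourierCoeff (u t) k =
      Complex.exp (-(Complex.I * (k : ℂ) ^ 2 * (t : ℂ))) * fourierCoeff (u 0) k
        - Complex.I * (ε : ℂ) ^ 2 *
          ∫ s in (0 : ℝ)..t, Complex.exp (-(Complex.I * (k : ℂ) ^ 2 * ((t - s : ℝ) : ℂ))) *
            fourierCoeff (fun x => (‖u s x‖ : ℂ) ^ 2 * u s x) k

/-- `f ∈ L²(𝕋)` is the function `∑ₖ cₖ gₖ e^{ikx}`. -/
def HasFourierData (c : ℤ → ℝ) (z : ℤ → ℂ) (f : L2Torus) : Prop :=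
  ∀ k : ℤ, fourierCoeff f k = (c k : ℂ) * z k

end CubicNLS

end

open MeasureTheory ProbabilityTheory Filter Asymptotics
open scoped Topology ENNReal NNReal

noncomputable section

namespace CubicNLS

/-! Put σ = ∑ c_k² and X = ∑ c_k |g_k|, the `FL¹` norm of the datum. The theorem is a large
deviation estimate for X, carried to time t(ε) by near-conservation of the `FL¹` norm.

Probability. Since |g_k| has tail e^{-r²}, asking |g_k| > a c_k/σ on a finite set of modes, with σ
summed over that set, costs exactly e^{-a²/σ} and forces X > a. Enlarging the set gives the lower
bound, whether or not c is in ℓ¹ (`exp_neg_le_prob_randomNorm`). If c is in ℓ¹, Chernoff's bound has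
the same exponent up to a term linear in a (`prob_randomNorm_le`), which is negligible when a = z
ε^{-1/2} and logarithms are multiplied by ε. If c is not in ℓ¹, then X = ∞ almost surely
(`ae_randomNorm_eq_top`).

Dynamics. In the interaction picture v_k = e^{ik²t} û_k the cubic term is a sum of interactions
oscillating at integer frequencies. Averaging over time 2π leaves the resonant ones, which multiply
each mode by a purely imaginary number (`exists_integral_tri_eq`) and so change its modulus only at
second order. With coupling ε² and size ε^{-1/2}, the relative growth is O(ε²) per period
(`norm_flow_period_le`), hence O(ε |log ε|) by time t(ε), plus O(ε) from the incomplete last period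
(`IsMild.fourierLebesgueNorm_le`). Time reversal (`IsMild.reverse`) turns this upper bound into a
lower bound.

Uniqueness. The given u lies only in C(L²) ∩ L⁴, and must be identified with the flow built in ℓ¹.
This rests on Zygmund's L⁴ inequality and its retarded form (`IsMild.eqOn`).

Thus exceeding z ε^{-1/2} at time t(ε) and at time 0 are equivalent up to an arbitrarily small
change of z, and continuity of z²/σ in z gives the limit when c is in ℓ¹. Otherwise the probability
is eventually 1, because a bounded norm at time t(ε) would force a finite one at time 0; the limit
is then 0 instead of a negative number. -/

/-! ### The modulus of one complex Gaussian: tail and exponential moments. -/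

theorem lintegral_stdComplexGaussian (f : ℂ → ℝ≥0∞) (hf : Measurable f) :
    ∫⁻ z, f z ∂stdComplexGaussian
      = ∫⁻ z, ENNReal.ofReal (Real.pi⁻¹ * Real.exp (-‖z‖ ^ 2)) * f z := by
  have hv : ((1 / 2 : ℝ≥0)) ≠ 0 := by norm_num
  rw [stdComplexGaussian, lintegral_map hf (by fun_prop),
    gaussianReal_of_var_ne_zero _ hv,
    prod_withDensity (measurable_gaussianPDF _ _) (measurable_gaussianPDF _ _),
    lintegral_withDensity_eq_lintegral_mul _ (by fun_prop) (by fun_prop),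
    ← (Complex.volume_preserving_equiv_real_prod.symm).lintegral_comp_emb
      Complex.measurableEquivRealProd.symm.measurableEmbedding]
  rw [Measure.volume_eq_prod]
  refine lintegral_congr fun z => ?_
  simp only [Pi.mul_apply]
  congr 1
  rw [gaussianPDF, gaussianPDF, ← ENNReal.ofReal_mul (gaussianPDFReal_nonneg _ _ _)]
  congr 1
  have : ‖Complex.measurableEquivRealProd.symm z‖ ^ 2 = z.1 ^ 2 + z.2 ^ 2 := by
    rw [← Complex.normSq_eq_norm_sq, Complex.normSq_apply]
    simp [Complex.measurableEquivRealProd, sq]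
  rw [this, gaussianPDFReal, gaussianPDFReal]
  have e : ∀ x : ℝ, -(x - 0) ^ 2 / (2 * ((1 / 2 : ℝ≥0) : ℝ)) = -x ^ 2 := by
    intro x; push_cast; ring
  rw [e, e]
  have e2 : (2 * Real.pi * ((1 / 2 : ℝ≥0) : ℝ)) = Real.pi := by push_cast; ring
  rw [e2]
  have e3 : (√Real.pi)⁻¹ * (√Real.pi)⁻¹ = Real.pi⁻¹ := by
    rw [← mul_inv, Real.mul_self_sqrt Real.pi_nonneg]
  calc _ = ((√Real.pi)⁻¹ * (√Real.pi)⁻¹) * (Real.exp (-z.1 ^ 2) * Real.exp (-z.2 ^ 2)) := by ring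
    _ = _ := by rw [e3, ← Real.exp_add]; congr 2; ring

theorem lintegral_norm_stdComplexGaussian (φ : ℝ → ℝ≥0∞) (hφ : Measurable φ) :
    ∫⁻ z, φ ‖z‖ ∂stdComplexGaussian
      = ∫⁻ r in Set.Ioi (0 : ℝ), ENNReal.ofReal (2 * r * Real.exp (-r ^ 2)) * φ r := by
  rw [lintegral_stdComplexGaussian _ (by fun_prop), ← Complex.lintegral_comp_polarCoord_symm]
  have h1 : ∫⁻ p in polarCoord.target, ENNReal.ofReal p.1 •
      (ENNReal.ofReal (Real.pi⁻¹ * Real.exp (-‖Complex.polarCoord.symm p‖ ^ 2)) *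
        φ ‖Complex.polarCoord.symm p‖)
      = ∫⁻ p in Set.Ioi (0 : ℝ) ×ˢ Set.Ioo (-Real.pi) Real.pi,
        ENNReal.ofReal (Real.pi⁻¹ * p.1 * Real.exp (-p.1 ^ 2)) * φ p.1 := by
    rw [polarCoord_target]
    refine setLIntegral_congr_fun (measurableSet_Ioi.prod measurableSet_Ioo) ?_
    rintro ⟨r, θ⟩ ⟨hr, -⟩
    have hr0 : (0 : ℝ) < r := hr
    simp only [Complex.norm_polarCoord_symm, abs_of_pos hr0, smul_eq_mul]
    rw [← mul_assoc, ← ENNReal.ofReal_mul hr0.le]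
    congr 2; ring
  rw [h1, Measure.volume_eq_prod, ← Measure.prod_restrict, lintegral_prod _ (by fun_prop)]
  refine lintegral_congr fun r => ?_
  simp only []
  rw [lintegral_const, Measure.restrict_apply_univ, Real.volume_Ioo, mul_assoc, mul_comm (φ r),
    ← mul_assoc, ← ENNReal.ofReal_mul' (by linarith [Real.pi_pos])]
  congr 2
  field_simp; ring

/-- The modulus has density 2r e^{-r²}, an exact derivative. The absence of a prefactor is what lets
products of tails over many modes stay sharp. -/
theorem stdComplexGaussian_lt_norm {r : ℝ} (hr : 0 ≤ r) :
    stdComplexGaussian {z | r < ‖z‖} = ENNReal.ofReal (Real.exp (-r ^ 2)) := by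
  have hm : MeasurableSet {z : ℂ | r < ‖z‖} := measurableSet_lt measurable_const measurable_norm
  have h := lintegral_norm_stdComplexGaussian (Set.indicator (Set.Ioi r) 1)
    (measurable_one.indicator measurableSet_Ioi)
  have h2 : (fun z : ℂ => (Set.Ioi r).indicator (1 : ℝ → ℝ≥0∞) ‖z‖)
      = Set.indicator {z : ℂ | r < ‖z‖} 1 := by
    ext z; simp [Set.indicator_apply]
  rw [h2, lintegral_indicator_one hm] at h
  rw [h]
  have h3 : ∫⁻ ρ in Set.Ioi (0 : ℝ), ENNReal.ofReal (2 * ρ * Real.exp (-ρ ^ 2)) *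
        (Set.Ioi r).indicator (1 : ℝ → ℝ≥0∞) ρ
      = ∫⁻ ρ in Set.Ioi r, ENNReal.ofReal (2 * ρ * Real.exp (-ρ ^ 2)) := by
    have : (fun ρ => ENNReal.ofReal (2 * ρ * Real.exp (-ρ ^ 2)) *
        (Set.Ioi r).indicator (1 : ℝ → ℝ≥0∞) ρ) = (Set.Ioi r).indicator
          (fun ρ => ENNReal.ofReal (2 * ρ * Real.exp (-ρ ^ 2))) := by
      ext ρ; by_cases h : r < ρ <;> simp [h]
    rw [this, setLIntegral_indicator measurableSet_Ioi, Set.inter_eq_left.2]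
    exact Set.Ioi_subset_Ioi hr
  rw [h3]
  have hd : ∀ x ∈ Set.Ici r, HasDerivAt (fun x : ℝ => -Real.exp (-x ^ 2))
      (2 * x * Real.exp (-x ^ 2)) x := by
    intro x _
    exact ((hasDerivAt_pow 2 x).fun_neg.exp).fun_neg.congr_deriv (by norm_num; ring)
  have ht : Tendsto (fun x : ℝ => -Real.exp (-x ^ 2)) atTop (𝓝 0) := by
    rw [← neg_zero]
    refine (Real.tendsto_exp_atBot.comp ?_).neg
    exact tendsto_neg_atTop_atBot.comp (tendsto_pow_atTop (by norm_num))
  have hpos : ∀ x ∈ Set.Ioi r, 0 ≤ 2 * x * Real.exp (-x ^ 2) := fun x hx => by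
    have : 0 ≤ x := hr.trans (le_of_lt hx)
    positivity
  have hi := integrableOn_Ioi_deriv_of_nonneg' hd hpos ht
  have hv := integral_Ioi_of_hasDerivAt_of_nonneg' hd hpos ht
  rw [← ofReal_integral_eq_lintegral_ofReal hi
    ((ae_restrict_iff' measurableSet_Ioi).2 (ae_of_all _ hpos)), hv]
  simp

instance : IsProbabilityMeasure stdComplexGaussian :=
  Measure.isProbabilityMeasure_map (by fun_prop)

/-- Split 2r = (2r - l) + l against e^{lr - r²}: the first part integrates to exactly 1, the second
is at most l √π e^{l²/4}. The constant 1/4 is the sharp one needed for the rate; the correction is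
linear in l, so that it sums over modes when c is in ℓ¹. -/
theorem lintegral_exp_mul_norm_stdComplexGaussian_le {l : ℝ} (hl : 0 ≤ l) :
    ∫⁻ z, ENNReal.ofReal (Real.exp (l * ‖z‖)) ∂stdComplexGaussian
      ≤ ENNReal.ofReal (Real.exp (l ^ 2 / 4 + √Real.pi * l)) := by
  rw [lintegral_norm_stdComplexGaussian (fun r => ENNReal.ofReal (Real.exp (l * r))) (by fun_prop)]
  have h1 : ∀ r ∈ Set.Ioi (0 : ℝ), ENNReal.ofReal (2 * r * Real.exp (-r ^ 2)) *
      ENNReal.ofReal (Real.exp (l * r)) = ENNReal.ofReal (2 * r * Real.exp (l * r - r ^ 2)) := by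
    intro r hr
    have hr0 : (0 : ℝ) < r := hr
    rw [← ENNReal.ofReal_mul (by positivity), mul_assoc (2 * r), ← Real.exp_add]
    congr 3; ring
  rw [setLIntegral_congr_fun measurableSet_Ioi h1]
  have hsq : ∀ r : ℝ, Real.exp (l * r - r ^ 2) = Real.exp (l ^ 2 / 4) *
      Real.exp (-1 * (r - l / 2) ^ 2) := fun r => by
    rw [← Real.exp_add]; congr 1; ring
  have hi0 : Integrable (fun r : ℝ => Real.exp (l * r - r ^ 2)) := by
    simp_rw [hsq]
    exact ((integrable_exp_neg_mul_sq one_pos).comp_sub_right (l / 2)).const_mul _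
  have hi1 : Integrable (fun r : ℝ => (2 * r - l) * Real.exp (l * r - r ^ 2)) := by
    simp_rw [hsq]
    have := ((integrable_mul_exp_neg_mul_sq one_pos).comp_sub_right (l / 2)).const_mul
      (2 * Real.exp (l ^ 2 / 4))
    refine this.congr (ae_of_all _ fun r => ?_)
    simp only; ring
  have hd : ∀ x ∈ Set.Ici (0 : ℝ), HasDerivAt (fun x : ℝ => -Real.exp (l * x - x ^ 2))
      ((2 * x - l) * Real.exp (l * x - x ^ 2)) x := by
    intro x _
    exact ((((hasDerivAt_id' x).const_mul l).fun_sub (hasDerivAt_pow 2 x)).exp).fun_neg.congr_deriv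
      (by norm_num; ring)
  have ht : Tendsto (fun x : ℝ => -Real.exp (l * x - x ^ 2)) atTop (𝓝 0) := by
    rw [← neg_zero]
    refine (Real.tendsto_exp_atBot.comp ?_).neg
    have h : Tendsto (fun x : ℝ => x * (x - l)) atTop atTop :=
      tendsto_id.atTop_mul_atTop₀ (tendsto_atTop_add_const_right _ _ tendsto_id)
    refine (tendsto_neg_atTop_atBot.comp h).congr fun x => ?_
    simp only [Function.comp]; ring
  have hv1 : ∫ r in Set.Ioi (0 : ℝ), (2 * r - l) * Real.exp (l * r - r ^ 2) = 1 := by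
    rw [integral_Ioi_of_hasDerivAt_of_tendsto' hd hi1.integrableOn ht]; simp
  have hv0 : ∫ r in Set.Ioi (0 : ℝ), Real.exp (l * r - r ^ 2) ≤ Real.exp (l ^ 2 / 4) * √Real.pi := by
    refine (setIntegral_le_integral hi0 (ae_of_all _ fun r => (Real.exp_pos _).le)).trans_eq ?_
    simp_rw [hsq]
    rw [integral_const_mul, integral_sub_right_eq_self (fun r : ℝ => Real.exp (-1 * r ^ 2)),
      integral_gaussian, div_one]
  have hfun : ∀ r : ℝ, 2 * r * Real.exp (l * r - r ^ 2)
      = (2 * r - l) * Real.exp (l * r - r ^ 2) + l * Real.exp (l * r - r ^ 2) := fun r => by ring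
  have hi2 : Integrable (fun r : ℝ => 2 * r * Real.exp (l * r - r ^ 2)) := by
    simp_rw [hfun]; exact hi1.add (hi0.const_mul l)
  rw [← ofReal_integral_eq_lintegral_ofReal hi2.integrableOn
    ((ae_restrict_iff' measurableSet_Ioi).2 (ae_of_all _ fun r hr => by
      have : (0 : ℝ) < r := hr
      positivity))]
  refine ENNReal.ofReal_le_ofReal ?_
  simp_rw [hfun]
  rw [integral_add hi1.integrableOn (hi0.const_mul l).integrableOn, hv1, integral_const_mul]
  calc 1 + l * ∫ r in Set.Ioi (0 : ℝ), Real.exp (l * r - r ^ 2)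
      ≤ Real.exp (l ^ 2 / 4) * 1 + l * (Real.exp (l ^ 2 / 4) * √Real.pi) := by
        gcongr
        rw [mul_one]; exact Real.one_le_exp (by positivity)
    _ = Real.exp (l ^ 2 / 4) * (√Real.pi * l + 1) := by ring
    _ ≤ Real.exp (l ^ 2 / 4) * Real.exp (√Real.pi * l) := by
        gcongr; exact Real.add_one_le_exp _
    _ = _ := (Real.exp_add _ _).symm

/-- Bound the integrand by e^{-l} where |z| > 1, an event of probability e^{-1}, and by 1 elsewhere;
then use 1 - e^{-l} ≥ l/(1+l). For bounded l the exponent is comparable to -l, so a divergent ∑ c_k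
drives products of these factors to 0. -/
theorem lintegral_exp_neg_mul_norm_stdComplexGaussian_le {l : ℝ} (hl : 0 ≤ l) :
    ∫⁻ z, ENNReal.ofReal (Real.exp (-(l * ‖z‖))) ∂stdComplexGaussian
      ≤ ENNReal.ofReal (Real.exp (-(Real.exp (-1) * (l / (1 + l))))) := by
  have hm : MeasurableSet {z : ℂ | 1 < ‖z‖} := measurableSet_lt measurable_const measurable_norm
  have hp := stdComplexGaussian_lt_norm (zero_le_one (α := ℝ))
  have hc : stdComplexGaussian {z | 1 < ‖z‖}ᶜ = ENNReal.ofReal (1 - Real.exp (-1)) := by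
    rw [prob_compl_eq_one_sub hm, hp, ENNReal.ofReal_sub _ (Real.exp_pos _).le]
    norm_num
  have h1 : Real.exp (-1) ≤ 1 := Real.exp_le_one_iff.2 (by norm_num)
  have hle : ∀ z : ℂ, ENNReal.ofReal (Real.exp (-(l * ‖z‖))) ≤
      {z : ℂ | 1 < ‖z‖}.indicator (fun _ => ENNReal.ofReal (Real.exp (-l))) z
        + {z : ℂ | 1 < ‖z‖}ᶜ.indicator (fun _ => 1) z := by
    intro z
    by_cases hz : 1 < ‖z‖
    · simp only [Set.indicator_apply, Set.mem_ofPred_eq, hz, if_true, Set.mem_compl_iff, not_true,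
        if_false, add_zero]
      refine ENNReal.ofReal_le_ofReal (Real.exp_le_exp.2 ?_)
      nlinarith
    · simp only [Set.indicator_apply, Set.mem_ofPred_eq, hz, if_false, Set.mem_compl_iff,
        not_false_eq_true, if_true, zero_add]
      rw [← ENNReal.ofReal_one]
      exact ENNReal.ofReal_le_ofReal (Real.exp_le_one_iff.2 (by have := norm_nonneg z; nlinarith))
  refine (lintegral_mono hle).trans ?_
  rw [lintegral_add_left (measurable_const.indicator hm), lintegral_indicator_const hm,
    lintegral_indicator_const hm.compl, hp, hc, one_mul,
    ← ENNReal.ofReal_mul (Real.exp_pos _).le,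
    ← ENNReal.ofReal_add (by positivity) (by linarith)]
  refine ENNReal.ofReal_le_ofReal ?_
  norm_num
  have h2 : Real.exp (-l) ≤ 1 / (1 + l) := by
    rw [Real.exp_neg, ← one_div]
    exact one_div_le_one_div_of_le (by positivity) (by linarith [Real.add_one_le_exp l])
  have h3 := Real.add_one_le_exp (-(Real.exp (-1) * (l / (1 + l))))
  have h4 : 1 / (1 + l) = 1 - l / (1 + l) := by field_simp; ring
  have h5 := mul_le_mul_of_nonneg_right h2 (Real.exp_pos (-1)).le
  rw [h4] at h5
  linarith

/-! ### The random series ∑ c_k |g_k|: tail bounds and divergence. -/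

section GaussianSum

variable {Ω : Type*} [MeasurableSpace Ω] {P : Measure Ω} [IsProbabilityMeasure P]
  {g : ℤ → Ω → ℂ}

theorem lintegral_prod_norm (hg : ∀ k, HasLaw (g k) stdComplexGaussian P)
    (hg_indep : iIndepFun g P) (s : Finset ℤ) (φ : ℤ → ℂ → ℝ≥0∞) (hφ : ∀ k, Measurable (φ k)) :
    ∫⁻ ω, ∏ k ∈ s, φ k (g k ω) ∂P = ∏ k ∈ s, ∫⁻ z, φ k z ∂stdComplexGaussian := by
  have hae : ∀ᵐ ω ∂P, ∀ k, g k ω = (hg k).aemeasurable.mk _ ω :=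
    ae_all_iff.2 fun k => (hg k).aemeasurable.ae_eq_mk
  have h1 : ∫⁻ ω, ∏ k ∈ s, φ k (g k ω) ∂P
      = ∫⁻ ω, ∏ k ∈ s, φ k ((hg k).aemeasurable.mk _ ω) ∂P :=
    lintegral_congr_ae (hae.mono fun ω h => by simp only [h])
  have h2 : iIndepFun (fun k => (hg k).aemeasurable.mk (g k)) P :=
    hg_indep.congr fun k => (hg k).aemeasurable.ae_eq_mk
  rw [h1, lintegral_prod_eq_prod_lintegral_of_indepFun s
    (fun k ω => φ k ((hg k).aemeasurable.mk _ ω)) (h2.comp φ hφ)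
    (fun k => (hφ k).comp (hg k).aemeasurable.measurable_mk)]
  refine Finset.prod_congr rfl fun k _ => ?_
  rw [← (hg k).lintegral_comp (hφ k).aemeasurable]
  exact lintegral_congr_ae (hae.mono fun ω h => by simp only [h])

/-- The `FL¹` norm of the random initial datum. -/
def randomNorm (c : ℤ → ℝ) (g : ℤ → Ω → ℂ) (ω : Ω) : ℝ≥0∞ := ∑' k, ‖(c k : ℂ) * g k ω‖ₑ

theorem ofReal_sum_le_randomNorm {c : ℤ → ℝ} (hc : ∀ k, 0 ≤ c k) (s : Finset ℤ) (ω : Ω) :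
    ENNReal.ofReal (∑ k ∈ s, c k * ‖g k ω‖) ≤ randomNorm c g ω := by
  refine le_trans (le_of_eq ?_) (ENNReal.sum_le_tsum s)
  rw [ENNReal.ofReal_sum_of_nonneg fun k _ => mul_nonneg (hc k) (norm_nonneg _)]
  refine Finset.sum_congr rfl fun k _ => ?_
  rw [← ofReal_norm, norm_mul, Complex.norm_real, Real.norm_of_nonneg (hc k)]

/-- Among thresholds r_k with ∑ c_k r_k = a, the sum ∑ r_k² is least, equal to a²/σ, for r_k = a
c_k/σ, by Cauchy–Schwarz. Independence then gives the probability that every |g_k| exceeds its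
threshold. -/
theorem exp_neg_le_prob_randomNorm_finset (hg : ∀ k, HasLaw (g k) stdComplexGaussian P)
    (hg_indep : iIndepFun g P) {c : ℤ → ℝ} (hc : ∀ k, 0 ≤ c k) (s : Finset ℤ)
    (hs : 0 < ∑ k ∈ s, c k ^ 2) {a : ℝ} (ha : 0 ≤ a) :
    ENNReal.ofReal (Real.exp (-(a ^ 2 / ∑ k ∈ s, c k ^ 2)))
      ≤ P {ω | ENNReal.ofReal a < randomNorm c g ω} := by
  set σ := ∑ k ∈ s, c k ^ 2 with hσ
  set r : ℤ → ℝ := fun k => a / σ * c k with hr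
  have hr0 : ∀ k, 0 ≤ r k := fun k => mul_nonneg (div_nonneg ha hs.le) (hc k)
  have hm : ∀ k, MeasurableSet {z : ℂ | r k < ‖z‖} := fun k =>
    measurableSet_lt measurable_const measurable_norm
  have h := lintegral_prod_norm hg hg_indep s (fun k => {z | r k < ‖z‖}.indicator 1)
    (fun k => measurable_one.indicator (hm k))
  have hR : ∏ k ∈ s, ∫⁻ z, {z : ℂ | r k < ‖z‖}.indicator 1 z ∂stdComplexGaussian
      = ENNReal.ofReal (Real.exp (-(a ^ 2 / σ))) := by
    have : ∀ k ∈ s, ∫⁻ z, {z : ℂ | r k < ‖z‖}.indicator 1 z ∂stdComplexGaussian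
        = ENNReal.ofReal (Real.exp (-(r k) ^ 2)) := fun k _ => by
      rw [lintegral_indicator_one (hm k), stdComplexGaussian_lt_norm (hr0 k)]
    rw [Finset.prod_congr rfl this, ← ENNReal.ofReal_prod_of_nonneg fun _ _ => (Real.exp_pos _).le,
      ← Real.exp_sum]
    congr 2
    simp only [hr, mul_pow, Finset.sum_neg_distrib, ← Finset.mul_sum, ← hσ]
    field_simp
  rw [← hR, ← h]
  have hprod : ∀ ω, ∏ k ∈ s, {z : ℂ | r k < ‖z‖}.indicator (1 : ℂ → ℝ≥0∞) (g k ω)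
      ≤ {ω | ENNReal.ofReal a < randomNorm c g ω}.indicator 1 ω := by
    intro ω
    by_cases hω : ∀ k ∈ s, r k < ‖g k ω‖
    · have hmem : ω ∈ {ω | ENNReal.ofReal a < randomNorm c g ω} := by
        refine lt_of_lt_of_le ?_ (ofReal_sum_le_randomNorm hc s ω)
        have hlt : a < ∑ k ∈ s, c k * ‖g k ω‖ := by
          have hex : ∃ k ∈ s, 0 < c k := by
            by_contra! hcon
            have : σ = 0 := Finset.sum_eq_zero fun k hk => by
              rw [le_antisymm (hcon k hk) (hc k)]; norm_num
            exact hs.ne' this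
          obtain ⟨k, hk, hck⟩ := hex
          calc a = ∑ k ∈ s, c k * r k := by
                simp only [hr, ← mul_assoc, mul_comm _ (a / σ)]
                simp only [mul_assoc, ← sq, ← Finset.mul_sum, ← hσ]
                field_simp
            _ < ∑ k ∈ s, c k * ‖g k ω‖ :=
                Finset.sum_lt_sum (fun j hj => mul_le_mul_of_nonneg_left (hω j hj).le (hc j))
                  ⟨k, hk, mul_lt_mul_of_pos_left (hω k hk) hck⟩
        exact (ENNReal.ofReal_lt_ofReal_iff_of_nonneg ha).2 hlt
      rw [Set.indicator_of_mem hmem]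
      refine Finset.prod_le_one' fun k _ => ?_
      by_cases hk : g k ω ∈ {z : ℂ | r k < ‖z‖} <;> simp [hk]
    · push Not at hω
      obtain ⟨k, hk, hkr⟩ := hω
      rw [Finset.prod_eq_zero hk]
      · exact zero_le
      · exact Set.indicator_of_notMem (by simpa using hkr) _
  refine (lintegral_mono hprod).trans ?_
  exact lintegral_indicator_one_le _

theorem exp_neg_le_prob_randomNorm (hg : ∀ k, HasLaw (g k) stdComplexGaussian P)
    (hg_indep : iIndepFun g P) {c : ℤ → ℝ} (hc : ∀ k, 0 ≤ c k)
    (hc_sq : Summable fun k => c k ^ 2) (hpos : 0 < ∑' k, c k ^ 2) {a : ℝ} (ha : 0 ≤ a) :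
    ENNReal.ofReal (Real.exp (-(a ^ 2 / ∑' k, c k ^ 2)))
      ≤ P {ω | ENNReal.ofReal a < randomNorm c g ω} := by
  have h : Tendsto (fun s : Finset ℤ => ENNReal.ofReal (Real.exp (-(a ^ 2 / ∑ k ∈ s, c k ^ 2))))
      atTop (𝓝 (ENNReal.ofReal (Real.exp (-(a ^ 2 / ∑' k, c k ^ 2))))) := by
    refine ENNReal.tendsto_ofReal ((Real.continuous_exp.tendsto _).comp ?_)
    exact (tendsto_const_nhds.div hc_sq.hasSum hpos.ne').neg
  refine le_of_tendsto h ?_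
  filter_upwards [hc_sq.hasSum.eventually (lt_mem_nhds hpos)] with s hs
  exact exp_neg_le_prob_randomNorm_finset hg hg_indep hc s hs ha

theorem randomNorm_eq_iSup {c : ℤ → ℝ} (hc : ∀ k, 0 ≤ c k) (ω : Ω) :
    randomNorm c g ω = ⨆ s : Finset ℤ, ENNReal.ofReal (∑ k ∈ s, c k * ‖g k ω‖) := by
  rw [randomNorm, ENNReal.tsum_eq_iSup_sum]
  refine iSup_congr fun s => ?_
  rw [ENNReal.ofReal_sum_of_nonneg fun k _ => mul_nonneg (hc k) (norm_nonneg _)]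
  refine Finset.sum_congr rfl fun k _ => ?_
  rw [← ofReal_norm, norm_mul, Complex.norm_real, Real.norm_of_nonneg (hc k)]

/-- Chernoff's bound on finite partial sums, with `l` left free for later optimisation. The
hypothesis c ∈ ℓ¹ enters only through the term linear in `l`. -/
theorem prob_randomNorm_le (hg : ∀ k, HasLaw (g k) stdComplexGaussian P)
    (hg_indep : iIndepFun g P) {c : ℤ → ℝ} (hc : ∀ k, 0 ≤ c k)
    (hc_sq : Summable fun k => c k ^ 2) (hc1 : Summable c) {a l : ℝ} (ha : 0 ≤ a) (hl : 0 ≤ l) :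
    P {ω | ENNReal.ofReal a < randomNorm c g ω}
      ≤ ENNReal.ofReal (Real.exp (-(l * a) + l ^ 2 / 4 * ∑' k, c k ^ 2
          + √Real.pi * l * ∑' k, c k)) := by
  set B := Real.exp (l ^ 2 / 4 * ∑' k, c k ^ 2 + √Real.pi * l * ∑' k, c k) with hB
  have hfin : ∀ s : Finset ℤ, P {ω | a < ∑ k ∈ s, c k * ‖g k ω‖}
      ≤ ENNReal.ofReal (Real.exp (-(l * a)) * B) := by
    intro s
    have h := lintegral_prod_norm hg hg_indep s
      (fun k z => ENNReal.ofReal (Real.exp (l * c k * ‖z‖))) (fun k => by fun_prop)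
    have hbound : ∏ k ∈ s, ∫⁻ z, ENNReal.ofReal (Real.exp (l * c k * ‖z‖)) ∂stdComplexGaussian
        ≤ ENNReal.ofReal B := by
      refine (Finset.prod_le_prod' fun k _ =>
        lintegral_exp_mul_norm_stdComplexGaussian_le (mul_nonneg hl (hc k))).trans ?_
      rw [← ENNReal.ofReal_prod_of_nonneg fun _ _ => (Real.exp_pos _).le, ← Real.exp_sum]
      refine ENNReal.ofReal_le_ofReal (Real.exp_le_exp.2 ?_)
      rw [Finset.sum_add_distrib]
      have h1 := hc_sq.sum_le_tsum s (fun k _ => sq_nonneg _)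
      have h2 := hc1.sum_le_tsum s (fun k _ => hc k)
      have e1 : ∑ k ∈ s, (l * c k) ^ 2 / 4 = l ^ 2 / 4 * ∑ k ∈ s, c k ^ 2 := by
        rw [Finset.mul_sum]; exact Finset.sum_congr rfl fun k _ => by ring
      have e2 : ∑ k ∈ s, √Real.pi * (l * c k) = √Real.pi * l * ∑ k ∈ s, c k := by
        rw [Finset.mul_sum]; exact Finset.sum_congr rfl fun k _ => by ring
      rw [e1, e2]
      gcongr
    have hind : ∀ ω, {ω | a < ∑ k ∈ s, c k * ‖g k ω‖}.indicator 1 ω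
        ≤ ENNReal.ofReal (Real.exp (-(l * a))) *
          ∏ k ∈ s, ENNReal.ofReal (Real.exp (l * c k * ‖g k ω‖)) := by
      intro ω
      by_cases hω : a < ∑ k ∈ s, c k * ‖g k ω‖
      · rw [Set.indicator_of_mem (by exact hω),
          ← ENNReal.ofReal_prod_of_nonneg fun _ _ => (Real.exp_pos _).le, ← Real.exp_sum,
          ← ENNReal.ofReal_mul (Real.exp_pos _).le, ← Real.exp_add, Pi.one_apply,
          ← ENNReal.ofReal_one]
        refine ENNReal.ofReal_le_ofReal (Real.one_le_exp ?_)
        have : ∑ k ∈ s, l * c k * ‖g k ω‖ = l * ∑ k ∈ s, c k * ‖g k ω‖ := by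
          rw [Finset.mul_sum]; exact Finset.sum_congr rfl fun k _ => by ring
        rw [this]
        nlinarith
      · rw [Set.indicator_of_notMem (by exact hω)]; exact zero_le
    have hms : NullMeasurableSet {ω | a < ∑ k ∈ s, c k * ‖g k ω‖} P := by
      refine nullMeasurableSet_lt aemeasurable_const ?_
      exact Finset.aemeasurable_fun_sum s fun k _ => (hg k).aemeasurable.norm.const_mul _
    rw [← lintegral_indicator_one₀ hms]
    refine (lintegral_mono hind).trans ?_
    rw [lintegral_const_mul' _ _ ENNReal.ofReal_ne_top, h, ENNReal.ofReal_mul (Real.exp_pos _).le]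
    gcongr
  -- X is the supremum of its finite partial sums, so the event is a directed union and the uniform
  -- finite bound passes to it.
  have hset : {ω | ENNReal.ofReal a < randomNorm c g ω}
      = ⋃ s : Finset ℤ, {ω | a < ∑ k ∈ s, c k * ‖g k ω‖} := by
    ext ω
    simp only [Set.mem_ofPred_eq, Set.mem_iUnion, randomNorm_eq_iSup hc, lt_iSup_iff,
      ENNReal.ofReal_lt_ofReal_iff_of_nonneg ha]
  have hdir : Directed (· ⊆ ·) fun s : Finset ℤ => {ω | a < ∑ k ∈ s, c k * ‖g k ω‖} := by
    refine Monotone.directed_le fun s t hst ω (hω : a < _) => show a < _ from lt_of_lt_of_le hω ?_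
    exact Finset.sum_le_sum_of_subset_of_nonneg hst fun k _ _ => mul_nonneg (hc k) (norm_nonneg _)
  rw [hset, hdir.measure_iUnion, show -(l * a) + l ^ 2 / 4 * ∑' k, c k ^ 2
      + √Real.pi * l * ∑' k, c k = -(l * a) + (l ^ 2 / 4 * ∑' k, c k ^ 2
      + √Real.pi * l * ∑' k, c k) by ring, Real.exp_add]
  exact iSup_le hfin

/-- The expectation of e^{-X} is at most e^{-δ ∑_s c_k} for every finite s, hence zero when ∑ c_k
diverges. Square summability serves only to bound c_k by M, so that c_k/(1+c_k) ≥ c_k/(1+M). -/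
theorem ae_randomNorm_eq_top (hg : ∀ k, HasLaw (g k) stdComplexGaussian P)
    (hg_indep : iIndepFun g P) {c : ℤ → ℝ} (hc : ∀ k, 0 ≤ c k)
    (hc_sq : Summable fun k => c k ^ 2) (hc1 : ¬ Summable c) :
    ∀ᵐ ω ∂P, randomNorm c g ω = ∞ := by
  set M := √(∑' k, c k ^ 2) with hM
  have hM0 : 0 ≤ M := Real.sqrt_nonneg _
  have hcM : ∀ k, c k ≤ M := fun k => by
    rw [hM]; exact Real.le_sqrt_of_sq_le (hc_sq.le_tsum k fun _ _ => sq_nonneg _)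
  set δ := Real.exp (-1) / (1 + M) with hδ
  have hδ0 : 0 < δ := by positivity
  set Z : Ω → ℝ≥0∞ := fun ω => ⨅ s : Finset ℤ, ∏ k ∈ s, ENNReal.ofReal (Real.exp (-(c k * ‖g k ω‖)))
    with hZ
  have hfin : ∀ s : Finset ℤ, ∫⁻ ω, Z ω ∂P ≤ ENNReal.ofReal (Real.exp (-(δ * ∑ k ∈ s, c k))) := by
    intro s
    refine (lintegral_mono fun ω => iInf_le _ s).trans ?_
    rw [lintegral_prod_norm hg hg_indep s
      (fun k z => ENNReal.ofReal (Real.exp (-(c k * ‖z‖)))) (fun k => by fun_prop)]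
    refine (Finset.prod_le_prod' fun k _ =>
        lintegral_exp_neg_mul_norm_stdComplexGaussian_le (hc k)).trans ?_
    rw [← ENNReal.ofReal_prod_of_nonneg fun _ _ => (Real.exp_pos _).le, ← Real.exp_sum]
    refine ENNReal.ofReal_le_ofReal (Real.exp_le_exp.2 ?_)
    rw [Finset.sum_neg_distrib, neg_le_neg_iff, Finset.mul_sum]
    refine Finset.sum_le_sum fun k _ => ?_
    rw [hδ, div_mul_eq_mul_div, mul_div_assoc]
    gcongr
    · exact hc k
    · have := hc k; positivity
    · exact hcM k
  have hZ0 : ∫⁻ ω, Z ω ∂P = 0 := by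
    have hlim : Tendsto (fun s : Finset ℤ => ENNReal.ofReal (Real.exp (-(δ * ∑ k ∈ s, c k))))
        atTop (𝓝 0) := by
      rw [← ENNReal.ofReal_zero]
      refine ENNReal.tendsto_ofReal (Real.tendsto_exp_neg_atTop_nhds_zero.comp ?_)
      refine Tendsto.const_mul_atTop hδ0 ?_
      have hmono : Monotone fun s : Finset ℤ => ∑ k ∈ s, c k := fun s t hst =>
        Finset.sum_le_sum_of_subset_of_nonneg hst fun k _ _ => hc k
      refine tendsto_atTop_atTop_of_monotone hmono fun b => ?_
      by_contra! hb
      exact hc1 (summable_of_sum_le hc fun s => (hb s).le)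
    exact le_antisymm (ge_of_tendsto' hlim hfin) zero_le
  have hZm : AEMeasurable Z P := by
    refine AEMeasurable.iInf fun s => ?_
    refine Finset.aemeasurable_fun_prod s fun k _ => ?_
    have := (hg k).aemeasurable
    fun_prop
  filter_upwards [(lintegral_eq_zero_iff' hZm).1 hZ0] with ω hω
  by_contra htop
  set X := (randomNorm c g ω).toReal
  have hlow : ENNReal.ofReal (Real.exp (-X)) ≤ Z ω := by
    refine le_iInf fun s => ?_
    rw [← ENNReal.ofReal_prod_of_nonneg fun _ _ => (Real.exp_pos _).le, ← Real.exp_sum]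
    refine ENNReal.ofReal_le_ofReal (Real.exp_le_exp.2 ?_)
    rw [Finset.sum_neg_distrib, neg_le_neg_iff]
    exact (ENNReal.ofReal_le_iff_le_toReal htop).1 (ofReal_sum_le_randomNorm hc s ω)
  rw [hω] at hlow
  have := ENNReal.ofReal_pos.2 (Real.exp_pos (-X))
  exact absurd hlow (not_le.2 (by simpa using this))

end GaussianSum

/-! ### The cubic nonlinearity on ℓ¹ and its resonances. -/

/-- The Banach space `ℓ¹(ℤ; ℂ)`. -/
abbrev EllOne : Type := lp (fun _ : ℤ => ℂ) 1

theorem EllOne.hasSum_norm (a : EllOne) : HasSum (fun k => ‖a k‖) ‖a‖ := by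
  simpa using lp.hasSum_norm (p := 1) (by simp) a

/-- The oscillating factor of the interaction `(p₁, p₂, p₃) ↦ p₁ + p₂ - p₃`. -/
def phase (t : ℝ) (p : ℤ × ℤ × ℤ) : ℂ :=
  Complex.exp (Complex.I * ((2 * (p.1 - p.2.2) * (p.2.1 - p.2.2) : ℤ) : ℂ) * t)

theorem norm_phase (t : ℝ) (p : ℤ × ℤ × ℤ) : ‖phase t p‖ = 1 := by
  have : Complex.I * ((2 * (p.1 - p.2.2) * (p.2.1 - p.2.2) : ℤ) : ℂ) * t
      = (((2 * (p.1 - p.2.2) * (p.2.1 - p.2.2) : ℤ) * t : ℝ) : ℂ) * Complex.I := by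
    push_cast; ring
  rw [phase, this, Complex.norm_exp_ofReal_mul_I]

theorem continuous_phase (p : ℤ × ℤ × ℤ) : Continuous fun t => phase t p := by
  unfold phase; fun_prop

/-- One interaction of the cubic nonlinearity. -/
def triTerm (t : ℝ) (a b c : EllOne) (p : ℤ × ℤ × ℤ) : EllOne :=
  lp.single 1 (p.1 + p.2.1 - p.2.2) (phase t p * (a p.1 * b p.2.1 * starRingEnd ℂ (c p.2.2)))

/-- The cubic nonlinearity in the interaction picture, as a trilinear map on `ℓ¹`. -/
def tri (t : ℝ) (a b c : EllOne) : EllOne := ∑' p, triTerm t a b c p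

theorem norm_triTerm (t : ℝ) (a b c : EllOne) (p : ℤ × ℤ × ℤ) :
    ‖triTerm t a b c p‖ = ‖a p.1‖ * (‖b p.2.1‖ * ‖c p.2.2‖) := by
  rw [triTerm, lp.norm_single (by simp), norm_mul, norm_phase, one_mul, norm_mul, norm_mul,
    RCLike.norm_conj, mul_assoc]

theorem hasSum_mul_mul {ι : Type*} {f g h : ι → ℝ} {x y z : ℝ} (hf : HasSum f x) (hg : HasSum g y)
    (hh : HasSum h z) (hf0 : ∀ i, 0 ≤ f i) (hg0 : ∀ i, 0 ≤ g i) (hh0 : ∀ i, 0 ≤ h i) :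
    HasSum (fun p : ι × ι × ι => f p.1 * (g p.2.1 * h p.2.2)) (x * (y * z)) := by
  have hgh : Summable fun q : ι × ι => g q.1 * h q.2 :=
    hg.summable.mul_of_nonneg hh.summable hg0 hh0
  exact hf.mul (hg.mul hh hgh)
    (hf.summable.mul_of_nonneg (g := fun q : ι × ι => g q.1 * h q.2) hgh hf0
      fun q => mul_nonneg (hg0 _) (hh0 _))

theorem triTerm_eq_smul (t : ℝ) (a b c : EllOne) (p : ℤ × ℤ × ℤ) :
    triTerm t a b c p = phase t p •
      (lp.single 1 (p.1 + p.2.1 - p.2.2) (a p.1 * b p.2.1 * starRingEnd ℂ (c p.2.2)) : EllOne) := by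
  rw [triTerm, ← smul_eq_mul, lp.single_smul]

theorem continuous_triTerm (a b c : EllOne) (p : ℤ × ℤ × ℤ) :
    Continuous fun t => triTerm t a b c p := by
  simp_rw [triTerm_eq_smul]
  exact (continuous_phase p).smul continuous_const

/-- Each interaction occupies a single mode and the phase has modulus 1, so the sum of norms
factors. This is the algebra property of ℓ¹ under convolution, uniform in time. -/
theorem hasSum_norm_triTerm (t : ℝ) (a b c : EllOne) :
    HasSum (fun p => ‖triTerm t a b c p‖) (‖a‖ * (‖b‖ * ‖c‖)) := by
  simp_rw [norm_triTerm]
  exact hasSum_mul_mul (f := fun k => ‖a k‖) (g := fun k => ‖b k‖) (h := fun k => ‖c k‖)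
    (EllOne.hasSum_norm a) (EllOne.hasSum_norm b) (EllOne.hasSum_norm c)
    (fun _ => norm_nonneg _) (fun _ => norm_nonneg _) (fun _ => norm_nonneg _)

theorem summable_triTerm (t : ℝ) (a b c : EllOne) : Summable (triTerm t a b c) :=
  (hasSum_norm_triTerm t a b c).summable.of_norm

theorem norm_tri_le (t : ℝ) (a b c : EllOne) : ‖tri t a b c‖ ≤ ‖a‖ * (‖b‖ * ‖c‖) := by
  rw [← (hasSum_norm_triTerm t a b c).tsum_eq]
  exact norm_tsum_le_tsum_norm (hasSum_norm_triTerm t a b c).summable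

theorem continuous_tri (a b c : EllOne) : Continuous fun t => tri t a b c := by
  refine continuous_tsum (fun p => ?_) (hasSum_norm_triTerm 0 a b c).summable fun p t => ?_
  · exact continuous_triTerm a b c p
  · rw [norm_triTerm, norm_triTerm]

theorem tri_sub_left (t : ℝ) (a a' b c : EllOne) :
    tri t (a - a') b c = tri t a b c - tri t a' b c := by
  rw [tri, tri, tri, ← (summable_triTerm t a b c).tsum_sub (summable_triTerm t a' b c)]
  refine tsum_congr fun p => ?_
  rw [triTerm, triTerm, triTerm, ← lp.single_sub]
  congr 1
  simp only [lp.coeFn_sub, Pi.sub_apply]; ring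

theorem tri_sub_mid (t : ℝ) (a b b' c : EllOne) :
    tri t a (b - b') c = tri t a b c - tri t a b' c := by
  rw [tri, tri, tri, ← (summable_triTerm t a b c).tsum_sub (summable_triTerm t a b' c)]
  refine tsum_congr fun p => ?_
  rw [triTerm, triTerm, triTerm, ← lp.single_sub]
  congr 1
  simp only [lp.coeFn_sub, Pi.sub_apply]; ring

theorem tri_sub_right (t : ℝ) (a b c c' : EllOne) :
    tri t a b (c - c') = tri t a b c - tri t a b c' := by
  rw [tri, tri, tri, ← (summable_triTerm t a b c).tsum_sub (summable_triTerm t a b c')]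
  refine tsum_congr fun p => ?_
  rw [triTerm, triTerm, triTerm, ← lp.single_sub]
  congr 1
  simp only [lp.coeFn_sub, Pi.sub_apply, map_sub]; ring

theorem norm_tri_sub_tri_le (t : ℝ) {a b : EllOne} {R : ℝ} (ha : ‖a‖ ≤ R) (hb : ‖b‖ ≤ R) :
    ‖tri t a a a - tri t b b b‖ ≤ 3 * R ^ 2 * ‖a - b‖ := by
  have h : tri t a a a - tri t b b b
      = tri t (a - b) a a + tri t b (a - b) a + tri t b b (a - b) := by
    rw [tri_sub_left, tri_sub_mid, tri_sub_right]; abel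
  have hR : 0 ≤ R := (norm_nonneg a).trans ha
  have hd := norm_nonneg (a - b)
  rw [h]
  calc _ ≤ ‖tri t (a - b) a a‖ + ‖tri t b (a - b) a‖ + ‖tri t b b (a - b)‖ := norm_add₃_le
    _ ≤ ‖a - b‖ * (R * R) + R * (‖a - b‖ * R) + R * (R * ‖a - b‖) := by
        gcongr
        · refine (norm_tri_le _ _ _ _).trans ?_; gcongr
        · refine (norm_tri_le _ _ _ _).trans ?_; gcongr
        · refine (norm_tri_le _ _ _ _).trans ?_; gcongr
    _ = _ := by ring

/-- The frequency k² - p₁² - p₂² + p₃² with k = p₁ + p₂ - p₃ factors as 2(p₁ - p₃)(p₂ - p₃). It is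
an integer, so a nonzero value integrates to 0 over 2π, and it vanishes only for trivial
interactions. -/
theorem integral_phase (s : ℝ) (p : ℤ × ℤ × ℤ) :
    ∫ t in s..(s + 2 * Real.pi), phase t p
      = if p.1 = p.2.2 ∨ p.2.1 = p.2.2 then ((2 * Real.pi : ℝ) : ℂ) else 0 := by
  set n : ℤ := 2 * (p.1 - p.2.2) * (p.2.1 - p.2.2) with hn
  by_cases h : p.1 = p.2.2 ∨ p.2.1 = p.2.2
  · have h0 : n = 0 := by rcases h with h | h <;> simp [hn, h]
    have : ∀ t, phase t p = 1 := fun t => by rw [phase, ← hn, h0]; simp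
    simp [this, h]
  · have h0 : n ≠ 0 := by
      push Not at h
      exact mul_ne_zero (mul_ne_zero two_ne_zero (sub_ne_zero.2 h.1)) (sub_ne_zero.2 h.2)
    have h0' : Complex.I * (n : ℂ) ≠ 0 := mul_ne_zero Complex.I_ne_zero (by exact_mod_cast h0)
    rw [if_neg h]
    simp only [phase, ← hn]
    rw [integral_exp_mul_complex h0', div_eq_zero_iff, sub_eq_zero]
    left
    rw [Complex.exp_eq_exp_iff_exists_int]
    exact ⟨n, by push_cast; ring⟩

theorem hasSum_integral_triTerm (s r : ℝ) (a b c : EllOne) :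
    HasSum (fun p => ∫ t in s..r, triTerm t a b c p) (∫ t in s..r, tri t a b c) := by
  refine intervalIntegral.hasSum_integral_of_dominated_convergence
    (fun p _ => ‖triTerm 0 a b c p‖) (fun p => ?_) (fun p => ?_) ?_ ?_ ?_
  · exact (continuous_triTerm a b c p).aestronglyMeasurable
  · exact ae_of_all _ fun t _ => by rw [norm_triTerm, norm_triTerm]
  · exact ae_of_all _ fun t _ => (hasSum_norm_triTerm 0 a b c).summable
  · exact continuous_const.intervalIntegrable _ _
  · exact ae_of_all _ fun t _ => (summable_triTerm t a b c).hasSum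

/-- Only resonant interactions survive the average over one period, and they act on each mode by
multiplication by a real number. -/
theorem exists_integral_tri_eq (s : ℝ) (v : EllOne) : ∃ θ : ℤ → ℝ, (∀ k, |θ k| ≤ 2 * ‖v‖ ^ 2) ∧
    ∀ k, (∫ t in s..(s + 2 * Real.pi), tri t v v v) k
      = ((2 * Real.pi * θ k : ℝ) : ℂ) * v k := by
  set r : ℤ → ℤ × ℤ × ℤ → ℝ := fun k p =>
    if p.1 + p.2.1 - p.2.2 = k ∧ (p.1 = p.2.2 ∨ p.2.1 = p.2.2) then ‖v p.2.2‖ ^ 2 else 0 with hr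
  have hsq : Summable fun j => ‖v j‖ ^ 2 := by
    refine Summable.of_nonneg_of_le (fun _ => by positivity) (fun j => ?_)
      (v.hasSum_norm.summable.mul_left ‖v‖)
    rw [sq]; gcongr; exact lp.norm_apply_le_norm one_ne_zero v j
  have hsq_le : ∑' j, ‖v j‖ ^ 2 ≤ ‖v‖ ^ 2 := by
    rw [sq, ← v.hasSum_norm.tsum_eq, ← tsum_mul_left]
    refine hsq.tsum_le_tsum (fun j => ?_) (v.hasSum_norm.summable.mul_left _)
    rw [sq, v.hasSum_norm.tsum_eq]; gcongr; exact lp.norm_apply_le_norm one_ne_zero v j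
  have hi1 : ∀ k : ℤ, Function.Injective fun j : ℤ => ((j, k, j) : ℤ × ℤ × ℤ) := fun k i j h => by
    simpa using congrArg Prod.fst h
  have hi2 : ∀ k : ℤ, Function.Injective fun j : ℤ => ((k, j, j) : ℤ × ℤ × ℤ) := fun k i j h => by
    simpa using congrArg (fun q => q.2.1) h
  have hs1 : ∀ k, HasSum (fun p : ℤ × ℤ × ℤ => if p.2.1 = k ∧ p.1 = p.2.2 then ‖v p.2.2‖ ^ 2 else 0)
      (∑' j, ‖v j‖ ^ 2) := fun k => by
    rw [← (hi1 k).hasSum_iff]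
    · simpa [Function.comp_def] using hsq.hasSum
    · rintro ⟨p1, p2, p3⟩ hp
      refine if_neg ?_
      rintro ⟨h1, h2⟩
      exact hp ⟨p1, by simp_all⟩
  have hs2 : ∀ k, HasSum (fun p : ℤ × ℤ × ℤ => if p.1 = k ∧ p.2.1 = p.2.2 then ‖v p.2.2‖ ^ 2 else 0)
      (∑' j, ‖v j‖ ^ 2) := fun k => by
    rw [← (hi2 k).hasSum_iff]
    · simpa [Function.comp_def] using hsq.hasSum
    · rintro ⟨p1, p2, p3⟩ hp
      refine if_neg ?_
      rintro ⟨h1, h2⟩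
      exact hp ⟨p2, by simp_all⟩
  have hr0 : ∀ k p, 0 ≤ r k p := fun k p => by simp only [hr]; split_ifs <;> positivity
  -- A resonant triple with output k is (j, k, j) or (k, j, j). The triple (k, k, k) is counted
  -- twice on the right, which is harmless for an upper bound and gives the factor 2 in |θ k| ≤
  -- 2‖v‖².
  have hrle : ∀ k p, r k p ≤ (if p.2.1 = k ∧ p.1 = p.2.2 then ‖v p.2.2‖ ^ 2 else 0)
      + (if p.1 = k ∧ p.2.1 = p.2.2 then ‖v p.2.2‖ ^ 2 else 0) := fun k p => by
    obtain ⟨p1, p2, p3⟩ := p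
    simp only [hr]
    by_cases h : p1 + p2 - p3 = k ∧ (p1 = p3 ∨ p2 = p3)
    · rw [if_pos h]
      rcases h with ⟨h1, h2 | h2⟩
      · rw [if_pos (show p2 = k ∧ p1 = p3 from ⟨by omega, h2⟩)]
        exact le_add_of_nonneg_right (by split_ifs <;> positivity)
      · rw [if_pos (show p1 = k ∧ p2 = p3 from ⟨by omega, h2⟩)]
        exact le_add_of_nonneg_left (by split_ifs <;> positivity)
    · rw [if_neg h]
      refine add_nonneg ?_ ?_ <;> split_ifs <;> positivity
  have hrs : ∀ k, Summable (r k) := fun k =>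
    Summable.of_nonneg_of_le (hr0 k) (hrle k) ((hs1 k).add (hs2 k)).summable
  refine ⟨fun k => ∑' p, r k p, fun k => ?_, fun k => ?_⟩
  · rw [abs_of_nonneg (tsum_nonneg (hr0 k))]
    have := (hrs k).tsum_le_tsum (hrle k) ((hs1 k).add (hs2 k)).summable
    rw [((hs1 k).add (hs2 k)).tsum_eq] at this
    linarith
  · have h1 := (hasSum_integral_triTerm s (s + 2 * Real.pi) v v v).mapL
      (lp.evalCLM ℂ (fun _ : ℤ => ℂ) 1 k)
    have h2 : HasSum (fun p => (((2 * Real.pi * r k p : ℝ) : ℂ) * v k))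
        (((2 * Real.pi * ∑' p, r k p : ℝ) : ℂ) * v k) := by
      refine HasSum.mul_right _ ?_
      exact_mod_cast ((hrs k).hasSum.mul_left (2 * Real.pi))
    refine HasSum.unique h1 (h2.congr_fun ?_)
    rintro ⟨p1, p2, p3⟩
    simp only [triTerm_eq_smul]
    rw [intervalIntegral.integral_smul_const, integral_phase, map_smul, smul_eq_mul]
    change _ * (Pi.single (p1 + p2 - p3) (v p1 * v p2 * starRingEnd ℂ (v p3)) : ℤ → ℂ) k = _
    rw [Pi.single_apply]
    simp only [hr]
    by_cases hk : p1 + p2 - p3 = k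
    · by_cases hp : p1 = p3 ∨ p2 = p3
      · rw [if_pos hp, if_pos hk.symm, if_pos ⟨hk, hp⟩]
        have hconj := Complex.mul_conj' (v p3)
        rcases hp with h | h
        · obtain rfl : p2 = k := by omega
          rw [h, mul_right_comm (v p3), hconj]; push_cast; ring
        · obtain rfl : p1 = k := by omega
          rw [h, mul_assoc (v p1), hconj]; push_cast; ring
      · simp only [hp, and_false, if_false]; simp
    · simp only [hk, Ne.symm hk, false_and, if_false]; simp

/-! ### The ℓ¹ flow over one period. -/

/-- The vector field of the cubic Schrödinger equation in the interaction picture. -/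
def nlsField (κ : ℝ) (t : ℝ) (v : EllOne) : EllOne := (-(Complex.I * (κ : ℂ))) • tri t v v v

theorem continuous_nlsField (κ : ℝ) (v : EllOne) : Continuous fun t => nlsField κ t v :=
  (continuous_tri v v v).const_smul (-(Complex.I * (κ : ℂ)))

theorem norm_nlsField_le {κ : ℝ} (hκ : 0 ≤ κ) (t : ℝ) {v : EllOne} {R : ℝ} (hv : ‖v‖ ≤ R) :
    ‖nlsField κ t v‖ ≤ κ * R ^ 3 := by
  rw [nlsField, norm_smul, norm_neg, norm_mul, Complex.norm_I, one_mul, Complex.norm_real,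
    Real.norm_of_nonneg hκ]
  gcongr
  refine (norm_tri_le _ _ _ _).trans ?_
  have := norm_nonneg v
  have hR := this.trans hv
  rw [pow_succ', sq]
  gcongr

theorem norm_nlsField_sub_le {κ : ℝ} (hκ : 0 ≤ κ) (t : ℝ) {v w : EllOne} {R : ℝ}
    (hv : ‖v‖ ≤ R) (hw : ‖w‖ ≤ R) :
    ‖nlsField κ t v - nlsField κ t w‖ ≤ κ * (3 * R ^ 2) * ‖v - w‖ := by
  rw [nlsField, nlsField, ← smul_sub, norm_smul, norm_neg, norm_mul, Complex.norm_I, one_mul,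
    Complex.norm_real, Real.norm_of_nonneg hκ, mul_assoc]
  gcongr
  exact norm_tri_sub_tri_le t hv hw

/-- Picard iteration in the ball of radius R about v₀, hence inside the ball of radius 2R. The field
is at most κ(2R)³ there, and over time 2π the displacement 16πκR³ is at most R by the smallness
hypothesis. -/
theorem exists_flow {κ R : ℝ} (hκ : 0 ≤ κ) (hsmall : 16 * Real.pi * κ * R ^ 2 ≤ 1)
    (v₀ : EllOne) (hv₀ : ‖v₀‖ ≤ R) (a : ℝ) :
    ∃ v : ℝ → EllOne, Continuous v ∧ v a = v₀ ∧ (∀ t, ‖v t‖ ≤ 2 * R) ∧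
      ContinuousOn (fun t => nlsField κ t (v t)) (Set.Icc a (a + 2 * Real.pi)) ∧
      ∀ t ∈ Set.Icc a (a + 2 * Real.pi), v t = v₀ + ∫ r in a..t, nlsField κ r (v r) := by
  have hR : 0 ≤ R := (norm_nonneg _).trans hv₀
  have hπ := Real.pi_pos
  have hab : a ≤ a + 2 * Real.pi := by linarith
  have hball : ∀ x ∈ Metric.closedBall v₀ R, ‖x‖ ≤ 2 * R := fun x hx => by
    have h1 : ‖x - v₀‖ ≤ R := by simpa [dist_eq_norm] using hx
    have h2 := norm_le_norm_add_norm_sub v₀ x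
    rw [norm_sub_rev] at h2
    linarith [norm_sub_rev v₀ x]
  have hmem : a ∈ Set.Icc a (a + 2 * Real.pi) := Set.left_mem_Icc.2 hab
  obtain ⟨R', hR'⟩ : ∃ R' : ℝ≥0, (R' : ℝ) = R := ⟨⟨R, hR⟩, rfl⟩
  obtain ⟨L, hL⟩ : ∃ L : ℝ≥0, (L : ℝ) = κ * (2 * R) ^ 3 := ⟨⟨_, by positivity⟩, rfl⟩
  obtain ⟨K, hK⟩ : ∃ K : ℝ≥0, (K : ℝ) = κ * (3 * (2 * R) ^ 2) := ⟨⟨_, by positivity⟩, rfl⟩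
  rw [← hR'] at hball
  have hPL : IsPicardLindelof (nlsField κ) (tmin := a) (tmax := a + 2 * Real.pi)
      ⟨a, hmem⟩ v₀ R' 0 L K :=
    { lipschitzOnWith := fun t _ => LipschitzOnWith.of_dist_le_mul fun x hx y hy => by
        rw [dist_eq_norm, dist_eq_norm, hK, ← hR']
        exact norm_nlsField_sub_le hκ t (hball x hx) (hball y hy)
      continuousOn := fun x _ => (continuous_nlsField κ x).continuousOn
      norm_le := fun t _ x hx => by
        rw [hL, ← hR']
        exact norm_nlsField_le hκ t (hball x hx)
      mul_max_le := by
        have : max (a + 2 * Real.pi - a) (a - a) = 2 * Real.pi := by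
          rw [add_sub_cancel_left, sub_self, max_eq_left]; positivity
        simp only [NNReal.coe_zero, sub_zero, this, hL, hR']
        calc κ * (2 * R) ^ 3 * (2 * Real.pi) = 16 * Real.pi * κ * R ^ 2 * R := by ring
          _ ≤ 1 * R := by gcongr
          _ = R := one_mul R }
  obtain ⟨α, hα⟩ := ODE.FunSpace.exists_isFixedPt_next hPL (x := v₀) (by simp)
  refine ⟨α.compProj, α.continuous_compProj, ?_, fun t => hR' ▸ hball _
    (α.compProj_mem_closedBall hPL.mul_max_le), α.continuousOn_comp_compProj hPL, fun t ht => ?_⟩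
  · have := ODE.FunSpace.next_apply₀ hPL (x := v₀) (by simp) α
    rw [hα] at this
    rwa [ODE.FunSpace.compProj_of_mem hmem]
  · rw [ODE.FunSpace.compProj_of_mem ht]
    conv_lhs => rw [← hα]
    rfl

theorem norm_flow_sub_le {κ R a t : ℝ} (hκ : 0 ≤ κ) {v : ℝ → EllOne} (hvR : ∀ t, ‖v t‖ ≤ 2 * R)
    (hv : v t = v a + ∫ r in a..t, nlsField κ r (v r)) :
    ‖v t - v a‖ ≤ κ * (2 * R) ^ 3 * |t - a| := by
  rw [hv, add_sub_cancel_left]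
  exact intervalIntegral.norm_integral_le_of_norm_le_const fun r _ =>
    norm_nlsField_le hκ r (hvR r)

/-- Over one period the `ℓ¹` norm changes only at second order. -/
theorem norm_flow_period_le {κ R a : ℝ} (hκ : 0 ≤ κ) {v : ℝ → EllOne} (hv₀ : ‖v a‖ ≤ R)
    (hvR : ∀ t, ‖v t‖ ≤ 2 * R)
    (hc : ContinuousOn (fun t => nlsField κ t (v t)) (Set.Icc a (a + 2 * Real.pi)))
    (hv : ∀ t ∈ Set.Icc a (a + 2 * Real.pi), v t = v a + ∫ r in a..t, nlsField κ r (v r)) :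
    ‖v (a + 2 * Real.pi)‖ ≤ ‖v a‖ + 400 * Real.pi ^ 2 * κ ^ 2 * R ^ 5 := by
  have hR : 0 ≤ R := (norm_nonneg _).trans hv₀
  have hπ := Real.pi_pos
  have hab : a ≤ a + 2 * Real.pi := by linarith
  have hi1 : IntervalIntegrable (fun t => nlsField κ t (v t)) volume a (a + 2 * Real.pi) := by
    refine ContinuousOn.intervalIntegrable ?_
    rwa [Set.uIcc_of_le hab]
  have hi2 : IntervalIntegrable (fun t => nlsField κ t (v a)) volume a (a + 2 * Real.pi) :=
    (continuous_nlsField κ (v a)).intervalIntegrable _ _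
  -- The argument of the field is frozen at its initial value. The frozen integral is the resonant
  -- average, and the remainder is of second order: the Lipschitz constant times the displacement.
  have hdecomp : v (a + 2 * Real.pi)
      = (v a + ∫ r in a..(a + 2 * Real.pi), nlsField κ r (v a))
        + ∫ r in a..(a + 2 * Real.pi), (nlsField κ r (v r) - nlsField κ r (v a)) := by
    rw [intervalIntegral.integral_sub hi1 hi2, hv _ ⟨hab, le_rfl⟩]; abel
  have herr : ‖∫ r in a..(a + 2 * Real.pi), (nlsField κ r (v r) - nlsField κ r (v a))‖
      ≤ κ * (3 * (2 * R) ^ 2) * (κ * (2 * R) ^ 3 * (2 * Real.pi)) * |a + 2 * Real.pi - a| := by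
    refine intervalIntegral.norm_integral_le_of_norm_le_const fun r hr => ?_
    rw [Set.uIoc_of_le hab] at hr
    refine (norm_nlsField_sub_le hκ r (hvR r) (hvR a)).trans ?_
    gcongr
    refine (norm_flow_sub_le hκ hvR (hv r ⟨hr.1.le, hr.2⟩)).trans ?_
    gcongr
    rw [abs_of_nonneg] <;> linarith [hr.1, hr.2]
  have hmain : ‖v a + ∫ r in a..(a + 2 * Real.pi), nlsField κ r (v a)‖
      ≤ (1 + (κ * (2 * Real.pi * (2 * ‖v a‖ ^ 2))) ^ 2) * ‖v a‖ := by
    obtain ⟨θ, hθ, hθv⟩ := exists_integral_tri_eq a (v a)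
    have hk : ∀ k, ‖(v a + ∫ r in a..(a + 2 * Real.pi), nlsField κ r (v a)) k‖
        ≤ (1 + (κ * (2 * Real.pi * (2 * ‖v a‖ ^ 2))) ^ 2) * ‖v a k‖ := by
      intro k
      simp only [nlsField]
      rw [intervalIntegral.integral_smul, lp.coeFn_add, Pi.add_apply, lp.coeFn_smul, Pi.smul_apply,
        hθv, smul_eq_mul]
      set x : ℝ := κ * (2 * Real.pi * θ k) with hx
      have e : v a k + -(Complex.I * (κ : ℂ)) * (((2 * Real.pi * θ k : ℝ) : ℂ) * v a k)
          = (1 - (x : ℂ) * Complex.I) * v a k := by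
        rw [hx]; push_cast; ring
      rw [e, norm_mul]
      gcongr
      -- The resonant increment is orthogonal to v_k in ℂ, so the first-order change of the modulus
      -- vanishes.
      have h1 : ‖(1 : ℂ) - (x : ℂ) * Complex.I‖ ≤ 1 + x ^ 2 := by
        rw [← abs_of_nonneg (norm_nonneg _), ← abs_of_nonneg (show (0 : ℝ) ≤ 1 + x ^ 2 by positivity),
          ← sq_le_sq, ← Complex.normSq_eq_norm_sq, Complex.normSq_apply]
        simp
        nlinarith [sq_nonneg x, sq_nonneg (x ^ 2)]
      refine h1.trans ?_
      have h2 : |x| ≤ κ * (2 * Real.pi * (2 * ‖v a‖ ^ 2)) := by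
        rw [hx, abs_mul, abs_of_nonneg hκ, abs_mul, abs_of_nonneg (by positivity : 0 ≤ 2 * Real.pi)]
        have := hθ k
        gcongr
      have := sq_le_sq' (neg_le_of_abs_le h2) (le_of_abs_le h2)
      linarith
    exact hasSum_le hk (EllOne.hasSum_norm _) ((v a).hasSum_norm.mul_left _)
  rw [hdecomp]
  refine (norm_add_le _ _).trans ((add_le_add hmain herr).trans ?_)
  rw [add_sub_cancel_left, abs_of_pos (by positivity : 0 < 2 * Real.pi)]
  have h1 : (κ * (2 * Real.pi * (2 * ‖v a‖ ^ 2))) ^ 2 * ‖v a‖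
      ≤ (κ * (2 * Real.pi * (2 * R ^ 2))) ^ 2 * R := by gcongr
  -- The resonant part contributes 16π²κ²R⁵ and the remainder 12 · 8 · (2π)² κ²R⁵ = 384π²κ²R⁵.
  nlinarith

/-! ### Free waves and the homogeneous L⁴ inequality. -/

/-- The free Schrödinger evolution of the trigonometric polynomial with coefficients `a` on `K`. -/
def freeWave (K : Finset ℤ) (a : ℤ → ℂ) (t : ℝ) (x : Torus) : ℂ :=
  ∑ k ∈ K, a k * Complex.exp (-(Complex.I * (k : ℂ) ^ 2 * t)) * fourier k x

theorem norm_exp_neg_I_mul (k : ℤ) (t : ℝ) :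
    ‖Complex.exp (-(Complex.I * (k : ℂ) ^ 2 * t))‖ = 1 := by
  have : -(Complex.I * (k : ℂ) ^ 2 * t) = ((-(k ^ 2 * t) : ℝ) : ℂ) * Complex.I := by
    push_cast; ring
  rw [this, Complex.norm_exp_ofReal_mul_I]

theorem norm_exp_I_mul (k : ℤ) (t : ℝ) :
    ‖Complex.exp (Complex.I * (k : ℂ) ^ 2 * t)‖ = 1 := by
  have : Complex.I * (k : ℂ) ^ 2 * t = ((k ^ 2 * t : ℝ) : ℂ) * Complex.I := by
    push_cast; ring
  rw [this, Complex.norm_exp_ofReal_mul_I]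

theorem conj_exp_neg_I_mul (k : ℤ) (t : ℝ) :
    starRingEnd ℂ (Complex.exp (-(Complex.I * (k : ℂ) ^ 2 * t)))
      = Complex.exp (Complex.I * (k : ℂ) ^ 2 * t) := by
  rw [← Complex.exp_conj]; congr 1; simp

theorem continuous_freeWave (K : Finset ℤ) (a : ℤ → ℂ) :
    Continuous fun p : ℝ × Torus => freeWave K a p.1 p.2 := by
  unfold freeWave
  refine continuous_finsetSum _ fun k _ => ?_
  refine Continuous.mul (by fun_prop) ((fourier k).continuous.comp continuous_snd)

theorem continuous_freeWave_apply (K : Finset ℤ) (a : ℤ → ℂ) (t : ℝ) :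
    Continuous (freeWave K a t) :=
  continuous_finsetSum _ fun k _ => continuous_const.mul (fourier k).continuous

theorem integral_fourier (n : ℤ) :
    ∫ x : Torus, fourier n x ∂torusMeasure = if n = 0 then 1 else 0 := by
  have h : fourierCoeff (fourier n : Torus → ℂ) 0 = ∫ x : Torus, fourier n x ∂torusMeasure := by
    simp [fourierCoeff]
  rw [← h, fourierCoeff_fourier, Pi.single_apply]
  simp [eq_comm]

theorem integral_exp_int_mul (s : ℝ) (n : ℤ) :
    ∫ t in s..(s + 2 * Real.pi), Complex.exp (-(Complex.I * (n : ℂ) * t))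
      = if n = 0 then ((2 * Real.pi : ℝ) : ℂ) else 0 := by
  split_ifs with h
  · simp [h]
  · have h0' : -(Complex.I * (n : ℂ)) ≠ 0 :=
      neg_ne_zero.2 (mul_ne_zero Complex.I_ne_zero (by exact_mod_cast h))
    have e : ∀ t : ℝ, -(Complex.I * (n : ℂ) * t) = -(Complex.I * (n : ℂ)) * t := fun t => by ring
    simp_rw [e]
    rw [integral_exp_mul_complex h0', div_eq_zero_iff, sub_eq_zero]
    left
    rw [Complex.exp_eq_exp_iff_exists_int]
    exact ⟨-n, by push_cast; ring⟩

theorem norm_freeWave_pow_four (K : Finset ℤ) (a : ℤ → ℂ) (t : ℝ) (x : Torus) :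
    ((‖freeWave K a t x‖ ^ 4 : ℝ) : ℂ)
      = ∑ q ∈ (K ×ˢ K) ×ˢ (K ×ˢ K), (a q.1.1 * a q.1.2 *
          (starRingEnd ℂ (a q.2.1) * starRingEnd ℂ (a q.2.2))) *
        (Complex.exp (-(Complex.I * ((q.1.1 ^ 2 + q.1.2 ^ 2 - q.2.1 ^ 2 - q.2.2 ^ 2 : ℤ) : ℂ) * t)) *
          fourier (q.1.1 + q.1.2 - q.2.1 - q.2.2) x) := by
  have h : ((‖freeWave K a t x‖ ^ 4 : ℝ) : ℂ)
      = (freeWave K a t x * freeWave K a t x) *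
        (starRingEnd ℂ (freeWave K a t x) * starRingEnd ℂ (freeWave K a t x)) := by
    have := Complex.mul_conj' (freeWave K a t x)
    calc ((‖freeWave K a t x‖ ^ 4 : ℝ) : ℂ) = ((‖freeWave K a t x‖ : ℂ) ^ 2) ^ 2 := by
          push_cast; ring
      _ = _ := by rw [← this]; ring
  rw [h]
  simp only [freeWave, map_sum]
  rw [Finset.sum_mul_sum, Finset.sum_mul_sum, ← Finset.sum_product', ← Finset.sum_product',
    Finset.sum_mul_sum, ← Finset.sum_product']
  refine Finset.sum_congr rfl fun q _ => ?_
  simp only [map_mul, conj_exp_neg_I_mul, ← fourier_neg]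
  have e1 : Complex.exp (-(Complex.I * ((q.1.1 ^ 2 + q.1.2 ^ 2 - q.2.1 ^ 2 - q.2.2 ^ 2 : ℤ) : ℂ) * t))
      = Complex.exp (-(Complex.I * (q.1.1 : ℂ) ^ 2 * t)) *
        Complex.exp (-(Complex.I * (q.1.2 : ℂ) ^ 2 * t)) *
        (Complex.exp (Complex.I * (q.2.1 : ℂ) ^ 2 * t) *
          Complex.exp (Complex.I * (q.2.2 : ℂ) ^ 2 * t)) := by
    rw [← Complex.exp_add, ← Complex.exp_add, ← Complex.exp_add]
    congr 1; push_cast; ring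
  have e2 : (fourier (q.1.1 + q.1.2 - q.2.1 - q.2.2) x : ℂ)
      = fourier q.1.1 x * fourier q.1.2 x * (fourier (-q.2.1) x * fourier (-q.2.2) x) := by
    rw [← fourier_add, ← fourier_add, ← fourier_add,
      show q.1.1 + q.1.2 + (-q.2.1 + -q.2.2) = q.1.1 + q.1.2 - q.2.1 - q.2.2 by ring]
  rw [e1, e2]; ring

/-- Expanding |w|⁴ and integrating over space and time keeps only k + l = m + n with k² + l² = m² +
n², that is {m, n} = {k, l}. The two pairings each contribute 2π (∑ |a_k|²)². -/
theorem integral_norm_freeWave_pow_four_le (K : Finset ℤ) (a : ℤ → ℂ) (s : ℝ) :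
    ∫ t in s..(s + 2 * Real.pi), ∫ x, ‖freeWave K a t x‖ ^ 4 ∂torusMeasure
      ≤ 4 * Real.pi * (∑ k ∈ K, ‖a k‖ ^ 2) ^ 2 := by
  set Q := (K ×ˢ K) ×ˢ (K ×ˢ K) with hQ
  set b : (ℤ × ℤ) × (ℤ × ℤ) → ℂ := fun q => a q.1.1 * a q.1.2 *
          (starRingEnd ℂ (a q.2.1) * starRingEnd ℂ (a q.2.2)) with hb
  have hx : ∀ t : ℝ, ((∫ x, ‖freeWave K a t x‖ ^ 4 ∂torusMeasure : ℝ) : ℂ)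
      = ∑ q ∈ Q, b q * (if q.1.1 + q.1.2 - q.2.1 - q.2.2 = 0 then 1 else 0) *
        Complex.exp (-(Complex.I * ((q.1.1 ^ 2 + q.1.2 ^ 2 - q.2.1 ^ 2 - q.2.2 ^ 2 : ℤ) : ℂ) * t)) := by
    intro t
    rw [← integral_complex_ofReal]
    simp_rw [norm_freeWave_pow_four]
    rw [integral_finsetSum]
    · refine Finset.sum_congr rfl fun q _ => ?_
      rw [integral_const_mul, integral_const_mul, integral_fourier]; ring
    · intro q _
      refine Integrable.const_mul (Integrable.const_mul ?_ _) _
      exact (fourier _).continuous.integrable_of_hasCompactSupport (HasCompactSupport.of_compactSpace _)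
  have hI : ((∫ t in s..(s + 2 * Real.pi), ∫ x, ‖freeWave K a t x‖ ^ 4 ∂torusMeasure : ℝ) : ℂ)
      = ∑ q ∈ Q, b q * (if q.1.1 + q.1.2 - q.2.1 - q.2.2 = 0 then 1 else 0) *
        (if q.1.1 ^ 2 + q.1.2 ^ 2 - q.2.1 ^ 2 - q.2.2 ^ 2 = 0 then ((2 * Real.pi : ℝ) : ℂ) else 0) := by
    rw [← intervalIntegral.integral_ofReal]
    simp_rw [hx]
    rw [intervalIntegral.integral_finsetSum]
    · refine Finset.sum_congr rfl fun q _ => ?_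
      rw [intervalIntegral.integral_const_mul, integral_exp_int_mul]
    · intro q _
      exact Continuous.intervalIntegrable (by fun_prop) _ _
  refine (Real.le_norm_self _).trans ?_
  rw [← Complex.norm_real, hI]
  refine (norm_sum_le _ _).trans ?_
  have hterm : ∀ q ∈ Q, ‖b q * (if q.1.1 + q.1.2 - q.2.1 - q.2.2 = 0 then 1 else 0) *
        (if q.1.1 ^ 2 + q.1.2 ^ 2 - q.2.1 ^ 2 - q.2.2 ^ 2 = 0 then ((2 * Real.pi : ℝ) : ℂ) else 0)‖
      ≤ (if q.2 = q.1 then 2 * Real.pi * (‖a q.1.1‖ ^ 2 * ‖a q.1.2‖ ^ 2) else 0)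
        + (if q.2 = q.1.swap then 2 * Real.pi * (‖a q.1.1‖ ^ 2 * ‖a q.1.2‖ ^ 2) else 0) := by
    rintro ⟨⟨k, l⟩, m, n⟩ _
    have hpi : ‖((2 * Real.pi : ℝ) : ℂ)‖ = 2 * Real.pi := by
      rw [Complex.norm_real, Real.norm_of_nonneg (by positivity)]
    simp only [hb]
    by_cases h1 : k + l - m - n = 0
    · by_cases h2 : k ^ 2 + l ^ 2 - m ^ 2 - n ^ 2 = 0
      -- Eliminating l by the linear relation makes the quadratic relation factor.
      · have h3 : (k - m) * (k - n) = 0 := by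
          have : l = m + n - k := by omega
          subst this
          linarith [show k ^ 2 + (m + n - k) ^ 2 - m ^ 2 - n ^ 2 = 2 * ((k - m) * (k - n)) by ring]
        rw [if_pos h1, if_pos h2, mul_one, norm_mul, hpi]
        simp only [norm_mul, RCLike.norm_conj]
        rcases mul_eq_zero.1 h3 with h | h
        · obtain rfl : m = k := by omega
          obtain rfl : n = l := by omega
          rw [if_pos rfl]
          refine le_add_of_le_of_nonneg (le_of_eq (by ring)) (by split_ifs <;> positivity)
        · obtain rfl : n = k := by omega
          obtain rfl : m = l := by omega
          simp only [Prod.swap_prod_mk, if_true]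
          refine le_add_of_nonneg_of_le (by split_ifs <;> positivity) (le_of_eq (by ring))
      · rw [if_neg h2, mul_zero, norm_zero]
        refine add_nonneg ?_ ?_ <;> split_ifs <;> positivity
    · rw [if_neg h1, mul_zero, zero_mul, norm_zero]
      refine add_nonneg ?_ ?_ <;> split_ifs <;> positivity
  refine (Finset.sum_le_sum hterm).trans (le_of_eq ?_)
  have hsq : ∑ p ∈ K ×ˢ K, (‖a p.1‖ ^ 2 * ‖a p.2‖ ^ 2) = (∑ k ∈ K, ‖a k‖ ^ 2) ^ 2 := by
    rw [sq, Finset.sum_mul_sum, ← Finset.sum_product']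
  rw [Finset.sum_add_distrib, hQ]
  have e1 : ∑ q ∈ (K ×ˢ K) ×ˢ (K ×ˢ K), (if q.2 = q.1 then 2 * Real.pi * (‖a q.1.1‖ ^ 2 * ‖a q.1.2‖ ^ 2) else 0)
      = 2 * Real.pi * (∑ k ∈ K, ‖a k‖ ^ 2) ^ 2 := by
    rw [← hsq, Finset.mul_sum, Finset.sum_product]
    refine Finset.sum_congr rfl fun p hp => ?_
    rw [Finset.sum_ite_eq' , if_pos hp]
  have e2 : ∑ q ∈ (K ×ˢ K) ×ˢ (K ×ˢ K),
      (if q.2 = q.1.swap then 2 * Real.pi * (‖a q.1.1‖ ^ 2 * ‖a q.1.2‖ ^ 2) else 0)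
      = 2 * Real.pi * (∑ k ∈ K, ‖a k‖ ^ 2) ^ 2 := by
    rw [← hsq, Finset.mul_sum, Finset.sum_product]
    refine Finset.sum_congr rfl fun p hp => ?_
    simp only []
    rw [Finset.sum_ite_eq', if_pos]
    rw [Finset.mem_product] at hp ⊢
    exact ⟨hp.2, hp.1⟩
  rw [e1, e2]; ring

theorem eLpNorm_four_pow_four {α : Type*} [MeasurableSpace α] (μ : Measure α) (f : α → ℂ) :
    eLpNorm f 4 μ ^ 4 = ∫⁻ x, ‖f x‖ₑ ^ 4 ∂μ := by
  have h := eLpNorm_nnreal_pow_eq_lintegral (f := f) (μ := μ) (p := 4) (by norm_num)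
  have e : ((4 : ℝ≥0) : ℝ) = ((4 : ℕ) : ℝ) := by norm_num
  simp only [e, ENNReal.rpow_natCast] at h
  exact_mod_cast h

theorem eLpNorm_four_pow_four_of_continuous {f : Torus → ℂ} (hf : Continuous f) :
    eLpNorm f 4 torusMeasure ^ 4 = ENNReal.ofReal (∫ z, ‖f z‖ ^ 4 ∂torusMeasure) := by
  rw [eLpNorm_four_pow_four, ofReal_integral_eq_lintegral_ofReal]
  · refine lintegral_congr fun z => ?_
    rw [ENNReal.ofReal_pow (norm_nonneg _), ofReal_norm]
  · exact (hf.norm.pow 4).integrable_of_hasCompactSupport (HasCompactSupport.of_compactSpace _)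
  · exact ae_of_all _ fun z => by positivity

theorem continuous_integral_norm_freeWave (K : Finset ℤ) (a : ℤ → ℂ) :
    Continuous fun t => ∫ z, ‖freeWave K a t z‖ ^ 4 ∂torusMeasure := by
  have h := continuous_parametric_integral_of_continuous (μ := torusMeasure) (s := Set.univ)
    (f := fun (t : ℝ) (z : Torus) => ‖freeWave K a t z‖ ^ 4)
    ((continuous_freeWave K a).norm.fun_pow 4) isCompact_univ
  simpa only [Measure.restrict_univ] using h

/-- Zygmund's `L⁴` Strichartz inequality on the torus. -/
theorem lintegral_freeWave_pow_four_le (K : Finset ℤ) (a : ℤ → ℂ) {x y : ℝ} (hxy : y ≤ x + 2 * Real.pi) :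
    ∫⁻ t in Set.Ioc x y, eLpNorm (freeWave K a t) 4 torusMeasure ^ 4
      ≤ ENNReal.ofReal (4 * Real.pi * (∑ k ∈ K, ‖a k‖ ^ 2) ^ 2) := by
  have h0 : x ≤ x + 2 * Real.pi := by linarith [Real.pi_pos]
  refine (lintegral_mono_set (Set.Ioc_subset_Ioc_right hxy)).trans ?_
  have hN : ∀ t, eLpNorm (freeWave K a t) 4 torusMeasure ^ 4
      = ENNReal.ofReal (∫ z, ‖freeWave K a t z‖ ^ 4 ∂torusMeasure) := fun t =>
    eLpNorm_four_pow_four_of_continuous (continuous_freeWave_apply K a t)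
  rw [lintegral_congr hN]
  have hcI := continuous_integral_norm_freeWave K a
  have hi : IntegrableOn (fun t => ∫ z, ‖freeWave K a t z‖ ^ 4 ∂torusMeasure)
      (Set.Ioc x (x + 2 * Real.pi)) := hcI.integrableOn_Icc.mono_set Set.Ioc_subset_Icc_self
  rw [← ofReal_integral_eq_lintegral_ofReal hi
    (ae_of_all _ fun t => integral_nonneg fun z => pow_nonneg (norm_nonneg _) 4),
    ← intervalIntegral.integral_of_le h0]
  exact ENNReal.ofReal_le_ofReal (integral_norm_freeWave_pow_four_le K a x)

theorem measurable_eLpNorm_four_freeWave (K : Finset ℤ) {b : ℝ → ℤ → ℂ}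
    (hb : ∀ k, Continuous fun t => b t k) :
    Measurable fun t => eLpNorm (freeWave K (b t) t) 4 torusMeasure := by
  have hc : Continuous fun p : ℝ × Torus => freeWave K (b p.1) p.1 p.2 := by
    unfold freeWave
    refine continuous_finsetSum _ fun k _ => ?_
    exact (((hb k).comp continuous_fst).mul (by fun_prop)).mul
      ((fourier k).continuous.comp continuous_snd)
  have h4 : Measurable fun t => eLpNorm (freeWave K (b t) t) 4 torusMeasure ^ 4 := by
    simp_rw [eLpNorm_four_pow_four]
    exact (hc.measurable.enorm.pow_const 4).lintegral_prod_right'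
  have e : (fun t => eLpNorm (freeWave K (b t) t) 4 torusMeasure)
      = fun t => (eLpNorm (freeWave K (b t) t) 4 torusMeasure ^ 4) ^ (1 / 4 : ℝ) := by
    ext t
    rw [← ENNReal.rpow_natCast, ← ENNReal.rpow_mul]; norm_num
  rw [e]
  exact h4.pow_const _

theorem freeWave_add (K : Finset ℤ) (a b : ℤ → ℂ) (t : ℝ) :
    freeWave K (fun k => a k + b k) t = freeWave K a t + freeWave K b t := by
  ext x
  simp only [freeWave, Pi.add_apply, ← Finset.sum_add_distrib]
  exact Finset.sum_congr rfl fun k _ => by ring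

theorem eLpNorm_freeWave_le (K : Finset ℤ) (b : ℤ → ℂ) (t : ℝ) :
    eLpNorm (freeWave K b t) 4 torusMeasure ≤ ENNReal.ofReal (∑ k ∈ K, ‖b k‖) := by
  refine (eLpNorm_le_of_ae_bound (C := ∑ k ∈ K, ‖b k‖) (ae_of_all _ fun x => ?_)).trans ?_
  · refine (norm_sum_le _ _).trans (Finset.sum_le_sum fun k _ => ?_)
    rw [norm_mul, norm_mul, norm_exp_neg_I_mul, mul_one, fourier_apply, Circle.norm_coe, mul_one]
  · simp

/-! ### The inhomogeneous L⁴ inequality. -/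

/-- A forcing term, given by its Fourier coefficients `F r k`, whose spatial `L^{4/3}` norm is
controlled, by duality, by a function `H` in `L^{4/3}` of time. -/
structure IsForcing (F : ℝ → ℤ → ℂ) (H : ℝ → ℝ≥0∞) : Prop where
  integrable : ∀ k, Integrable fun r => F r k
  aemeasurable : AEMeasurable H
  lintegral_ne_top : ∫⁻ r, H r ^ (4 / 3 : ℝ) ≠ ∞
  dual : ∀ᵐ r, ∀ (K : Finset ℤ) (b : ℤ → ℂ), ‖∑ k ∈ K, starRingEnd ℂ (b k) * F r k‖ₑ
    ≤ H r * eLpNorm (fun x : Torus => ∑ k ∈ K, b k * fourier k x) 4 torusMeasure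

/-- The Fourier coefficients, in the interaction picture, of the Duhamel integral. -/
def duhamelCoeff (F : ℝ → ℤ → ℂ) (x y : ℝ) (k : ℤ) : ℂ :=
  ∫ r in x..y, Complex.exp (Complex.I * (k : ℂ) ^ 2 * r) * F r k

theorem IsForcing.integrable_exp_mul {F : ℝ → ℤ → ℂ} {H : ℝ → ℝ≥0∞} (hF : IsForcing F H) (k : ℤ) :
    Integrable fun r : ℝ => Complex.exp (Complex.I * (k : ℂ) ^ 2 * r) * F r k := by
  refine (hF.integrable k).bdd_mul (c := 1) ?_ (ae_of_all _ fun r => (norm_exp_I_mul k r).le)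
  exact Continuous.aestronglyMeasurable (by fun_prop)

theorem IsForcing.continuous_duhamelCoeff {F : ℝ → ℤ → ℂ} {H : ℝ → ℝ≥0∞} (hF : IsForcing F H)
    (x : ℝ) (k : ℤ) : Continuous fun y => duhamelCoeff F x y k :=
  intervalIntegral.continuous_primitive
    (fun _ _ => (hF.integrable_exp_mul k).intervalIntegrable) x

theorem IsForcing.duhamelCoeff_add {F : ℝ → ℤ → ℂ} {H : ℝ → ℝ≥0∞} (hF : IsForcing F H)
    (x y z : ℝ) (k : ℤ) : duhamelCoeff F x y k + duhamelCoeff F y z k = duhamelCoeff F x z k :=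
  intervalIntegral.integral_add_adjacent_intervals (hF.integrable_exp_mul k).intervalIntegrable
    (hF.integrable_exp_mul k).intervalIntegrable

/-- The dual of the homogeneous inequality. With S = ∑ |d_k|², pairing the forcing with the free
wave whose coefficients are d gives S ≤ M^{3/4} (4πS²)^{1/4}; raise to the fourth power and divide
by S². -/
theorem IsForcing.sq_sum_duhamelCoeff_le {F : ℝ → ℤ → ℂ} {H : ℝ → ℝ≥0∞} (hF : IsForcing F H)
    (K : Finset ℤ) {x y : ℝ} (hxy : x ≤ y) (hxy' : y ≤ x + 2 * Real.pi) :
    ENNReal.ofReal ((∑ k ∈ K, ‖duhamelCoeff F x y k‖ ^ 2) ^ 2)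
      ≤ ENNReal.ofReal (4 * Real.pi) * (∫⁻ r in Set.Ioc x y, H r ^ (4 / 3 : ℝ)) ^ 3 := by
  set d := duhamelCoeff F x y with hd
  set S := ∑ k ∈ K, ‖d k‖ ^ 2 with hS
  set M := ∫⁻ r in Set.Ioc x y, H r ^ (4 / 3 : ℝ) with hM
  have hS0 : 0 ≤ S := Finset.sum_nonneg fun _ _ => by positivity
  have hSI : (S : ℂ) = ∫ r in x..y, ∑ k ∈ K,
      starRingEnd ℂ (d k * Complex.exp (-(Complex.I * (k : ℂ) ^ 2 * r))) * F r k := by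
    rw [intervalIntegral.integral_finsetSum]
    · rw [hS]; push_cast
      refine Finset.sum_congr rfl fun k _ => ?_
      rw [← Complex.conj_mul']
      simp only [map_mul, conj_exp_neg_I_mul]
      simp only [mul_assoc (starRingEnd ℂ (d k))]
      rw [intervalIntegral.integral_const_mul]
      rfl
    · intro k _
      simp only [map_mul, conj_exp_neg_I_mul]
      simp only [mul_assoc (starRingEnd ℂ (d k))]
      exact ((hF.integrable_exp_mul k).const_mul _).intervalIntegrable
  have h1 : ENNReal.ofReal S ≤ ∫⁻ r in Set.Ioc x y, H r * eLpNorm (freeWave K d r) 4 torusMeasure := by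
    have : ENNReal.ofReal S = ‖(S : ℂ)‖ₑ := by
      rw [← ofReal_norm, Complex.norm_real, Real.norm_of_nonneg hS0]
    rw [this, hSI, intervalIntegral.integral_of_le hxy]
    refine (enorm_integral_le_lintegral_enorm _).trans (lintegral_mono_ae ?_)
    filter_upwards [ae_restrict_of_ae hF.dual] with r hr
    exact hr K _
  have hN : Measurable fun r => eLpNorm (freeWave K d r) 4 torusMeasure :=
    measurable_eLpNorm_four_freeWave K (b := fun _ => d) fun _ => continuous_const
  have h2 : ENNReal.ofReal S ≤ M ^ (3 / 4 : ℝ) * (ENNReal.ofReal (4 * Real.pi * S ^ 2)) ^ (1 / 4 : ℝ) := by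
    refine h1.trans ((ENNReal.lintegral_mul_le_Lp_mul_Lq _ (p := 4 / 3) (q := 4)
      ⟨by norm_num, by norm_num, by norm_num⟩ hF.aemeasurable.restrict hN.aemeasurable).trans ?_)
    have e : (1 / (4 / 3) : ℝ) = 3 / 4 := by norm_num
    rw [e]
    gcongr
    have e4 : ∀ z : ℝ≥0∞, z ^ (4 : ℝ) = z ^ 4 := fun z => by
      rw [← ENNReal.rpow_natCast]; norm_num
    simp only [e4]
    exact lintegral_freeWave_pow_four_le K d hxy'
  have h3 : ENNReal.ofReal S ^ 4 ≤ M ^ 3 * ENNReal.ofReal (4 * Real.pi * S ^ 2) := by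
    refine (pow_le_pow_left' h2 4).trans (le_of_eq ?_)
    rw [mul_pow, ← ENNReal.rpow_natCast, ← ENNReal.rpow_mul, ← ENNReal.rpow_natCast,
      ← ENNReal.rpow_mul, ← ENNReal.rpow_natCast M 3]
    norm_num
  rcases hS0.eq_or_lt with h0 | h0
  · rw [← h0]; simp
  · have hpos : ENNReal.ofReal (S ^ 2) ≠ 0 := by
      rw [Ne, ENNReal.ofReal_eq_zero, not_le]; positivity
    rw [← ENNReal.mul_le_mul_iff_left hpos ENNReal.ofReal_ne_top]
    calc ENNReal.ofReal (S ^ 2) * ENNReal.ofReal (S ^ 2) = ENNReal.ofReal S ^ 4 := by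
          rw [ENNReal.ofReal_pow hS0]; ring
      _ ≤ _ := h3
      _ = _ := by rw [ENNReal.ofReal_mul (by positivity)]; ring

theorem exists_lintegral_Ioc_eq_half {f : ℝ → ℝ≥0∞} (hf : AEMeasurable f)
    (hfin : ∫⁻ r, f r ≠ ∞) {x y : ℝ} (hxy : x ≤ y) :
    ∃ m ∈ Set.Icc x y, ∫⁻ r in Set.Ioc x m, f r = (∫⁻ r in Set.Ioc x y, f r) / 2 ∧
      ∫⁻ r in Set.Ioc m y, f r = (∫⁻ r in Set.Ioc x y, f r) / 2 := by
  set μ := volume.withDensity f with hμ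
  have hi : Integrable fun r => (f r).toReal := integrable_toReal_of_lintegral_ne_top hf hfin
  have hval : ∀ m, x ≤ m → ∫⁻ r in Set.Ioc x m, f r = ENNReal.ofReal (∫ r in x..m, (f r).toReal) := by
    intro m hm
    rw [intervalIntegral.integral_of_le hm,
      ofReal_integral_eq_lintegral_ofReal hi.integrableOn (ae_of_all _ fun _ => ENNReal.toReal_nonneg)]
    refine lintegral_congr_ae ?_
    filter_upwards [ae_restrict_of_ae (ae_lt_top' hf hfin)] with r hr
    rw [ENNReal.ofReal_toReal hr.ne]
  have hc : Continuous fun m => ∫ r in x..m, (f r).toReal :=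
    intervalIntegral.continuous_primitive (fun _ _ => hi.intervalIntegrable) x
  set G := ∫ r in x..y, (f r).toReal with hG
  have hG0 : 0 ≤ G := intervalIntegral.integral_nonneg hxy fun _ _ => ENNReal.toReal_nonneg
  have hmem : G / 2 ∈ Set.Icc (∫ r in x..x, (f r).toReal) (∫ r in x..y, (f r).toReal) := by
    rw [intervalIntegral.integral_same]; constructor <;> linarith
  obtain ⟨m, hm, hmG⟩ := intermediate_value_Icc hxy hc.continuousOn hmem
  have h1 : ∫⁻ r in Set.Ioc x m, f r = (∫⁻ r in Set.Ioc x y, f r) / 2 := by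
    rw [hval m hm.1, hval y hxy, ← hG]
    simp only at hmG
    rw [hmG, ENNReal.ofReal_div_of_pos two_pos]; simp
  refine ⟨m, hm, h1, ?_⟩
  have hadd : ∫⁻ r in Set.Ioc x y, f r = (∫⁻ r in Set.Ioc x m, f r) + ∫⁻ r in Set.Ioc m y, f r := by
    rw [← Set.Ioc_union_Ioc_eq_Ioc hm.1 hm.2,
      lintegral_union measurableSet_Ioc (Set.Ioc_disjoint_Ioc_of_le le_rfl)]
  have hT : ∫⁻ r in Set.Ioc x y, f r ≠ ∞ := ((setLIntegral_le_lintegral _ _).trans_lt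
    (lt_top_iff_ne_top.2 hfin)).ne
  rw [h1] at hadd
  have hT2 : (∫⁻ r in Set.Ioc x y, f r) / 2 ≠ ∞ := ENNReal.div_ne_top hT two_ne_zero
  have h3 : (∫⁻ r in Set.Ioc x y, f r) / 2 + ∫⁻ r in Set.Ioc m y, f r
      = (∫⁻ r in Set.Ioc x y, f r) / 2 + (∫⁻ r in Set.Ioc x y, f r) / 2 := by
    rw [← hadd, ENNReal.add_halves]
  exact (ENNReal.add_right_inj hT2).1 h3

/-- The coefficient of p⁴ must be small: `IsForcing.retarded_step` needs (1 + 2)/2³ ≤ 1/2, whereas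
the symmetric bound 8(p⁴ + r⁴) would give 9/8 and no contraction. -/
theorem ENNReal_add_pow_four_le (p r : ℝ≥0∞) : (p + r) ^ 4 ≤ 2 * p ^ 4 + 125 * r ^ 4 := by
  by_cases hp : p = ∞
  · simp [hp]
  by_cases hr : r = ∞
  · simp [hr]
  lift p to ℝ≥0 using hp
  lift r to ℝ≥0 using hr
  norm_cast
  rw [← NNReal.coe_le_coe]
  push_cast
  have hp : (0 : ℝ) ≤ p := p.2
  have hr : (0 : ℝ) ≤ r := r.2
  generalize (p : ℝ) = p at *
  generalize (r : ℝ) = r at *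
  have h1 : (p + r) ^ 2 ≤ 5 / 4 * p ^ 2 + 5 * r ^ 2 := by nlinarith [sq_nonneg (p - 4 * r)]
  have h2 : (5 / 4 * p ^ 2 + 5 * r ^ 2) ^ 2 ≤ 2 * p ^ 4 + 125 * r ^ 4 := by
    nlinarith [sq_nonneg (p ^ 2 - 8 * r ^ 2), sq_nonneg (p ^ 2), sq_nonneg (r ^ 2),
      sq_nonneg (p ^ 2 - 14 * r ^ 2)]
  calc (p + r) ^ 4 = ((p + r) ^ 2) ^ 2 := by ring
    _ ≤ (5 / 4 * p ^ 2 + 5 * r ^ 2) ^ 2 := by gcongr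
    _ ≤ _ := h2

/-- Cut where the mass M of H^{4/3} is halved. Each half obeys the bound with M³/8, and on the
second half the forcing of the first acts as a free wave, controlled by the two preceding
inequalities. The old constant thus enters with a factor at most 1/2. -/
theorem IsForcing.retarded_step {F : ℝ → ℤ → ℂ} {H : ℝ → ℝ≥0∞} (hF : IsForcing F H)
    (K : Finset ℤ) {B : ℝ≥0∞}
    (hB : ∀ x y, x ≤ y → y ≤ x + 2 * Real.pi →
      ∫⁻ t in Set.Ioc x y, eLpNorm (freeWave K (duhamelCoeff F x t) t) 4 torusMeasure ^ 4
        ≤ B * (∫⁻ r in Set.Ioc x y, H r ^ (4 / 3 : ℝ)) ^ 3)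
    {x y : ℝ} (hxy : x ≤ y) (hxy' : y ≤ x + 2 * Real.pi) :
      ∫⁻ t in Set.Ioc x y, eLpNorm (freeWave K (duhamelCoeff F x t) t) 4 torusMeasure ^ 4
        ≤ (B / 2 + 125 * ENNReal.ofReal (4 * Real.pi) ^ 2) *
          (∫⁻ r in Set.Ioc x y, H r ^ (4 / 3 : ℝ)) ^ 3 := by
  obtain ⟨m, hm, hm1, hm2⟩ := exists_lintegral_Ioc_eq_half (hF.aemeasurable.pow_const (4 / 3 : ℝ))
    hF.lintegral_ne_top hxy
  set M := ∫⁻ r in Set.Ioc x y, H r ^ (4 / 3 : ℝ) with hM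
  have hb1 := hB x m hm.1 (hm.2.trans hxy')
  have hb2 := hB m y hm.2 (by linarith [hm.1])
  have hb3 := lintegral_freeWave_pow_four_le K (duhamelCoeff F x m) (x := m) (y := y)
    (by linarith [hm.1])
  have hb4 := hF.sq_sum_duhamelCoeff_le K hm.1 (hm.2.trans hxy')
  rw [hm1] at hb1 hb4
  rw [hm2] at hb2
  have hpt : ∀ t, eLpNorm (freeWave K (duhamelCoeff F x t) t) 4 torusMeasure ^ 4
      ≤ 2 * eLpNorm (freeWave K (duhamelCoeff F m t) t) 4 torusMeasure ^ 4
        + 125 * eLpNorm (freeWave K (duhamelCoeff F x m) t) 4 torusMeasure ^ 4 := by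
    intro t
    have e : freeWave K (duhamelCoeff F x t) t
        = freeWave K (duhamelCoeff F m t) t + freeWave K (duhamelCoeff F x m) t := by
      rw [← freeWave_add]
      congr 1
      ext k
      rw [add_comm, hF.duhamelCoeff_add]
    rw [e]
    refine le_trans (pow_le_pow_left' (eLpNorm_add_le ?_ ?_ (by norm_num)) 4)
      (ENNReal_add_pow_four_le _ _)
    · exact (continuous_freeWave_apply K _ t).aestronglyMeasurable
    · exact (continuous_freeWave_apply K _ t).aestronglyMeasurable
  have hmeas : Measurable fun t => eLpNorm (freeWave K (duhamelCoeff F m t) t) 4 torusMeasure :=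
    measurable_eLpNorm_four_freeWave K fun k => hF.continuous_duhamelCoeff m k
  have hmeas' : Measurable fun t => eLpNorm (freeWave K (duhamelCoeff F x m) t) 4 torusMeasure :=
    measurable_eLpNorm_four_freeWave K (b := fun _ => duhamelCoeff F x m) fun k => continuous_const
  have hsecond : ∫⁻ t in Set.Ioc m y, eLpNorm (freeWave K (duhamelCoeff F x t) t) 4 torusMeasure ^ 4
      ≤ 2 * (B * (M / 2) ^ 3) + 125 * (ENNReal.ofReal (4 * Real.pi) *
        (ENNReal.ofReal (4 * Real.pi) * (M / 2) ^ 3)) := by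
    refine (lintegral_mono hpt).trans ?_
    rw [lintegral_add_left (by fun_prop), lintegral_const_mul _ (by fun_prop),
      lintegral_const_mul _ (by fun_prop)]
    gcongr
    refine hb3.trans ?_
    rw [ENNReal.ofReal_mul (by positivity)]
    gcongr
  rw [← Set.Ioc_union_Ioc_eq_Ioc hm.1 hm.2,
      lintegral_union measurableSet_Ioc (Set.Ioc_disjoint_Ioc_of_le le_rfl)]
  refine (add_le_add hb1 hsecond).trans ?_
  have hM2 : M = 2 * (M / 2) := by rw [ENNReal.mul_div_cancel two_ne_zero (by simp)]
  have hB2 : B = 2 * (B / 2) := by rw [ENNReal.mul_div_cancel two_ne_zero (by simp)]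
  generalize M / 2 = N at *
  generalize ENNReal.ofReal (4 * Real.pi) = c at *
  rw [hM2]
  calc B * N ^ 3 + (2 * (B * N ^ 3) + 125 * (c * (c * N ^ 3)))
      = 3 * B * N ^ 3 + 125 * c ^ 2 * N ^ 3 := by ring
    _ ≤ 4 * B * N ^ 3 + 8 * (125 * c ^ 2 * N ^ 3) := by
        refine add_le_add ?_ ?_
        · gcongr; norm_num
        · exact le_mul_of_one_le_left zero_le (by norm_num)
    _ = 4 * (2 * (B / 2)) * N ^ 3 + 8 * (125 * c ^ 2 * N ^ 3) := by rw [← hB2]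
    _ = _ := by ring

/-- The inhomogeneous `L⁴` Strichartz inequality, on trigonometric polynomials. The passage from the
full to the retarded Duhamel integral bisects the time interval, as in the Christ–Kiselev lemma. -/
theorem IsForcing.lintegral_duhamel_pow_four_le {F : ℝ → ℤ → ℂ} {H : ℝ → ℝ≥0∞} (hF : IsForcing F H)
    (K : Finset ℤ) {x y : ℝ} (hxy : x ≤ y) (hxy' : y ≤ x + 2 * Real.pi) :
    ∫⁻ t in Set.Ioc x y, eLpNorm (freeWave K (duhamelCoeff F x t) t) 4 torusMeasure ^ 4
      ≤ 250 * ENNReal.ofReal (4 * Real.pi) ^ 2 *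
        (∫⁻ r in Set.Ioc x y, H r ^ (4 / 3 : ℝ)) ^ 3 := by
  set c := ENNReal.ofReal (4 * Real.pi) with hc
  have hcT : c ≠ ∞ := ENNReal.ofReal_ne_top
  -- A crude starting constant, growing with the number of modes; only its finiteness matters, since
  -- the iteration removes it.
  set B₀ : ℝ≥0∞ := (K.card : ℝ≥0∞) ^ 4 * c * ENNReal.ofReal (2 * Real.pi) with hB₀
  have hB₀T : B₀ ≠ ∞ := by
    refine ENNReal.mul_ne_top (ENNReal.mul_ne_top ?_ hcT) ENNReal.ofReal_ne_top
    exact ENNReal.pow_ne_top (ENNReal.natCast_ne_top _)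
  have hbase : ∀ x y, x ≤ y → y ≤ x + 2 * Real.pi →
      ∫⁻ t in Set.Ioc x y, eLpNorm (freeWave K (duhamelCoeff F x t) t) 4 torusMeasure ^ 4
        ≤ B₀ * (∫⁻ r in Set.Ioc x y, H r ^ (4 / 3 : ℝ)) ^ 3 := by
    intro x y hxy hxy'
    set M := ∫⁻ r in Set.Ioc x y, H r ^ (4 / 3 : ℝ) with hM
    have hpt : ∀ t ∈ Set.Ioc x y, eLpNorm (freeWave K (duhamelCoeff F x t) t) 4 torusMeasure ^ 4
        ≤ (K.card : ℝ≥0∞) ^ 4 * (c * M ^ 3) := by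
      intro t ht
      have h1 := hF.sq_sum_duhamelCoeff_le K ht.1.le (ht.2.trans hxy')
      set d := duhamelCoeff F x t
      have hMt : ∫⁻ r in Set.Ioc x t, H r ^ (4 / 3 : ℝ) ≤ M :=
        lintegral_mono_set (Set.Ioc_subset_Ioc_right ht.2)
      have h2 : (∑ k ∈ K, ‖d k‖) ^ 2 ≤ K.card * ∑ k ∈ K, ‖d k‖ ^ 2 := sq_sum_le_card_mul_sum_sq
      have h3 : (∑ k ∈ K, ‖d k‖) ^ 4 ≤ (K.card : ℝ) ^ 4 * (∑ k ∈ K, ‖d k‖ ^ 2) ^ 2 := by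
        have hs : 0 ≤ ∑ k ∈ K, ‖d k‖ ^ 2 := Finset.sum_nonneg fun _ _ => by positivity
        have hK : (K.card : ℝ) ≤ (K.card : ℝ) ^ 2 := by
          exact_mod_cast Nat.le_self_pow two_ne_zero _
        calc (∑ k ∈ K, ‖d k‖) ^ 4 = ((∑ k ∈ K, ‖d k‖) ^ 2) ^ 2 := by ring
          _ ≤ (K.card * ∑ k ∈ K, ‖d k‖ ^ 2) ^ 2 := by gcongr
          _ ≤ ((K.card : ℝ) ^ 2 * ∑ k ∈ K, ‖d k‖ ^ 2) ^ 2 := by gcongr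
          _ = _ := by ring
      calc eLpNorm (freeWave K d t) 4 torusMeasure ^ 4
          ≤ ENNReal.ofReal (∑ k ∈ K, ‖d k‖) ^ 4 := pow_le_pow_left' (eLpNorm_freeWave_le K d t) 4
        _ = ENNReal.ofReal ((∑ k ∈ K, ‖d k‖) ^ 4) :=
            (ENNReal.ofReal_pow (Finset.sum_nonneg fun _ _ => norm_nonneg _) 4).symm
        _ ≤ ENNReal.ofReal ((K.card : ℝ) ^ 4 * (∑ k ∈ K, ‖d k‖ ^ 2) ^ 2) :=
            ENNReal.ofReal_le_ofReal h3
        _ = (K.card : ℝ≥0∞) ^ 4 * ENNReal.ofReal ((∑ k ∈ K, ‖d k‖ ^ 2) ^ 2) := by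
            rw [ENNReal.ofReal_mul (by positivity), ENNReal.ofReal_pow (by positivity),
              ENNReal.ofReal_natCast]
        _ ≤ _ := by
            gcongr
            exact h1.trans (by gcongr)
    refine (setLIntegral_mono measurable_const hpt).trans ?_
    rw [setLIntegral_const, Real.volume_Ioc, hB₀]
    have : ENNReal.ofReal (y - x) ≤ ENNReal.ofReal (2 * Real.pi) :=
      ENNReal.ofReal_le_ofReal (by linarith)
    calc (K.card : ℝ≥0∞) ^ 4 * (c * M ^ 3) * ENNReal.ofReal (y - x)
        ≤ (K.card : ℝ≥0∞) ^ 4 * (c * M ^ 3) * ENNReal.ofReal (2 * Real.pi) := by gcongr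
      _ = _ := by ring
  -- The constant 250c² is the fixed point of B ↦ B/2 + 125c².
  have hiter : ∀ n : ℕ, ∀ x y, x ≤ y → y ≤ x + 2 * Real.pi →
      ∫⁻ t in Set.Ioc x y, eLpNorm (freeWave K (duhamelCoeff F x t) t) 4 torusMeasure ^ 4
        ≤ (B₀ / 2 ^ n + 250 * c ^ 2) * (∫⁻ r in Set.Ioc x y, H r ^ (4 / 3 : ℝ)) ^ 3 := by
    intro n
    induction n with
    | zero =>
      intro x y hxy hxy'
      refine (hbase x y hxy hxy').trans ?_
      gcongr
      simp
    | succ n ih =>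
      intro x y hxy hxy'
      refine (hF.retarded_step K ih hxy hxy').trans (le_of_eq ?_)
      congr 1
      rw [ENNReal.add_div, add_assoc]
      congr 1
      · rw [div_eq_mul_inv, div_eq_mul_inv, div_eq_mul_inv, mul_assoc, pow_succ,
          ENNReal.mul_inv (by simp) (by simp)]
      · rw [← hc]
        have : (250 : ℝ≥0∞) * c ^ 2 = 2 * (125 * c ^ 2) := by ring
        rw [this, mul_comm 2, ENNReal.mul_div_cancel_right two_ne_zero (by simp)]
        ring
  have hlim : Tendsto (fun n : ℕ => (B₀ / 2 ^ n + 250 * c ^ 2) *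
      (∫⁻ r in Set.Ioc x y, H r ^ (4 / 3 : ℝ)) ^ 3) atTop
      (𝓝 ((0 + 250 * c ^ 2) * (∫⁻ r in Set.Ioc x y, H r ^ (4 / 3 : ℝ)) ^ 3)) := by
    have hT : ∫⁻ r in Set.Ioc x y, H r ^ (4 / 3 : ℝ) ≠ ∞ := ((setLIntegral_le_lintegral _ _).trans_lt
      (lt_top_iff_ne_top.2 hF.lintegral_ne_top)).ne
    refine ENNReal.Tendsto.mul_const (Tendsto.add_const _ ?_) (Or.inr (ENNReal.pow_ne_top hT))
    have h2 : Tendsto (fun n : ℕ => ((2 : ℝ≥0∞)⁻¹) ^ n) atTop (𝓝 0) :=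
      ENNReal.tendsto_pow_atTop_nhds_zero_of_lt_one (by simp)
    have h3 := ENNReal.Tendsto.const_mul (a := B₀) h2 (Or.inr hB₀T)
    rw [mul_zero] at h3
    refine h3.congr fun n => ?_
    rw [div_eq_mul_inv, ENNReal.inv_pow]
  rw [zero_add] at hlim
  exact ge_of_tendsto' hlim fun n => hiter n x y hxy hxy'

/-! ### Measurability in time and semicontinuity of the L⁴ norm. -/

/-- L² convergence gives almost everywhere convergence along a subsequence of any subsequence, and
boundedness of φ gives domination. Unbounded functionals of u(t) are reached as limits of these,
which supplies their measurability in time. -/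
theorem continuous_integral_fourier_mul_comp {φ : ℂ → ℂ} (hφ : Continuous φ) {C : ℝ}
    (hC : ∀ z, ‖φ z‖ ≤ C) (n : ℤ) :
    Continuous fun f : L2Torus => ∫ x, fourier n x * φ (f x) ∂torusMeasure := by
  rw [continuous_iff_seqContinuous]
  intro f f₀ hf
  refine tendsto_of_subseq_tendsto fun ns hns => ?_
  have hm : TendstoInMeasure torusMeasure (fun j x => f (ns j) x) atTop (fun x => f₀ x) :=
    tendstoInMeasure_of_tendsto_Lp (hf.comp hns)
  obtain ⟨ms, -, hms⟩ := hm.exists_seq_tendsto_ae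
  refine ⟨ms, ?_⟩
  refine tendsto_integral_of_dominated_convergence (fun _ => C) (fun j => ?_)
    (integrable_const C) (fun j => ae_of_all _ fun x => ?_) ?_
  · exact (fourier n).continuous.aestronglyMeasurable.mul
      (hφ.comp_aestronglyMeasurable (Lp.aestronglyMeasurable _))
  · rw [norm_mul, fourier_apply, Circle.norm_coe, one_mul]; exact hC _
  · filter_upwards [hms] with x hx
    exact ((hφ.tendsto _).comp hx).const_mul _

/-- Truncated fourth moment, a continuous functional on `L²`. -/
def truncFour (n : ℕ) (f : L2Torus) : ℝ := ∫ x, min (‖f x‖ ^ 4) n ∂torusMeasure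

theorem continuous_truncFour (n : ℕ) : Continuous (truncFour n) := by
  have h := continuous_integral_fourier_mul_comp (φ := fun z => ((min (‖z‖ ^ 4) n : ℝ) : ℂ))
    (by fun_prop) (C := n) (fun z => by
      rw [Complex.norm_real, Real.norm_of_nonneg (by positivity)]
      exact min_le_right _ _) 0
  simp only [fourier_zero, one_mul, integral_complex_ofReal] at h
  exact Complex.continuous_re.comp h

theorem ofReal_truncFour (n : ℕ) (f : L2Torus) :
    ENNReal.ofReal (truncFour n f) = ∫⁻ x, min (‖f x‖ₑ ^ 4) n ∂torusMeasure := by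
  rw [truncFour, ofReal_integral_eq_lintegral_ofReal]
  · refine lintegral_congr fun x => ?_
    rw [ENNReal.ofReal_min, ENNReal.ofReal_pow (norm_nonneg _), ofReal_norm, ENNReal.ofReal_natCast]
  · refine Integrable.mono' (integrable_const (n : ℝ)) ?_ (ae_of_all _ fun x => ?_)
    · exact ((Lp.aestronglyMeasurable f).norm.pow 4).inf aestronglyMeasurable_const
    · rw [Real.norm_of_nonneg (by positivity)]; exact min_le_right _ _
  · exact ae_of_all _ fun x => by positivity

theorem eLpNorm_four_pow_four_eq_iSup (f : L2Torus) :
    eLpNorm f 4 torusMeasure ^ 4 = ⨆ n, ENNReal.ofReal (truncFour n f) := by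
  rw [eLpNorm_four_pow_four]
  simp_rw [ofReal_truncFour]
  rw [← lintegral_iSup']
  · refine lintegral_congr fun x => ?_
    rw [← inf_iSup_eq, ENNReal.iSup_natCast, inf_top_eq]
  · intro n
    exact ((Lp.aestronglyMeasurable f).enorm.pow_const 4).inf aemeasurable_const
  · refine ae_of_all _ fun x m n hmn => ?_
    exact min_le_min_left _ (by exact_mod_cast hmn)

theorem aemeasurable_eLpNorm_four {u : ℝ → L2Torus} {s : Set ℝ} (hs : MeasurableSet s)
    (hu : ContinuousOn u s) :
    AEMeasurable (fun r => eLpNorm (u r) 4 torusMeasure) (volume.restrict s) := by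
  have h4 : AEMeasurable (fun r => eLpNorm (u r) 4 torusMeasure ^ 4) (volume.restrict s) := by
    simp_rw [eLpNorm_four_pow_four_eq_iSup]
    refine AEMeasurable.iSup fun n => ?_
    exact (((continuous_truncFour n).comp_continuousOn hu).aemeasurable hs).ennreal_ofReal
  have e : (fun r => eLpNorm (u r) 4 torusMeasure)
      = fun r => (eLpNorm (u r) 4 torusMeasure ^ 4) ^ (1 / 4 : ℝ) := by
    ext r
    rw [← ENNReal.rpow_natCast, ← ENNReal.rpow_mul]; norm_num
  rw [e]
  exact h4.pow_const _

/-- The fourth power of the L⁴ norm is a supremum of functionals continuous on L². This carries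
bounds from Fourier partial sums to the function itself. -/
theorem eLpNorm_four_pow_four_le_liminf {f : ℕ → L2Torus} {f₀ : L2Torus}
    (hf : Tendsto f atTop (𝓝 f₀)) :
    eLpNorm f₀ 4 torusMeasure ^ 4 ≤ liminf (fun j => eLpNorm (f j) 4 torusMeasure ^ 4) atTop := by
  rw [eLpNorm_four_pow_four_eq_iSup]
  refine iSup_le fun n => ?_
  have h : Tendsto (fun j => ENNReal.ofReal (truncFour n (f j))) atTop
      (𝓝 (ENNReal.ofReal (truncFour n f₀))) :=
    ENNReal.tendsto_ofReal (((continuous_truncFour n).tendsto _).comp hf)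
  rw [← h.liminf_eq]
  refine liminf_le_liminf (Eventually.of_forall fun j => ?_)
  rw [eLpNorm_four_pow_four_eq_iSup]
  exact le_iSup (fun n => ENNReal.ofReal (truncFour n (f j))) n

/-- The Fourier coefficients of the cubic nonlinearity `|f|² f`. -/
def cubicCoeff (f : Torus → ℂ) (k : ℤ) : ℂ := fourierCoeff (fun x => (‖f x‖ : ℂ) ^ 2 * f x) k

theorem integrable_cubic {f : Torus → ℂ} (hf : MemLp f 4 torusMeasure) :
    Integrable (fun x => (‖f x‖ : ℂ) ^ 2 * f x) torusMeasure := by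
  have h4 : Integrable (fun x => ‖f x‖ ^ 4) torusMeasure := by
    have := hf.integrable_norm_rpow (by norm_num) (by norm_num)
    refine this.congr (ae_of_all _ fun x => ?_)
    simp only [ENNReal.toReal_ofNat]
    exact_mod_cast Real.rpow_natCast ‖f x‖ 4
  refine Integrable.mono' ((integrable_const (1 : ℝ)).add h4) ?_ (ae_of_all _ fun x => ?_)
  · have := hf.1
    exact ((Complex.continuous_ofReal.comp_aestronglyMeasurable this.norm).pow 2).mul this
  · have h0 := norm_nonneg (f x)
    rw [norm_mul, norm_pow, Complex.norm_real, norm_norm, Pi.add_apply]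
    nlinarith [sq_nonneg (‖f x‖ ^ 2 - ‖f x‖), sq_nonneg (‖f x‖ ^ 2 - 1), sq_nonneg (‖f x‖ - 1)]

theorem aestronglyMeasurable_cubicCoeff {u : ℝ → L2Torus} {s : Set ℝ} (hs : MeasurableSet s)
    (hu : ContinuousOn u s)
    (h4 : ∀ᵐ r ∂volume.restrict s, eLpNorm (u r) 4 torusMeasure < ∞) (k : ℤ) :
    AEStronglyMeasurable (fun r => cubicCoeff (u r) k) (volume.restrict s) := by
  -- Bounded continuous regularisations of |z|² z, dominated by |z|³ and converging pointwise to it.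
  set φ : ℕ → ℂ → ℂ := fun n z => ((‖z‖ : ℂ) ^ 2 * z) / ((1 + ‖z‖ ^ 3 / (n + 1) : ℝ) : ℂ) with hφ
  have hden : ∀ (n : ℕ) (z : ℂ), (1 : ℝ) ≤ 1 + ‖z‖ ^ 3 / (n + 1) := fun n z => by
    have : 0 ≤ ‖z‖ ^ 3 / ((n : ℝ) + 1) := by positivity
    linarith
  have hnorm : ∀ n z, ‖φ n z‖ = ‖z‖ ^ 3 / (1 + ‖z‖ ^ 3 / (n + 1)) := fun n z => by
    rw [hφ]
    simp only
    rw [norm_div, norm_mul, norm_pow, Complex.norm_real, norm_norm, Complex.norm_real,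
      Real.norm_of_nonneg (zero_le_one.trans (hden n z))]
    ring
  have hφc : ∀ n, Continuous (φ n) := fun n => by
    refine Continuous.div (by fun_prop) (by fun_prop) fun z => ?_
    have := hden n z
    exact_mod_cast (by positivity : (0 : ℝ) < 1 + ‖z‖ ^ 3 / (n + 1)).ne'
  have hφb : ∀ n z, ‖φ n z‖ ≤ (n : ℝ) + 1 := fun n z => by
    rw [hnorm, div_le_iff₀ (by linarith [hden n z])]
    have : ((n : ℝ) + 1) * (1 + ‖z‖ ^ 3 / (n + 1)) = n + 1 + ‖z‖ ^ 3 := by field_simp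
    rw [this]
    have : (0 : ℝ) ≤ n := Nat.cast_nonneg n
    linarith
  have hφle : ∀ n z, ‖φ n z‖ ≤ ‖z‖ ^ 3 := fun n z => by
    rw [hnorm]
    exact div_le_self (by positivity) (hden n z)
  refine aestronglyMeasurable_of_tendsto_ae atTop
    (f := fun n r => ∫ x, fourier (-k) x * φ n (u r x) ∂torusMeasure) (fun n => ?_) ?_
  · exact ((continuous_integral_fourier_mul_comp (hφc n) (hφb n) (-k)).comp_continuousOn
      hu).aestronglyMeasurable hs
  · filter_upwards [h4] with r hr
    have hmem : MemLp (u r) 4 torusMeasure := ⟨Lp.aestronglyMeasurable _, hr⟩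
    rw [cubicCoeff, fourierCoeff]
    simp only [smul_eq_mul]
    refine tendsto_integral_of_dominated_convergence _ (fun j => ?_)
      (integrable_cubic hmem).norm (fun j => ae_of_all _ fun x => ?_) (ae_of_all _ fun x => ?_)
    · exact (fourier (-k)).continuous.aestronglyMeasurable.mul
        ((hφc j).comp_aestronglyMeasurable (Lp.aestronglyMeasurable _))
    · rw [norm_mul, fourier_apply, Circle.norm_coe, one_mul, norm_mul, norm_pow, Complex.norm_real,
        norm_norm]
      refine (hφle j _).trans (le_of_eq (by ring))
    · refine Tendsto.const_mul _ ?_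
      have h1 : Tendsto (fun n : ℕ => (1 + ‖u r x‖ ^ 3 / ((n : ℝ) + 1) : ℝ)) atTop (𝓝 (1 + 0)) := by
        refine Tendsto.const_add _ ?_
        have := (tendsto_one_div_add_atTop_nhds_zero_nat (𝕜 := ℝ)).const_mul (‖u r x‖ ^ 3)
        simpa [div_eq_mul_inv] using this
      have h2 : Tendsto (fun n : ℕ => (((1 + ‖u r x‖ ^ 3 / ((n : ℝ) + 1) : ℝ)) : ℂ)) atTop
          (𝓝 ((1 + 0 : ℝ) : ℂ)) := (Complex.continuous_ofReal.tendsto _).comp h1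
      have h3 := (tendsto_const_nhds (x := ((‖u r x‖ : ℂ) ^ 2 * u r x))).div h2 (by simp)
      rw [add_zero, Complex.ofReal_one, div_one] at h3
      exact h3

/-! ### Hölder estimates for the cubic nonlinearity. -/

theorem lintegral_mul_sq_le {α : Type*} [MeasurableSpace α] {μ : Measure α} {f g : α → ℝ≥0∞}
    (hf : AEMeasurable f μ) (hg : AEMeasurable g μ) :
    (∫⁻ x, f x * g x ∂μ) ^ 2 ≤ (∫⁻ x, f x ^ 2 ∂μ) * ∫⁻ x, g x ^ 2 ∂μ := by
  have h := ENNReal.lintegral_mul_le_Lp_mul_Lq μ Real.HolderConjugate.two_two hf hg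
  refine (pow_le_pow_left' h 2).trans (le_of_eq ?_)
  rw [mul_pow, ← ENNReal.rpow_natCast, ← ENNReal.rpow_natCast, ← ENNReal.rpow_mul,
    ← ENNReal.rpow_mul]
  norm_num

theorem lintegral_mul_mul_mul_pow_four_le {α : Type*} [MeasurableSpace α] {μ : Measure α}
    {f g h : α → ℝ≥0∞} (hf : AEMeasurable f μ) (hg : AEMeasurable g μ) (hh : AEMeasurable h μ) :
    (∫⁻ x, f x * g x * h x ^ 2 ∂μ) ^ 4
      ≤ (∫⁻ x, f x ^ 4 ∂μ) * (∫⁻ x, g x ^ 4 ∂μ) * (∫⁻ x, h x ^ 4 ∂μ) ^ 2 := by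
  have h1 := lintegral_mul_sq_le (hf.mul hg) (hh.pow_const 2)
  have h2 := lintegral_mul_sq_le (hf.pow_const 2) (hg.pow_const 2)
  simp only [Pi.mul_apply, mul_pow, ← pow_mul, Nat.reduceMul] at h1 h2
  calc (∫⁻ x, f x * g x * h x ^ 2 ∂μ) ^ 4 = ((∫⁻ x, f x * g x * h x ^ 2 ∂μ) ^ 2) ^ 2 := by ring
    _ ≤ ((∫⁻ x, f x ^ 2 * g x ^ 2 ∂μ) * ∫⁻ x, h x ^ 4 ∂μ) ^ 2 := pow_le_pow_left' h1 2
    _ = (∫⁻ x, f x ^ 2 * g x ^ 2 ∂μ) ^ 2 * (∫⁻ x, h x ^ 4 ∂μ) ^ 2 := by ring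
    _ ≤ _ := by gcongr

theorem lintegral_mul_mul_sq_le_eLpNorm {f g h : Torus → ℂ} (hf : AEStronglyMeasurable f torusMeasure)
    (hg : AEStronglyMeasurable g torusMeasure) (hh : AEStronglyMeasurable h torusMeasure) :
    ∫⁻ x, ‖f x‖ₑ * ‖g x‖ₑ * ‖h x‖ₑ ^ 2 ∂torusMeasure
      ≤ eLpNorm f 4 torusMeasure * eLpNorm g 4 torusMeasure * eLpNorm h 4 torusMeasure ^ 2 := by
  rw [← ENNReal.pow_le_pow_left_iff four_ne_zero]
  refine (lintegral_mul_mul_mul_pow_four_le hf.enorm hg.enorm hh.enorm).trans (le_of_eq ?_)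
  simp only [← eLpNorm_four_pow_four]
  ring

theorem norm_cubic_sub_cubic_le (z w : ℂ) :
    ‖(‖z‖ : ℂ) ^ 2 * z - (‖w‖ : ℂ) ^ 2 * w‖ ≤ 2 * ‖z - w‖ * (‖z‖ ^ 2 + ‖w‖ ^ 2) := by
  have e : (‖z‖ : ℂ) ^ 2 * z - (‖w‖ : ℂ) ^ 2 * w
      = (‖z‖ : ℂ) ^ 2 * (z - w) + (((‖z‖ - ‖w‖) * (‖z‖ + ‖w‖) : ℝ) : ℂ) * w := by push_cast; ring
  rw [e]
  refine (norm_add_le _ _).trans ?_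
  rw [norm_mul, norm_mul, norm_pow, Complex.norm_real, norm_norm, Complex.norm_real, norm_mul,
    Real.norm_eq_abs, Real.norm_of_nonneg (by positivity : 0 ≤ ‖z‖ + ‖w‖)]
  have h1 := abs_norm_sub_norm_le z w
  have hz := norm_nonneg z
  have hw := norm_nonneg w
  have hd := norm_nonneg (z - w)
  calc ‖z‖ ^ 2 * ‖z - w‖ + |‖z‖ - ‖w‖| * (‖z‖ + ‖w‖) * ‖w‖
      ≤ ‖z‖ ^ 2 * ‖z - w‖ + ‖z - w‖ * (‖z‖ + ‖w‖) * ‖w‖ := by gcongr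
    _ = ‖z - w‖ * (‖z‖ ^ 2 + (‖z‖ + ‖w‖) * ‖w‖) := by ring
    _ ≤ ‖z - w‖ * (2 * (‖z‖ ^ 2 + ‖w‖ ^ 2)) := by
        gcongr
        nlinarith [sq_nonneg (‖z‖ - ‖w‖)]
    _ = _ := by ring

theorem enorm_cubic_sub_cubic_le (z w : ℂ) :
    ‖(‖z‖ : ℂ) ^ 2 * z - (‖w‖ : ℂ) ^ 2 * w‖ₑ ≤ 2 * ‖z - w‖ₑ * (‖z‖ₑ ^ 2 + ‖w‖ₑ ^ 2) := by
  simp only [← ofReal_norm]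
  rw [← ENNReal.ofReal_pow (norm_nonneg _), ← ENNReal.ofReal_pow (norm_nonneg _),
    ← ENNReal.ofReal_add (by positivity) (by positivity),
    show (2 : ℝ≥0∞) = ENNReal.ofReal 2 by simp, ← ENNReal.ofReal_mul two_pos.le,
    ← ENNReal.ofReal_mul (by positivity)]
  exact ENNReal.ofReal_le_ofReal (norm_cubic_sub_cubic_le z w)

theorem enorm_cubicCoeff_le {f : Torus → ℂ} (k : ℤ) :
    ‖cubicCoeff f k‖ₑ ≤ 1 + eLpNorm f 4 torusMeasure ^ 4 := by
  rw [cubicCoeff, fourierCoeff, eLpNorm_four_pow_four]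
  refine (enorm_integral_le_lintegral_enorm _).trans ?_
  have h1 : (1 : ℝ≥0∞) = ∫⁻ _, 1 ∂torusMeasure := by simp
  rw [h1, ← lintegral_add_left measurable_const]
  refine lintegral_mono fun x => ?_
  have h0 := norm_nonneg (f x)
  rw [smul_eq_mul, ← ofReal_norm, ← ofReal_norm, ← ENNReal.ofReal_pow (norm_nonneg _),
    ← ENNReal.ofReal_one, ← ENNReal.ofReal_add zero_le_one (by positivity)]
  refine ENNReal.ofReal_le_ofReal ?_
  rw [norm_mul, fourier_apply, Circle.norm_coe, one_mul, norm_mul, norm_pow, Complex.norm_real,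
    norm_norm]
  nlinarith [sq_nonneg (‖f x‖ ^ 2 - ‖f x‖), sq_nonneg (‖f x‖ ^ 2 - 1), sq_nonneg (‖f x‖ - 1)]

/-! ### Mild solutions and the forcing produced by their difference. -/

/-- `u` is a solution of the cubic Schrödinger equation with coupling constant `κ` on `[a, b]`,
with Duhamel's formula based at `a` and written in the interaction picture. -/
structure IsMild (κ a b : ℝ) (u : ℝ → L2Torus) : Prop where
  continuousOn : ContinuousOn u (Set.Icc a b)
  lintegral_ne_top : ∫⁻ r in Set.Icc a b, eLpNorm (u r) 4 torusMeasure ^ 4 ≠ ∞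
  duhamel : ∀ t ∈ Set.Icc a b, ∀ k : ℤ,
    Complex.exp (Complex.I * (k : ℂ) ^ 2 * t) * fourierCoeff (u t) k
      = Complex.exp (Complex.I * (k : ℂ) ^ 2 * a) * fourierCoeff (u a) k
        - Complex.I * κ * ∫ r in a..t, Complex.exp (Complex.I * (k : ℂ) ^ 2 * r) * cubicCoeff (u r) k

theorem ae_eLpNorm_four_lt_top {u : ℝ → L2Torus} {s : Set ℝ} (hs : MeasurableSet s)
    (hu : ContinuousOn u s)
    (hfin : ∫⁻ r in s, eLpNorm (u r) 4 torusMeasure ^ 4 ≠ ∞) :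
    ∀ᵐ r ∂volume.restrict s, eLpNorm (u r) 4 torusMeasure < ∞ := by
  filter_upwards [ae_lt_top' ((aemeasurable_eLpNorm_four hs hu).pow_const 4) hfin] with r hr
  simpa using hr

theorem integrableOn_cubicCoeff {u : ℝ → L2Torus} {a b : ℝ} (hu : ContinuousOn u (Set.Icc a b))
    (hfin : ∫⁻ r in Set.Icc a b, eLpNorm (u r) 4 torusMeasure ^ 4 ≠ ∞) (k : ℤ) :
    IntegrableOn (fun r => cubicCoeff (u r) k) (Set.Icc a b) := by
  refine ⟨aestronglyMeasurable_cubicCoeff measurableSet_Icc hu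
    (ae_eLpNorm_four_lt_top measurableSet_Icc hu hfin) k, ?_⟩
  refine (lintegral_mono fun r => enorm_cubicCoeff_le k).trans_lt ?_
  rw [lintegral_add_left measurable_const]
  exact ENNReal.add_lt_top.2 ⟨by simp, lt_top_iff_ne_top.2 hfin⟩

theorem integrableOn_exp_mul_cubicCoeff {u : ℝ → L2Torus} {a b : ℝ}
    (hu : ContinuousOn u (Set.Icc a b))
    (hfin : ∫⁻ r in Set.Icc a b, eLpNorm (u r) 4 torusMeasure ^ 4 ≠ ∞) (k : ℤ) :
    IntegrableOn (fun r : ℝ => Complex.exp (Complex.I * (k : ℂ) ^ 2 * r) * cubicCoeff (u r) k)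
      (Set.Icc a b) := by
  refine (integrableOn_cubicCoeff hu hfin k).bdd_mul (c := 1) ?_
    (ae_of_all _ fun r => (norm_exp_I_mul k r).le)
  exact Continuous.aestronglyMeasurable (by fun_prop)

theorem IsMild.intervalIntegrable {κ a b : ℝ} {u : ℝ → L2Torus} (h : IsMild κ a b u) {x y : ℝ}
    (hx : x ∈ Set.Icc a b) (hy : y ∈ Set.Icc a b) (k : ℤ) :
    IntervalIntegrable (fun r : ℝ => Complex.exp (Complex.I * (k : ℂ) ^ 2 * r) * cubicCoeff (u r) k)
      volume x y :=
  ((integrableOn_exp_mul_cubicCoeff h.continuousOn h.lintegral_ne_top k).mono_set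
    (Set.uIcc_subset_Icc hx hy)).intervalIntegrable

theorem IsMild.mono {κ a b x y : ℝ} {u : ℝ → L2Torus} (h : IsMild κ a b u) (hx : a ≤ x)
    (hy : y ≤ b) : IsMild κ x y u where
  continuousOn := h.continuousOn.mono (Set.Icc_subset_Icc hx hy)
  lintegral_ne_top := ne_top_of_le_ne_top h.lintegral_ne_top
    (lintegral_mono_set (Set.Icc_subset_Icc hx hy))
  duhamel t ht k := by
    have hxm : x ∈ Set.Icc a b := ⟨hx, ht.1.trans (ht.2.trans hy)⟩
    have htm : t ∈ Set.Icc a b := ⟨hx.trans ht.1, ht.2.trans hy⟩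
    have ham : a ∈ Set.Icc a b := ⟨le_rfl, hxm.1.trans hxm.2⟩
    rw [h.duhamel t htm k, h.duhamel x hxm k,
      ← intervalIntegral.integral_add_adjacent_intervals (h.intervalIntegrable ham hxm k)
        (h.intervalIntegrable hxm htm k)]
    ring

theorem tendsto_freeWave_coeff (f : L2Torus) :
    Tendsto (fun n : ℕ => ∑ k ∈ Finset.Icc (-(n : ℤ)) n,
      fourierCoeff f k • (fourierLp 2 k : L2Torus)) atTop (𝓝 f) :=
  (hasSum_fourier_series_L2 f).comp Finset.tendsto_Icc_neg

theorem coeFn_sum_fourierLp (K : Finset ℤ) (b : ℤ → ℂ) :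
    ((∑ k ∈ K, b k • (fourierLp 2 k : L2Torus) : L2Torus) : Torus → ℂ)
      =ᵐ[torusMeasure] fun x => ∑ k ∈ K, b k * fourier k x := by
  have h1 : ∀ᵐ x ∂torusMeasure, ∀ k : ℤ, (b k • (fourierLp 2 k : L2Torus) : L2Torus) x
      = b k * fourier k x := by
    rw [ae_all_iff]
    intro k
    filter_upwards [Lp.coeFn_smul (b k) (fourierLp 2 k : L2Torus),
      coeFn_fourierLp (T := 2 * Real.pi) 2 k] with x hx1 hx2
    rw [hx1, Pi.smul_apply, hx2, smul_eq_mul]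
  filter_upwards [h1, Lp.coeFn_finsetSum K fun k => (b k • (fourierLp 2 k : L2Torus))] with x hx1 hx2
  rw [hx2, Finset.sum_apply]
  exact Finset.sum_congr rfl fun k _ => hx1 k

/-- The sum is the integral of the nonlinearity difference against a conjugated trigonometric
polynomial. The pointwise bound 2|f - g|(|f|² + |g|²) and Hölder with four L⁴ factors finish; this
is the duality required by `IsForcing`. -/
theorem enorm_sum_conj_mul_cubicCoeff_sub_le {f g : L2Torus} (hf : eLpNorm f 4 torusMeasure < ∞)
    (hg : eLpNorm g 4 torusMeasure < ∞) (K : Finset ℤ) (b : ℤ → ℂ) :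
    ‖∑ k ∈ K, starRingEnd ℂ (b k) * (cubicCoeff f k - cubicCoeff g k)‖ₑ
      ≤ 2 * eLpNorm (f - g : L2Torus) 4 torusMeasure *
          (eLpNorm f 4 torusMeasure ^ 2 + eLpNorm g 4 torusMeasure ^ 2) *
        eLpNorm (fun x : Torus => ∑ k ∈ K, b k * fourier k x) 4 torusMeasure := by
  have hif := integrable_cubic (f := f) ⟨Lp.aestronglyMeasurable _, hf⟩
  have hig := integrable_cubic (f := g) ⟨Lp.aestronglyMeasurable _, hg⟩
  set φ : Torus → ℂ := fun x => ∑ k ∈ K, b k * fourier k x with hφ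
  have hφm : AEStronglyMeasurable φ torusMeasure := Continuous.aestronglyMeasurable
    (continuous_finsetSum _ fun k _ => continuous_const.mul (fourier k).continuous)
  have hbdd : ∀ (k : ℤ) {h : Torus → ℂ}, Integrable h torusMeasure →
      Integrable (fun x => fourier (-k) x * h x) torusMeasure := fun k h hh =>
    hh.bdd_mul (c := 1) (fourier (-k)).continuous.aestronglyMeasurable
      (ae_of_all _ fun x => by rw [fourier_apply, Circle.norm_coe])
  have hsum : ∑ k ∈ K, starRingEnd ℂ (b k) * (cubicCoeff f k - cubicCoeff g k)
      = ∫ x, starRingEnd ℂ (φ x) *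
        ((‖f x‖ : ℂ) ^ 2 * f x - (‖g x‖ : ℂ) ^ 2 * g x) ∂torusMeasure := by
    have hpt : ∀ x, starRingEnd ℂ (φ x) * ((‖f x‖ : ℂ) ^ 2 * f x - (‖g x‖ : ℂ) ^ 2 * g x)
        = ∑ k ∈ K, starRingEnd ℂ (b k) * (fourier (-k) x *
          ((‖f x‖ : ℂ) ^ 2 * f x - (‖g x‖ : ℂ) ^ 2 * g x)) := fun x => by
      simp only [hφ, map_sum, map_mul, ← fourier_neg, Finset.sum_mul, mul_assoc]
    have hid : Integrable (fun x => (‖f x‖ : ℂ) ^ 2 * f x - (‖g x‖ : ℂ) ^ 2 * g x) torusMeasure :=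
      hif.sub hig
    simp_rw [hpt]
    rw [integral_finsetSum _ fun k _ => (hbdd k hid).const_mul _]
    refine Finset.sum_congr rfl fun k _ => ?_
    rw [integral_const_mul]
    congr 1
    simp only [mul_sub]
    rw [integral_sub (hbdd k hif) (hbdd k hig)]
    rfl
  rw [hsum]
  refine (enorm_integral_le_lintegral_enorm _).trans ?_
  have hsubae : ∀ᵐ x ∂torusMeasure, (f - g : L2Torus) x = f x - g x := Lp.coeFn_sub f g
  have hle : ∫⁻ x, ‖starRingEnd ℂ (φ x) *
        ((‖f x‖ : ℂ) ^ 2 * f x - (‖g x‖ : ℂ) ^ 2 * g x)‖ₑ ∂torusMeasure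
      ≤ ∫⁻ x, (2 * (‖φ x‖ₑ * ‖(f - g : L2Torus) x‖ₑ * ‖f x‖ₑ ^ 2)
        + 2 * (‖φ x‖ₑ * ‖(f - g : L2Torus) x‖ₑ * ‖g x‖ₑ ^ 2)) ∂torusMeasure := by
    refine lintegral_mono_ae ?_
    filter_upwards [hsubae] with x hx
    rw [enorm_mul, RCLike.enorm_conj, hx]
    refine (mul_le_mul_right (enorm_cubic_sub_cubic_le _ _) _).trans (le_of_eq ?_)
    ring
  refine hle.trans ?_
  have hwm := Lp.aestronglyMeasurable (f - g : L2Torus)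
  have hfm := Lp.aestronglyMeasurable f
  have hgm := Lp.aestronglyMeasurable g
  rw [lintegral_add_left' (by
      exact (((hφm.enorm.mul hwm.enorm).mul (hfm.enorm.pow_const 2)).const_mul 2)),
    lintegral_const_mul' _ _ (by simp), lintegral_const_mul' _ _ (by simp)]
  calc _ ≤ 2 * (eLpNorm φ 4 torusMeasure * eLpNorm (f - g : L2Torus) 4 torusMeasure *
          eLpNorm f 4 torusMeasure ^ 2) +
        2 * (eLpNorm φ 4 torusMeasure * eLpNorm (f - g : L2Torus) 4 torusMeasure *
          eLpNorm g 4 torusMeasure ^ 2) := by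
        gcongr
        · exact lintegral_mul_mul_sq_le_eLpNorm hφm hwm hfm
        · exact lintegral_mul_mul_sq_le_eLpNorm hφm hwm hgm
    _ = _ := by ring

theorem ENNReal_add_sq_le (p r : ℝ≥0∞) : (p + r) ^ 2 ≤ 2 * (p ^ 2 + r ^ 2) := by
  by_cases hp : p = ∞
  · simp [hp]
  by_cases hr : r = ∞
  · simp [hr]
  lift p to ℝ≥0 using hp
  lift r to ℝ≥0 using hr
  norm_cast
  rw [← NNReal.coe_le_coe]
  push_cast
  nlinarith [sq_nonneg ((p : ℝ) - r)]

/-- Finiteness of this quantity is what permits absorbing it into the left side in the uniqueness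
argument. -/
theorem lintegral_sub_pow_four_ne_top {κ a b : ℝ} {u U : ℝ → L2Torus} (hu : IsMild κ a b u)
    (hU : IsMild κ a b U) :
    ∫⁻ r in Set.Icc a b, eLpNorm (u r - U r : L2Torus) 4 torusMeasure ^ 4 ≠ ∞ := by
  have hle : ∀ r, eLpNorm (u r - U r : L2Torus) 4 torusMeasure ^ 4
      ≤ 2 * eLpNorm (u r) 4 torusMeasure ^ 4 + 125 * eLpNorm (U r) 4 torusMeasure ^ 4 := fun r => by
    refine le_trans (pow_le_pow_left' ?_ 4) (ENNReal_add_pow_four_le _ _)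
    rw [eLpNorm_congr_ae (Lp.coeFn_sub _ _)]
    exact eLpNorm_sub_le (Lp.aestronglyMeasurable _) (Lp.aestronglyMeasurable _) (by norm_num)
  refine ne_top_of_le_ne_top ?_ (lintegral_mono hle)
  rw [lintegral_add_left' (((aemeasurable_eLpNorm_four measurableSet_Icc
    hu.continuousOn).pow_const 4).const_mul 2), lintegral_const_mul' _ _ (by simp),
    lintegral_const_mul' _ _ (by simp)]
  exact ENNReal.add_ne_top.2 ⟨ENNReal.mul_ne_top (by simp) hu.lintegral_ne_top,
    ENNReal.mul_ne_top (by simp) hU.lintegral_ne_top⟩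

/-- The function of time controlling the difference of two cubic nonlinearities in `L^{4/3}`. -/
def cubicDiffBound (u U : ℝ → L2Torus) (r : ℝ) : ℝ≥0∞ :=
  2 * eLpNorm (u r - U r : L2Torus) 4 torusMeasure *
    (eLpNorm (u r) 4 torusMeasure ^ 2 + eLpNorm (U r) 4 torusMeasure ^ 2)

theorem aemeasurable_cubicDiffBound {u U : ℝ → L2Torus} {s : Set ℝ} (hs : MeasurableSet s)
    (hu : ContinuousOn u s) (hU : ContinuousOn U s) :
    AEMeasurable (cubicDiffBound u U) (volume.restrict s) := by
  have h1 := aemeasurable_eLpNorm_four hs hu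
  have h2 := aemeasurable_eLpNorm_four hs hU
  have h3 : AEMeasurable (fun r => eLpNorm (u r - U r : L2Torus) 4 torusMeasure)
      (volume.restrict s) := aemeasurable_eLpNorm_four hs (hu.sub hU)
  exact (h3.const_mul 2).mul ((h1.pow_const 2).add (h2.pow_const 2))

/-- Hölder in time with exponents 3 and 3/2 applied to W^{4/3} V^{4/3}, where V is quadratic in the
L⁴ norms. The constant 64 is 2⁴ from the factor 2 in the bound times 2² from squaring ∫ V². -/
theorem lintegral_cubicDiffBound_pow_three_le {u U : ℝ → L2Torus} {s : Set ℝ} (hs : MeasurableSet s)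
    (hu : ContinuousOn u s) (hU : ContinuousOn U s) :
    (∫⁻ r in s, cubicDiffBound u U r ^ (4 / 3 : ℝ)) ^ 3
      ≤ 64 * (∫⁻ r in s, eLpNorm (u r - U r : L2Torus) 4 torusMeasure ^ 4) *
        ((∫⁻ r in s, eLpNorm (u r) 4 torusMeasure ^ 4)
          + ∫⁻ r in s, eLpNorm (U r) 4 torusMeasure ^ 4) ^ 2 := by
  set W : ℝ → ℝ≥0∞ := fun r => eLpNorm (u r - U r : L2Torus) 4 torusMeasure with hW
  set V : ℝ → ℝ≥0∞ := fun r => eLpNorm (u r) 4 torusMeasure ^ 2 + eLpNorm (U r) 4 torusMeasure ^ 2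
    with hV
  have h1 := aemeasurable_eLpNorm_four hs hu
  have h2 := aemeasurable_eLpNorm_four hs hU
  have h3 : AEMeasurable W (volume.restrict s) := aemeasurable_eLpNorm_four hs (hu.sub hU)
  have hVm : AEMeasurable V (volume.restrict s) := (h1.pow_const 2).add (h2.pow_const 2)
  have hH : ∀ r, cubicDiffBound u U r ^ (4 / 3 : ℝ)
      = (2 : ℝ≥0∞) ^ (4 / 3 : ℝ) * (W r ^ (4 / 3 : ℝ) * V r ^ (4 / 3 : ℝ)) := fun r => by
    rw [cubicDiffBound, ENNReal.mul_rpow_of_nonneg _ _ (by norm_num),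
      ENNReal.mul_rpow_of_nonneg _ _ (by norm_num), mul_assoc]
  have hHol := ENNReal.lintegral_mul_le_Lp_mul_Lq (volume.restrict s) (p := 3) (q := 3 / 2)
      ⟨by norm_num, by norm_num, by norm_num⟩ (h3.pow_const (4 / 3 : ℝ)) (hVm.pow_const (4 / 3 : ℝ))
  simp only [Pi.mul_apply, ← ENNReal.rpow_mul] at hHol
  norm_num at hHol
  have hV2 : ∫⁻ r in s, V r ^ 2 ≤ 2 * ((∫⁻ r in s, eLpNorm (u r) 4 torusMeasure ^ 4)
          + ∫⁻ r in s, eLpNorm (U r) 4 torusMeasure ^ 4) := by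
    rw [← lintegral_add_left' (h1.pow_const 4), ← lintegral_const_mul' _ _ (by simp)]
    refine lintegral_mono fun r => ?_
    simp only [hV]
    have := ENNReal_add_sq_le (eLpNorm (u r) 4 torusMeasure ^ 2) (eLpNorm (U r) 4 torusMeasure ^ 2)
    simpa only [← pow_mul] using this
  simp_rw [hH]
  rw [lintegral_const_mul' _ _ (by simp), mul_pow]
  have e2 : ((2 : ℝ≥0∞) ^ (4 / 3 : ℝ)) ^ 3 = 16 := by
    rw [← ENNReal.rpow_natCast, ← ENNReal.rpow_mul]
    norm_num
  rw [e2]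
  have h4 : (∫⁻ r in s, W r ^ (4 / 3 : ℝ) * V r ^ (4 / 3 : ℝ)) ^ 3
      ≤ (∫⁻ r in s, W r ^ 4) * (∫⁻ r in s, V r ^ 2) ^ 2 := by
    refine (pow_le_pow_left' hHol 3).trans (le_of_eq ?_)
    rw [mul_pow, ← ENNReal.rpow_natCast, ← ENNReal.rpow_natCast, ← ENNReal.rpow_mul,
      ← ENNReal.rpow_mul]
    norm_num
  calc _ ≤ 16 * ((∫⁻ r in s, W r ^ 4) * (2 * ((∫⁻ r in s, eLpNorm (u r) 4 torusMeasure ^ 4)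
          + ∫⁻ r in s, eLpNorm (U r) 4 torusMeasure ^ 4)) ^ 2) := by
        gcongr
        exact h4.trans (by gcongr)
    _ = _ := by ring

theorem isForcing_cubicDiff {κ a b : ℝ} {u U : ℝ → L2Torus} (hu : IsMild κ a b u)
    (hU : IsMild κ a b U) :
    IsForcing (fun r k => (Set.Icc a b).indicator (fun r => cubicCoeff (u r) k - cubicCoeff (U r) k) r)
      ((Set.Icc a b).indicator (cubicDiffBound u U)) where
  integrable k := by
    rw [integrable_indicator_iff measurableSet_Icc]
    exact (integrableOn_cubicCoeff hu.continuousOn hu.lintegral_ne_top k).sub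
      (integrableOn_cubicCoeff hU.continuousOn hU.lintegral_ne_top k)
  aemeasurable := (aemeasurable_indicator_iff measurableSet_Icc).2
    (aemeasurable_cubicDiffBound measurableSet_Icc hu.continuousOn hU.continuousOn)
  lintegral_ne_top := by
    have e : ∀ r, (Set.Icc a b).indicator (cubicDiffBound u U) r ^ (4 / 3 : ℝ)
        = (Set.Icc a b).indicator (fun r => cubicDiffBound u U r ^ (4 / 3 : ℝ)) r := fun r => by
      by_cases hr : r ∈ Set.Icc a b <;> simp [hr]
    simp_rw [e]
    rw [lintegral_indicator measurableSet_Icc]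
    have h := lintegral_cubicDiffBound_pow_three_le measurableSet_Icc hu.continuousOn hU.continuousOn
    have hW := lintegral_sub_pow_four_ne_top hu hU
    refine fun htop => ?_
    rw [htop] at h
    refine absurd h (not_le.2 ?_)
    rw [ENNReal.top_pow three_ne_zero, lt_top_iff_ne_top]
    exact ENNReal.mul_ne_top (ENNReal.mul_ne_top (by simp) hW)
      (ENNReal.pow_ne_top (ENNReal.add_ne_top.2 ⟨hu.lintegral_ne_top, hU.lintegral_ne_top⟩))
  dual := by
    have h1 := (ae_restrict_iff' measurableSet_Icc).1
      (ae_eLpNorm_four_lt_top measurableSet_Icc hu.continuousOn hu.lintegral_ne_top)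
    have h2 := (ae_restrict_iff' measurableSet_Icc).1
      (ae_eLpNorm_four_lt_top measurableSet_Icc hU.continuousOn hU.lintegral_ne_top)
    filter_upwards [h1, h2] with r hr1 hr2 K c
    by_cases hr : r ∈ Set.Icc a b
    · simp only [Set.indicator_of_mem hr]
      exact enorm_sum_conj_mul_cubicCoeff_sub_le (hr1 hr) (hr2 hr) K c
    · simp [Set.indicator_of_notMem hr]

theorem fourierCoeff_sub_L2 (f g : L2Torus) (k : ℤ) :
    fourierCoeff (f - g : L2Torus) k = fourierCoeff f k - fourierCoeff g k := by
  rw [← fourierBasis_repr, ← fourierBasis_repr, ← fourierBasis_repr, map_sub]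
  rfl

theorem IsMild.fourierCoeff_sub {κ a b : ℝ} {u U : ℝ → L2Torus} (hu : IsMild κ a b u)
    (hU : IsMild κ a b U) (h0 : u a = U a) {t : ℝ} (ht : t ∈ Set.Icc a b) (k : ℤ) :
    fourierCoeff (u t - U t : L2Torus) k = -(Complex.I * κ) *
      (duhamelCoeff (fun r k => (Set.Icc a b).indicator
        (fun r => cubicCoeff (u r) k - cubicCoeff (U r) k) r) a t k *
        Complex.exp (-(Complex.I * (k : ℂ) ^ 2 * t))) := by
  have ham : a ∈ Set.Icc a b := ⟨le_rfl, ht.1.trans ht.2⟩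
  have e1 := hu.duhamel t ht k
  have e2 := hU.duhamel t ht k
  have e3 : duhamelCoeff (fun r k => (Set.Icc a b).indicator
        (fun r => cubicCoeff (u r) k - cubicCoeff (U r) k) r) a t k
      = (∫ r in a..t, Complex.exp (Complex.I * (k : ℂ) ^ 2 * r) * cubicCoeff (u r) k)
        - ∫ r in a..t, Complex.exp (Complex.I * (k : ℂ) ^ 2 * r) * cubicCoeff (U r) k := by
    rw [duhamelCoeff, ← intervalIntegral.integral_sub (hu.intervalIntegrable ham ht k)
      (hU.intervalIntegrable ham ht k)]
    refine intervalIntegral.integral_congr fun r hr => ?_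
    rw [Set.uIcc_of_le ht.1] at hr
    rw [Set.indicator_of_mem (show r ∈ Set.Icc a b from ⟨hr.1, hr.2.trans ht.2⟩), mul_sub]
  have e4 : Complex.exp (-(Complex.I * (k : ℂ) ^ 2 * t)) * Complex.exp (Complex.I * (k : ℂ) ^ 2 * t)
      = 1 := by rw [← Complex.exp_add]; simp
  rw [fourierCoeff_sub_L2, e3]
  have e5 : fourierCoeff (u t) k - fourierCoeff (U t) k
      = Complex.exp (-(Complex.I * (k : ℂ) ^ 2 * t)) *
        (Complex.exp (Complex.I * (k : ℂ) ^ 2 * t) * fourierCoeff (u t) k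
          - Complex.exp (Complex.I * (k : ℂ) ^ 2 * t) * fourierCoeff (U t) k) := by
    rw [← mul_sub, ← mul_assoc, e4, one_mul]
  rw [e5, e1, e2, h0]
  ring

/-! ### Uniqueness. -/

/-- Strichartz estimate for the difference of two solutions with the same initial value. -/
theorem IsMild.lintegral_sub_pow_four_le {κ a b : ℝ} (hab : a ≤ b) (hab' : b ≤ a + 2 * Real.pi)
    {u U : ℝ → L2Torus} (hu : IsMild κ a b u) (hU : IsMild κ a b U) (h0 : u a = U a) :
    ∫⁻ r in Set.Icc a b, eLpNorm (u r - U r : L2Torus) 4 torusMeasure ^ 4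
      ≤ ENNReal.ofReal |κ| ^ 4 * (250 * ENNReal.ofReal (4 * Real.pi) ^ 2) *
        (64 * (∫⁻ r in Set.Icc a b, eLpNorm (u r - U r : L2Torus) 4 torusMeasure ^ 4) *
        ((∫⁻ r in Set.Icc a b, eLpNorm (u r) 4 torusMeasure ^ 4)
          + ∫⁻ r in Set.Icc a b, eLpNorm (U r) 4 torusMeasure ^ 4) ^ 2) := by
  have hF := isForcing_cubicDiff hu hU
  set F : ℝ → ℤ → ℂ := fun r k => (Set.Icc a b).indicator
    (fun r => cubicCoeff (u r) k - cubicCoeff (U r) k) r with hFdef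
  set K : ℕ → Finset ℤ := fun n => Finset.Icc (-(n : ℤ)) n with hK
  set G : ℕ → ℝ → ℝ≥0∞ := fun n t => ENNReal.ofReal |κ| ^ 4 *
    eLpNorm (freeWave (K n) (duhamelCoeff F a t) t) 4 torusMeasure ^ 4 with hG
  have hGm : ∀ n, Measurable (G n) := fun n =>
    ((measurable_eLpNorm_four_freeWave (K n) fun k =>
      hF.continuous_duhamelCoeff a k).pow_const 4).const_mul _
  -- The Strichartz bound is uniform in the set of modes, so lower semicontinuity at each time and
  -- then Fatou's lemma in time remove the truncation.
  have hpt : ∀ t ∈ Set.Icc a b, eLpNorm (u t - U t : L2Torus) 4 torusMeasure ^ 4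
      ≤ liminf (fun n => G n t) atTop := by
    intro t ht
    refine (eLpNorm_four_pow_four_le_liminf (tendsto_freeWave_coeff (u t - U t))).trans (le_of_eq ?_)
    congr 1
    ext n
    rw [eLpNorm_congr_ae (coeFn_sum_fourierLp _ _)]
    have : (fun x : Torus => ∑ k ∈ Finset.Icc (-(n : ℤ)) n,
          fourierCoeff (u t - U t : L2Torus) k * fourier k x)
        = (-(Complex.I * κ)) • freeWave (K n) (duhamelCoeff F a t) t := by
      ext x
      rw [Pi.smul_apply, smul_eq_mul, freeWave, Finset.mul_sum]
      refine Finset.sum_congr rfl fun k _ => ?_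
      rw [hu.fourierCoeff_sub hU h0 ht k]
      ring
    rw [this, eLpNorm_const_smul, mul_pow, hG]
    congr 2
    rw [enorm_neg, enorm_mul, ← ofReal_norm, ← ofReal_norm, Complex.norm_I, Complex.norm_real]
    simp
  have hres : (volume : Measure ℝ).restrict (Set.Icc a b) = volume.restrict (Set.Ioc a b) :=
    Measure.restrict_congr_set Ioc_ae_eq_Icc.symm
  have hM : ∫⁻ r in Set.Ioc a b, (Set.Icc a b).indicator (cubicDiffBound u U) r ^ (4 / 3 : ℝ)
      ≤ ∫⁻ r in Set.Icc a b, cubicDiffBound u U r ^ (4 / 3 : ℝ) := by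
    refine (lintegral_mono_set Set.Ioc_subset_Icc_self).trans (le_of_eq ?_)
    exact setLIntegral_congr_fun measurableSet_Icc fun r hr => by
      simp only [Set.indicator_of_mem hr]
  calc ∫⁻ r in Set.Icc a b, eLpNorm (u r - U r : L2Torus) 4 torusMeasure ^ 4
      ≤ ∫⁻ r in Set.Icc a b, liminf (fun n => G n r) atTop :=
        setLIntegral_mono' measurableSet_Icc hpt
    _ ≤ liminf (fun n => ∫⁻ r in Set.Icc a b, G n r) atTop := lintegral_liminf_le hGm
    _ ≤ ENNReal.ofReal |κ| ^ 4 * (250 * ENNReal.ofReal (4 * Real.pi) ^ 2) *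
        (∫⁻ r in Set.Icc a b, cubicDiffBound u U r ^ (4 / 3 : ℝ)) ^ 3 := by
        refine liminf_le_of_le (by isBoundedDefault) fun c hc => ?_
        obtain ⟨n, hn⟩ := hc.exists
        refine hn.trans ?_
        rw [hres, hG, lintegral_const_mul' _ _ (by simp), mul_assoc]
        gcongr
        refine (hF.lintegral_duhamel_pow_four_le (K n) hab hab').trans ?_
        rw [hres] at hM
        exact mul_le_mul_right (pow_le_pow_left' hM 3) _
    _ ≤ _ := by
        gcongr
        exact lintegral_cubicDiffBound_pow_three_le measurableSet_Icc hu.continuousOn hU.continuousOn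

/-- Uniqueness on short time intervals. -/
theorem IsMild.eqOn_of_small {κ a b : ℝ} (hab : a < b) (hab' : b ≤ a + 2 * Real.pi)
    {u U : ℝ → L2Torus} (hu : IsMild κ a b u) (hU : IsMild κ a b U) (h0 : u a = U a)
    (hsmall : ENNReal.ofReal |κ| ^ 4 * (250 * ENNReal.ofReal (4 * Real.pi) ^ 2) *
      (64 * ((∫⁻ r in Set.Icc a b, eLpNorm (u r) 4 torusMeasure ^ 4)
          + ∫⁻ r in Set.Icc a b, eLpNorm (U r) 4 torusMeasure ^ 4) ^ 2) < 1) :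
    Set.EqOn u U (Set.Icc a b) := by
  have h := IsMild.lintegral_sub_pow_four_le hab.le hab' hu hU h0
  have hfin := lintegral_sub_pow_four_ne_top hu hU
  have hz : ∫⁻ r in Set.Icc a b, eLpNorm (u r - U r : L2Torus) 4 torusMeasure ^ 4 = 0 := by
    by_contra hne
    refine absurd h (not_le.2 ?_)
    set Z := ∫⁻ r in Set.Icc a b, eLpNorm (u r - U r : L2Torus) 4 torusMeasure ^ 4
    calc _ = (ENNReal.ofReal |κ| ^ 4 * (250 * ENNReal.ofReal (4 * Real.pi) ^ 2) *
        (64 * ((∫⁻ r in Set.Icc a b, eLpNorm (u r) 4 torusMeasure ^ 4)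
          + ∫⁻ r in Set.Icc a b, eLpNorm (U r) 4 torusMeasure ^ 4) ^ 2)) * Z := by ring
      _ < 1 * Z := (ENNReal.mul_lt_mul_iff_left hne hfin).2 hsmall
      _ = Z := one_mul Z
  have hm : AEMeasurable (fun r => eLpNorm (u r - U r : L2Torus) 4 torusMeasure ^ 4)
      (volume.restrict (Set.Icc a b)) := (aemeasurable_eLpNorm_four measurableSet_Icc
        (u := fun r => u r - U r) (hu.continuousOn.sub hU.continuousOn)).pow_const 4
  have hae : u =ᵐ[volume.restrict (Set.Icc a b)] U := by
    filter_upwards [(lintegral_eq_zero_iff' hm).1 hz] with r hr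
    have h1 : eLpNorm (u r - U r : L2Torus) 4 torusMeasure = 0 := by simpa using hr
    have h2 := (eLpNorm_eq_zero_iff (Lp.aestronglyMeasurable _) (by norm_num)).1 h1
    rw [← sub_eq_zero]
    exact (Lp.eq_zero_iff_ae_eq_zero).2 h2
  exact Measure.eqOn_Icc_of_ae_eq volume hab.ne hae hu.continuousOn hU.continuousOn

/-- Uniqueness in `C([a, b]; L²) ∩ L⁴`. -/
theorem IsMild.eqOn {κ a b : ℝ} {u U : ℝ → L2Torus} (hu : IsMild κ a b u)
    (hU : IsMild κ a b U) (h0 : u a = U a) : Set.EqOn u U (Set.Icc a b) := by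
  set f : ℝ → ℝ≥0∞ := fun r => eLpNorm (u r) 4 torusMeasure ^ 4 + eLpNorm (U r) 4 torusMeasure ^ 4
    with hf
  have hfm := (aemeasurable_eLpNorm_four measurableSet_Icc hu.continuousOn).pow_const 4
  have hffin : ∫⁻ r in Set.Icc a b, f r ≠ ∞ := by
    rw [hf, lintegral_add_left' hfm]
    exact ENNReal.add_ne_top.2 ⟨hu.lintegral_ne_top, hU.lintegral_ne_top⟩
  have hclosed : IsClosed ({t | u t = U t} ∩ Set.Icc a b) := by
    have : {t | u t = U t} ∩ Set.Icc a b = Set.Icc a b ∩ (fun t => u t - U t) ⁻¹' {0} := by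
      ext t
      simp only [Set.mem_inter_iff, Set.mem_ofPred_eq, Set.mem_preimage, Set.mem_singleton_iff,
        sub_eq_zero, and_comm]
    rw [this]
    exact (hu.continuousOn.sub hU.continuousOn).preimage_isClosed_of_isClosed isClosed_Icc
      isClosed_singleton
  -- Continuous induction: from any point of agreement, absolute continuity of the L⁴ integrals
  -- provides a short interval to the right on which `IsMild.eqOn_of_small` applies.
  refine hclosed.Icc_subset_of_forall_exists_gt h0 ?_
  rintro x ⟨hxu, hxa, hxb⟩ y hy
  have hlim : Tendsto (fun z => ∫⁻ r in Set.Icc x z, f r ∂(volume.restrict (Set.Icc a b)))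
      (𝓝[>] x) (𝓝 0) := by
    refine tendsto_setLIntegral_zero hffin ?_
    have h1 : Tendsto (fun z => ENNReal.ofReal (z - x)) (𝓝[>] x) (𝓝 0) := by
      have : Tendsto (fun z => ENNReal.ofReal (z - x)) (𝓝 x) (𝓝 (ENNReal.ofReal (x - x))) :=
        ENNReal.tendsto_ofReal (tendsto_id.sub_const x)
      rw [sub_self, ENNReal.ofReal_zero] at this
      exact this.mono_left nhdsWithin_le_nhds
    refine tendsto_of_tendsto_of_tendsto_of_le_of_le tendsto_const_nhds h1 (fun _ => zero_le)
      fun z => ?_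
    refine (Measure.restrict_apply_le _ _).trans ?_
    rw [Real.volume_Icc]
  have hlim2 : Tendsto (fun z => ENNReal.ofReal |κ| ^ 4 * (250 * ENNReal.ofReal (4 * Real.pi) ^ 2) *
      (64 * (∫⁻ r in Set.Icc x z, f r ∂(volume.restrict (Set.Icc a b))) ^ 2)) (𝓝[>] x)
      (𝓝 (ENNReal.ofReal |κ| ^ 4 * (250 * ENNReal.ofReal (4 * Real.pi) ^ 2) * (64 * 0 ^ 2))) := by
    refine ENNReal.Tendsto.const_mul (ENNReal.Tendsto.const_mul (ENNReal.Tendsto.pow hlim)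
      (Or.inr (by simp))) (Or.inr ?_)
    exact ENNReal.mul_ne_top (ENNReal.pow_ne_top ENNReal.ofReal_ne_top)
      (ENNReal.mul_ne_top (by simp) (ENNReal.pow_ne_top ENNReal.ofReal_ne_top))
  have hev := hlim2.eventually (gt_mem_nhds (show _ < (1 : ℝ≥0∞) by simp))
  have hev2 : ∀ᶠ z in 𝓝[>] x, z ∈ Set.Ioc x (min (min y b) (x + 2 * Real.pi)) := by
    refine Ioc_mem_nhdsGT ?_
    simp only [lt_min_iff]
    exact ⟨⟨hy, hxb⟩, by linarith [Real.pi_pos]⟩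
  obtain ⟨z, hz1, hz2, hz3⟩ := (hev.and hev2).exists
  simp only [le_min_iff] at hz3
  have hsub : Set.Icc x z ⊆ Set.Icc a b := Set.Icc_subset_Icc hxa hz3.1.2
  rw [Measure.restrict_restrict_of_subset hsub, hf,
    lintegral_add_left' (hfm.mono_measure (Measure.restrict_mono hsub le_rfl))] at hz1
  have := IsMild.eqOn_of_small hz2 hz3.2 (hu.mono hxa hz3.1.2) (hU.mono hxa hz3.1.2) hxu hz1
  exact ⟨z, this ⟨hz2.le, le_rfl⟩, hz2, hz3.1.1⟩

/-! ### Passing between ℓ¹ trajectories and L² solutions. -/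

/-- The function with Fourier coefficients `e^{-ik²t} v k`. -/
def wave (t : ℝ) (v : EllOne) : C(Torus, ℂ) :=
  ∑' k : ℤ, (Complex.exp (-(Complex.I * (k : ℂ) ^ 2 * t)) * v k) • fourier k

/-- `wave t v` as an element of `L²`. -/
def waveLp (t : ℝ) (v : EllOne) : L2Torus := ContinuousMap.toLp 2 torusMeasure ℂ (wave t v)

theorem norm_waveTerm (t : ℝ) (v : EllOne) (k : ℤ) :
    ‖(Complex.exp (-(Complex.I * (k : ℂ) ^ 2 * t)) * v k) • (fourier k : C(Torus, ℂ))‖ = ‖v k‖ := by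
  rw [norm_smul, fourier_norm, norm_mul, norm_exp_neg_I_mul, one_mul, mul_one]

theorem summable_norm_waveTerm (t : ℝ) (v : EllOne) : Summable fun k : ℤ =>
    ‖(Complex.exp (-(Complex.I * (k : ℂ) ^ 2 * t)) * v k) • (fourier k : C(Torus, ℂ))‖ := by
  simp_rw [norm_waveTerm]
  exact v.hasSum_norm.summable

theorem hasSum_wave (t : ℝ) (v : EllOne) : HasSum
    (fun k : ℤ => (Complex.exp (-(Complex.I * (k : ℂ) ^ 2 * t)) * v k) • (fourier k : C(Torus, ℂ)))
    (wave t v) :=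
  (summable_norm_waveTerm t v).of_norm.hasSum

theorem norm_wave_le (t : ℝ) (v : EllOne) : ‖wave t v‖ ≤ ‖v‖ := by
  refine (norm_tsum_le_tsum_norm (summable_norm_waveTerm t v)).trans (le_of_eq ?_)
  simp_rw [norm_waveTerm]
  exact v.hasSum_norm.tsum_eq

theorem wave_sub (t : ℝ) (v w : EllOne) : wave t (v - w) = wave t v - wave t w := by
  refine (hasSum_wave t (v - w)).unique (((hasSum_wave t v).sub (hasSum_wave t w)).congr_fun ?_)
  intro k
  rw [← sub_smul, lp.coeFn_sub, Pi.sub_apply, mul_sub]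

theorem continuous_wave_left (v : EllOne) : Continuous fun t => wave t v := by
  refine continuous_tsum (fun k => ?_) v.hasSum_norm.summable fun k t => (norm_waveTerm t v k).le
  have : Continuous fun t : ℝ => Complex.exp (-(Complex.I * (k : ℂ) ^ 2 * t)) * v k := by fun_prop
  exact this.smul continuous_const

theorem continuous_wave {v : ℝ → EllOne} (hv : Continuous v) :
    Continuous fun t => wave t (v t) := by
  rw [continuous_iff_continuousAt]
  intro s
  have h1 : Tendsto (fun t => wave t (v t - v s)) (𝓝 s) (𝓝 0) := by
    refine squeeze_zero_norm (fun t => norm_wave_le t _) ?_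
    have : Tendsto (fun t => ‖v t - v s‖) (𝓝 s) (𝓝 ‖v s - v s‖) :=
      ((hv.sub continuous_const).norm).tendsto s
    simpa using this
  have h2 := h1.add ((continuous_wave_left (v s)).tendsto s)
  rw [zero_add] at h2
  refine h2.congr fun t => ?_
  rw [wave_sub, sub_add_cancel]

/-- The frequency map `m` need not be injective, so that the statement covers both the series of a
wave and the triple series of its cubic nonlinearity. -/
theorem hasSum_fourierCoeff {ι : Type*} {b : ι → ℂ} {m : ι → ℤ} {F : C(Torus, ℂ)}
    (h : HasSum (fun i => b i • (fourier (m i) : C(Torus, ℂ))) F) (k : ℤ) :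
    HasSum (fun i => if m i = k then b i else 0) (fourierCoeff F k) := by
  have h1 := (h.mapL (ContinuousMap.toLp 2 torusMeasure ℂ)).mapL
    (innerSL ℂ (fourierLp (T := 2 * Real.pi) 2 k))
  have h2 : innerSL ℂ (fourierLp (T := 2 * Real.pi) 2 k) (ContinuousMap.toLp 2 torusMeasure ℂ F)
      = fourierCoeff F k := by
    rw [← fourierCoeff_toLp, ← fourierBasis_repr, HilbertBasis.repr_apply_apply, innerSL_apply_apply,
      coe_fourierBasis]
  rw [h2] at h1
  refine h1.congr_fun fun i => ?_
  have h3 := (orthonormal_iff_ite.1 (orthonormal_fourier (T := 2 * Real.pi))) k (m i)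
  rw [map_smul, innerSL_apply_apply, inner_smul_right]
  change _ = b i * inner ℂ (fourierLp 2 k) (fourierLp 2 (m i) : L2Torus)
  rw [h3, mul_ite, mul_one, mul_zero]
  simp only [eq_comm]

theorem fourierCoeff_waveLp (t : ℝ) (v : EllOne) (k : ℤ) :
    fourierCoeff (waveLp t v) k = Complex.exp (-(Complex.I * (k : ℂ) ^ 2 * t)) * v k := by
  rw [waveLp, fourierCoeff_toLp]
  refine (hasSum_fourierCoeff (hasSum_wave t v) k).unique ?_
  exact (hasSum_ite_eq k (Complex.exp (-(Complex.I * (k : ℂ) ^ 2 * t)) * v k)).congr_fun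
    fun j => by by_cases h : j = k <;> simp [h]

/-- Absolute convergence allows multiplying out w · w · conj(w) as a triple series; the exponentials
of mode k combine with the outer factor into `phase`. -/
theorem cubicCoeff_waveLp (t : ℝ) (v : EllOne) (k : ℤ) :
    Complex.exp (Complex.I * (k : ℂ) ^ 2 * t) * cubicCoeff (waveLp t v) k = tri t v v v k := by
  obtain ⟨a, ha⟩ : ∃ a : ℤ → ℂ, ∀ k, a k = Complex.exp (-(Complex.I * (k : ℂ) ^ 2 * t)) * v k :=
    ⟨_, fun _ => rfl⟩
  have hna : ∀ k, ‖a k‖ = ‖v k‖ := fun k => by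
    rw [ha, norm_mul, norm_exp_neg_I_mul, one_mul]
  have hsa : HasSum (fun k => ‖a k‖) ‖v‖ := by simpa only [hna] using v.hasSum_norm
  set b : ℤ × ℤ × ℤ → ℂ := fun p => a p.1 * (a p.2.1 * starRingEnd ℂ (a p.2.2)) with hb
  have hnb : Summable fun p => ‖b p‖ := by
    refine (hasSum_mul_mul hsa hsa hsa (fun _ => norm_nonneg _) (fun _ => norm_nonneg _)
      (fun _ => norm_nonneg _)).summable.congr fun p => ?_
    simp only [hb]; rw [norm_mul, norm_mul, RCLike.norm_conj]
  have hsum : Summable fun p : ℤ × ℤ × ℤ =>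
      b p • (fourier (p.1 + p.2.1 - p.2.2) : C(Torus, ℂ)) := by
    refine Summable.of_norm (hnb.congr fun p => ?_)
    rw [norm_smul, fourier_norm, mul_one]
  set F : C(Torus, ℂ) := ∑' p : ℤ × ℤ × ℤ, b p • fourier (p.1 + p.2.1 - p.2.2) with hF
  have hFx : ∀ x, F x = (‖wave t v x‖ : ℂ) ^ 2 * wave t v x := by
    intro x
    have h1 : HasSum (fun p : ℤ × ℤ × ℤ => b p * fourier (p.1 + p.2.1 - p.2.2) x) (F x) := by
      simpa using hsum.hasSum.mapL (ContinuousMap.evalCLM ℂ x)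
    have h2 : HasSum (fun k : ℤ => a k * fourier k x) (wave t v x) := by
      simpa [ha] using (hasSum_wave t v).mapL (ContinuousMap.evalCLM ℂ x)
    have h3 : HasSum (fun k : ℤ => starRingEnd ℂ (a k * fourier k x)) (starRingEnd ℂ (wave t v x)) :=
      h2.mapL (Complex.conjCLE : ℂ →L[ℝ] ℂ)
    have hn : Summable fun k : ℤ => ‖a k * fourier k x‖ := by
      refine hsa.summable.congr fun k => ?_
      rw [norm_mul, fourier_apply, Circle.norm_coe, mul_one]
    have hn' : Summable fun k : ℤ => ‖starRingEnd ℂ (a k * fourier k x)‖ := by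
      simpa only [RCLike.norm_conj] using hn
    have hn2 := summable_mul_of_summable_norm hn hn'
    have h4 := h2.mul h3 hn2
    have hn3 := summable_mul_of_summable_norm hn (hn.mul_norm hn')
    have h5 := h2.mul h4 hn3
    have h6 : (‖wave t v x‖ : ℂ) ^ 2 * wave t v x
        = wave t v x * (wave t v x * starRingEnd ℂ (wave t v x)) := by
      rw [Complex.mul_conj', mul_comm]
    rw [h6]
    refine h1.unique (h5.congr_fun fun p => ?_)
    simp only [hb, map_mul, ← fourier_neg, sub_eq_add_neg, fourier_add]
    ring
  have hcc : cubicCoeff (waveLp t v) k = fourierCoeff F k := by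
    refine congrFun (fourierCoeff_congr_ae ?_) k
    filter_upwards [ContinuousMap.coeFn_toLp (p := 2) (𝕜 := ℂ) torusMeasure (wave t v)] with x hx
    rw [waveLp, hx, hFx]
  rw [hcc]
  have h1 := (hasSum_fourierCoeff hsum.hasSum k).mul_left (Complex.exp (Complex.I * (k : ℂ) ^ 2 * t))
  have h2 := (summable_triTerm t v v v).hasSum.mapL (lp.evalCLM ℂ (fun _ : ℤ => ℂ) 1 k)
  refine h1.unique (h2.congr_fun ?_)
  rintro ⟨p1, p2, p3⟩
  change _ = (Pi.single (p1 + p2 - p3) (phase t (p1, p2, p3) * (v p1 * v p2 * starRingEnd ℂ (v p3)))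
    : ℤ → ℂ) k
  rw [Pi.single_apply]
  by_cases hk : p1 + p2 - p3 = k
  · rw [if_pos hk, if_pos hk.symm]
    simp only [hb, ha, map_mul, conj_exp_neg_I_mul, phase]
    have : Complex.exp (Complex.I * ((2 * (p1 - p3) * (p2 - p3) : ℤ) : ℂ) * t)
        = Complex.exp (Complex.I * (k : ℂ) ^ 2 * t) * (Complex.exp (-(Complex.I * (p1 : ℂ) ^ 2 * t)) *
          (Complex.exp (-(Complex.I * (p2 : ℂ) ^ 2 * t)) * Complex.exp (Complex.I * (p3 : ℂ) ^ 2 * t))) := by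
      rw [← Complex.exp_add, ← Complex.exp_add, ← Complex.exp_add, ← hk]
      congr 1
      push_cast
      ring
    rw [this]
    ring
  · rw [if_neg hk, if_neg (Ne.symm hk), mul_zero]

theorem eLpNorm_waveLp_le (t : ℝ) (v : EllOne) :
    eLpNorm (waveLp t v) 4 torusMeasure ≤ ENNReal.ofReal ‖v‖ := by
  rw [waveLp, eLpNorm_congr_ae (ContinuousMap.coeFn_toLp (p := 2) (𝕜 := ℂ) torusMeasure (wave t v))]
  refine (eLpNorm_le_of_ae_bound (C := ‖v‖) (ae_of_all _ fun x => ?_)).trans (le_of_eq ?_)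
  · exact ((wave t v).norm_coe_le_norm x).trans (norm_wave_le t v)
  · simp

theorem isMild_waveLp {κ a b R : ℝ} {v : ℝ → EllOne} (hv : Continuous v) (hvR : ∀ t, ‖v t‖ ≤ R)
    (hc : ContinuousOn (fun t => nlsField κ t (v t)) (Set.Icc a b))
    (h : ∀ t ∈ Set.Icc a b, v t = v a + ∫ r in a..t, nlsField κ r (v r)) :
    IsMild κ a b fun t => waveLp t (v t) where
  continuousOn :=
    ((ContinuousMap.toLp 2 torusMeasure ℂ).continuous.comp (continuous_wave hv)).continuousOn
  lintegral_ne_top := by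
    refine ne_top_of_le_ne_top ?_ (lintegral_mono fun r => pow_le_pow_left'
      ((eLpNorm_waveLp_le r (v r)).trans (ENNReal.ofReal_le_ofReal (hvR r))) 4)
    rw [lintegral_const]
    exact ENNReal.mul_ne_top (ENNReal.pow_ne_top ENNReal.ofReal_ne_top) (by simp)
  duhamel t ht k := by
    have e1 : ∀ s : ℝ, Complex.exp (Complex.I * (k : ℂ) ^ 2 * s) * fourierCoeff (waveLp s (v s)) k
        = v s k := fun s => by
      rw [fourierCoeff_waveLp, ← mul_assoc, ← Complex.exp_add]
      simp
    simp_rw [cubicCoeff_waveLp]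
    rw [e1, e1, h t ht, lp.coeFn_add, Pi.add_apply, sub_eq_add_neg]
    congr 1
    have hi : IntervalIntegrable (fun r => nlsField κ r (v r)) volume a t := by
      refine ContinuousOn.intervalIntegrable ?_
      rw [Set.uIcc_of_le ht.1]
      exact hc.mono (Set.Icc_subset_Icc_right ht.2)
    have e2 := (lp.evalCLM ℂ (fun _ : ℤ => ℂ) 1 k).intervalIntegral_comp_comm hi
    change _ = (∫ r in a..t, nlsField κ r (v r)) k at e2
    rw [← e2, ← neg_mul, ← intervalIntegral.integral_const_mul]
    refine intervalIntegral.integral_congr fun r _ => ?_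
    change (nlsField κ r (v r)) k = _
    rw [nlsField, lp.coeFn_smul, Pi.smul_apply, smul_eq_mul]

theorem fourierLebesgueNorm_waveLp (t : ℝ) (v : EllOne) :
    fourierLebesgueNorm (waveLp t v) = ENNReal.ofReal ‖v‖ := by
  rw [fourierLebesgueNorm, ← v.hasSum_norm.tsum_eq,
    ENNReal.ofReal_tsum_of_nonneg (fun _ => norm_nonneg _) v.hasSum_norm.summable]
  refine tsum_congr fun k => ?_
  rw [fourierCoeff_waveLp, ← ofReal_norm, norm_mul, norm_exp_neg_I_mul, one_mul]

theorem L2Torus_ext {f g : L2Torus} (h : ∀ k, fourierCoeff f k = fourierCoeff g k) : f = g := by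
  refine (fourierBasis (T := 2 * Real.pi)).repr.injective ?_
  ext k
  rw [fourierBasis_repr, fourierBasis_repr, h]

theorem exists_waveLp_eq {f : L2Torus} (hf : fourierLebesgueNorm f ≠ ∞) (t : ℝ) :
    ∃ v : EllOne, waveLp t v = f := by
  have hs : Summable fun k => ‖fourierCoeff f k‖ := by
    rw [fourierLebesgueNorm] at hf
    simpa using ENNReal.summable_toReal hf
  have hmem : Memℓp (fun k : ℤ => Complex.exp (Complex.I * (k : ℂ) ^ 2 * t) * fourierCoeff f k) 1 := by
    refine memℓp_gen ?_
    simpa [norm_exp_I_mul] using hs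
  refine ⟨⟨_, hmem⟩, L2Torus_ext fun k => ?_⟩
  rw [fourierCoeff_waveLp]
  change _ * (_ * _) = _
  rw [← mul_assoc, ← Complex.exp_add]
  simp

/-! ### Growth of the Fourier-Lebesgue norm over long times. -/

/-- A solution whose Fourier-Lebesgue norm is small enough is given over one period by the flow in
`ℓ¹`. -/
theorem IsMild.exists_flow {κ a b R : ℝ} (hκ : 0 ≤ κ) (hb : b ≤ a + 2 * Real.pi)
    {u : ℝ → L2Torus} (hu : IsMild κ a b u) (hR : 0 ≤ R)
    (hsmall : 16 * Real.pi * κ * R ^ 2 ≤ 1) (hua : fourierLebesgueNorm (u a) ≤ ENNReal.ofReal R) :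
    ∃ n : ℝ → ℝ,
      (∀ t ∈ Set.Icc a b, fourierLebesgueNorm (u t) = ENNReal.ofReal (n t)) ∧
      (∀ t ∈ Set.Icc a b, n t ≤ n a + κ * (2 * R) ^ 3 * (2 * Real.pi)) ∧
      n (a + 2 * Real.pi) ≤ n a + 400 * Real.pi ^ 2 * κ ^ 2 * R ^ 5 := by
  obtain ⟨v₀, hv₀⟩ := exists_waveLp_eq (ne_top_of_le_ne_top ENNReal.ofReal_ne_top hua) a
  have hv₀R : ‖v₀‖ ≤ R := by
    rwa [← hv₀, fourierLebesgueNorm_waveLp, ENNReal.ofReal_le_ofReal_iff hR] at hua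
  obtain ⟨v, hvc, hva, hvR, hfc, hv⟩ := CubicNLS.exists_flow hκ hsmall v₀ hv₀R a
  rw [← hva] at hv hv₀ hv₀R
  have hsub : Set.Icc a b ⊆ Set.Icc a (a + 2 * Real.pi) := Set.Icc_subset_Icc_right hb
  have hU := isMild_waveLp hvc hvR (hfc.mono hsub) fun t ht => hv t (hsub ht)
  have heq := hu.eqOn hU hv₀.symm
  -- The ℓ¹ flow exists on the whole period even when u is given only up to b, so the last bound
  -- holds although n(a + 2π) need not then describe u.
  refine ⟨fun t => ‖v t‖, fun t ht => ?_, fun t ht => ?_,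
    norm_flow_period_le hκ hv₀R hvR hfc hv⟩
  · rw [heq ht, fourierLebesgueNorm_waveLp]
  · have h1 := norm_flow_sub_le hκ hvR (hv t (hsub ht))
    have h2 : |t - a| ≤ 2 * Real.pi := by
      rw [abs_of_nonneg (by linarith [ht.1])]; linarith [(hsub ht).2]
    have h3 : ‖v t‖ ≤ ‖v a‖ + ‖v t - v a‖ := by
      have := norm_add_le (v a) (v t - v a)
      rwa [add_sub_cancel] at this
    refine h3.trans (add_le_add_right (h1.trans ?_) _)
    gcongr

theorem IsSolution.isMild {ε T : ℝ} {u : ℝ → L2Torus} (h : IsSolution ε T u) :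
    IsMild (ε ^ 2) 0 T u where
  continuousOn := h.continuousOn
  lintegral_ne_top := by
    simp_rw [eLpNorm_four_pow_four]
    exact h.lintegral_pow_four_lt_top.ne
  duhamel t ht k := by
    have e1 : Complex.exp (Complex.I * (k : ℂ) ^ 2 * t) *
        Complex.exp (-(Complex.I * (k : ℂ) ^ 2 * t)) = 1 := by rw [← Complex.exp_add]; simp
    have e2 : ∀ s : ℝ, Complex.exp (-(Complex.I * (k : ℂ) ^ 2 * ((t - s : ℝ) : ℂ)))
        = Complex.exp (-(Complex.I * (k : ℂ) ^ 2 * t)) * Complex.exp (Complex.I * (k : ℂ) ^ 2 * s) :=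
      fun s => by rw [← Complex.exp_add]; congr 1; push_cast; ring
    rw [h.duhamel t ht k]
    simp_rw [e2, mul_assoc (Complex.exp (-(Complex.I * (k : ℂ) ^ 2 * t))), ← cubicCoeff.eq_1]
    rw [intervalIntegral.integral_const_mul, mul_sub, ← mul_assoc, e1]
    have e3 : ∀ J : ℂ, Complex.exp (Complex.I * (k : ℂ) ^ 2 * t) * (Complex.I * (ε : ℂ) ^ 2 *
        (Complex.exp (-(Complex.I * (k : ℂ) ^ 2 * t)) * J)) = Complex.I * (ε : ℂ) ^ 2 * J := fun J => by
      linear_combination (Complex.I * (ε : ℂ) ^ 2 * J) * e1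
    rw [e3]
    simp

/-- Growth of the Fourier-Lebesgue norm over a long time interval. -/
theorem IsMild.fourierLebesgueNorm_le {κ T R m : ℝ} (hκ : 0 ≤ κ) (hT : 0 ≤ T) (hm : 0 ≤ m)
    {u : ℝ → L2Torus} (hu : IsMild κ 0 T u) (hR : 0 ≤ R) (hsmall : 16 * Real.pi * κ * R ^ 2 ≤ 1)
    (hmR : m + 200 * Real.pi * κ ^ 2 * R ^ 5 * T ≤ R)
    (hu0 : fourierLebesgueNorm (u 0) ≤ ENNReal.ofReal m) :
    fourierLebesgueNorm (u T) ≤ ENNReal.ofReal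
      (m + 200 * Real.pi * κ ^ 2 * R ^ 5 * T + κ * (2 * R) ^ 3 * (2 * Real.pi)) := by
  have hπ := Real.pi_pos
  -- A is a growth rate per unit time: 2πA is the gain 400π²κ²R⁵ of one full period.
  set A : ℝ := 200 * Real.pi * κ ^ 2 * R ^ 5 with hA
  have hA0 : 0 ≤ A := by positivity
  have key : ∀ j : ℕ, 2 * Real.pi * j ≤ T →
      fourierLebesgueNorm (u (2 * Real.pi * j)) ≤ ENNReal.ofReal (m + A * (2 * Real.pi * j)) := by
    intro j
    induction j with
    | zero => intro _; simpa using hu0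
    | succ j ih =>
      intro hj
      push_cast at hj
      have hjT : 2 * Real.pi * j ≤ T := by linarith
      have hj0 : (0 : ℝ) ≤ 2 * Real.pi * j := by positivity
      have h1 := ih hjT
      have h2 : m + A * (2 * Real.pi * j) ≤ R :=
        le_trans (add_le_add_right (mul_le_mul_of_nonneg_left hjT hA0) _) hmR
      obtain ⟨n, hn, -, hper⟩ := IsMild.exists_flow hκ le_rfl (hu.mono hj0 (by linarith)) hR hsmall
        (h1.trans (ENNReal.ofReal_le_ofReal h2))
      rw [hn _ ⟨le_rfl, by linarith⟩, ENNReal.ofReal_le_ofReal_iff (by positivity)] at h1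
      have e : 2 * Real.pi * ((j + 1 : ℕ) : ℝ) = 2 * Real.pi * j + 2 * Real.pi := by push_cast; ring
      rw [e, hn _ ⟨by linarith, le_rfl⟩]
      refine ENNReal.ofReal_le_ofReal (hper.trans ?_)
      calc _ ≤ m + A * (2 * Real.pi * j) + 400 * Real.pi ^ 2 * κ ^ 2 * R ^ 5 := by gcongr
        _ = _ := by rw [hA]; ring
  set N : ℕ := ⌊T / (2 * Real.pi)⌋₊ with hN
  have hNT : 2 * Real.pi * N ≤ T := by
    have := Nat.floor_le (show 0 ≤ T / (2 * Real.pi) by positivity)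
    rw [le_div_iff₀ (by positivity)] at this
    linarith
  have hTN : T ≤ 2 * Real.pi * N + 2 * Real.pi := by
    have := Nat.lt_floor_add_one (T / (2 * Real.pi))
    rw [div_lt_iff₀ (by positivity)] at this
    linarith
  have h1 := key N hNT
  have h2 : m + A * (2 * Real.pi * N) ≤ m + A * T := by gcongr
  -- On the incomplete last period there is no averaging, so the first-order bound is used; it is
  -- paid only once.
  obtain ⟨n, hn, hle, -⟩ := IsMild.exists_flow hκ hTN (hu.mono (by positivity) le_rfl) hR hsmall
    (h1.trans (ENNReal.ofReal_le_ofReal (h2.trans hmR)))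
  rw [hn _ ⟨le_rfl, hNT⟩, ENNReal.ofReal_le_ofReal_iff (by positivity)] at h1
  rw [hn T ⟨hNT, le_rfl⟩]
  refine ENNReal.ofReal_le_ofReal ((hle T ⟨hNT, le_rfl⟩).trans ?_)
  linarith

/-! ### Time reversal. -/

theorem fourierCoeff_star (f : Torus → ℂ) (k : ℤ) :
    fourierCoeff (fun x => starRingEnd ℂ (f x)) k = starRingEnd ℂ (fourierCoeff f (-k)) := by
  rw [fourierCoeff, fourierCoeff, ← integral_conj]
  congr 1
  ext x
  rw [smul_eq_mul, smul_eq_mul, map_mul, neg_neg, fourier_neg]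

theorem fourierCoeff_star_L2 (f : L2Torus) (k : ℤ) :
    fourierCoeff (star f : L2Torus) k = starRingEnd ℂ (fourierCoeff f (-k)) := by
  rw [← fourierCoeff_star]
  refine congrFun (fourierCoeff_congr_ae ?_) k
  filter_upwards [Lp.coeFn_star f] with x hx
  rw [hx]; rfl

theorem cubicCoeff_star_L2 (f : L2Torus) (k : ℤ) :
    cubicCoeff (star f : L2Torus) k = starRingEnd ℂ (cubicCoeff f (-k)) := by
  rw [cubicCoeff, cubicCoeff, ← fourierCoeff_star]
  refine congrFun (fourierCoeff_congr_ae ?_) k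
  filter_upwards [Lp.coeFn_star f] with x hx
  rw [hx, Pi.star_apply, norm_star, map_mul, map_pow, Complex.conj_ofReal]
  rfl

theorem fourierLebesgueNorm_star (f : L2Torus) :
    fourierLebesgueNorm (star f : L2Torus) = fourierLebesgueNorm f := by
  rw [fourierLebesgueNorm, fourierLebesgueNorm, ← (Equiv.neg ℤ).tsum_eq]
  refine tsum_congr fun k => ?_
  rw [fourierCoeff_star_L2, RCLike.enorm_conj, Equiv.neg_apply, neg_neg]

theorem isometry_star_L2 : Isometry (star : L2Torus → L2Torus) := by
  refine Isometry.of_dist_eq fun f g => ?_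
  rw [Lp.dist_def, Lp.dist_def]
  congr 1
  refine eLpNorm_congr_norm_ae ?_
  filter_upwards [Lp.coeFn_star f, Lp.coeFn_star g] with x hf hg
  rw [Pi.sub_apply, Pi.sub_apply, hf, hg, Pi.star_apply, Pi.star_apply, ← star_sub, norm_star]

/-- Time reversal. -/
theorem IsMild.reverse {κ T : ℝ} {u : ℝ → L2Torus} (hu : IsMild κ 0 T u) :
    IsMild κ 0 T fun s => star (u (T - s)) where
  continuousOn := by
    refine isometry_star_L2.continuous.comp_continuousOn (hu.continuousOn.comp (by fun_prop) fun s hs => ?_)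
    exact ⟨by linarith [hs.2], by linarith [hs.1]⟩
  lintegral_ne_top := by
    have e : ∀ r, eLpNorm (star (u (T - r)) : L2Torus) 4 torusMeasure
        = eLpNorm (u (T - r)) 4 torusMeasure := fun r => by
      refine eLpNorm_congr_norm_ae ?_
      filter_upwards [Lp.coeFn_star (u (T - r))] with x hx
      rw [hx, Pi.star_apply, norm_star]
    simp_rw [e]
    have h := (Measure.measurePreserving_sub_left (volume : Measure ℝ) T).setLIntegral_comp_emb
      (MeasurableEquiv.subLeft T).measurableEmbedding
      (fun r => eLpNorm (u r) 4 torusMeasure ^ 4) (Set.Icc 0 T)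
    rw [h]
    have himg : (fun x => T - x) '' Set.Icc 0 T = Set.Icc 0 T := by simp
    rw [himg]
    exact hu.lintegral_ne_top
  duhamel s hs k := by
    have hs' : T - s ∈ Set.Icc 0 T := ⟨by linarith [hs.2], by linarith [hs.1]⟩
    -- Duhamel's formula is rebased at T - s and evaluated at T; its conjugate, after the
    -- substitution r ↦ T - r, is the formula for the reversed solution.
    have h1 := (hu.mono hs'.1 le_rfl).duhamel T ⟨hs'.2, le_rfl⟩ (-k)
    have h2 := congrArg (starRingEnd ℂ) h1
    simp only [fourierCoeff_star_L2, cubicCoeff_star_L2]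
    have e0 : ∀ r : ℝ, starRingEnd ℂ (Complex.exp (Complex.I * ((-k : ℤ) : ℂ) ^ 2 * r))
        = Complex.exp (-(Complex.I * (k : ℂ) ^ 2 * r)) := fun r => by
      rw [← Complex.exp_conj]; congr 1; simp
    rw [map_sub, map_mul, map_mul, map_mul, map_mul, e0, e0, Complex.conj_I, Complex.conj_ofReal,
      ← intervalIntegral.intervalIntegral_conj] at h2
    simp only [map_mul, e0] at h2
    have e1 : ∀ r : ℝ, Complex.exp (Complex.I * (k : ℂ) ^ 2 * T) *
        Complex.exp (-(Complex.I * (k : ℂ) ^ 2 * r))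
          = Complex.exp (Complex.I * (k : ℂ) ^ 2 * ((T - r : ℝ) : ℂ)) := fun r => by
      rw [← Complex.exp_add]; congr 1; push_cast; ring
    have e2 := intervalIntegral.integral_comp_sub_left (a := 0) (b := s)
      (fun r : ℝ => Complex.exp (Complex.I * (k : ℂ) ^ 2 * ((T - r : ℝ) : ℂ)) *
        starRingEnd ℂ (cubicCoeff (u r) (-k))) T
    simp only [sub_sub_cancel, sub_zero] at e2
    rw [e2]
    have e3 : ∀ r : ℝ, Complex.exp (Complex.I * (k : ℂ) ^ 2 * ((T - r : ℝ) : ℂ)) *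
        starRingEnd ℂ (cubicCoeff (u r) (-k)) = Complex.exp (Complex.I * (k : ℂ) ^ 2 * T) *
        (Complex.exp (-(Complex.I * (k : ℂ) ^ 2 * r)) * starRingEnd ℂ (cubicCoeff (u r) (-k))) :=
      fun r => by rw [← e1, mul_assoc]
    simp_rw [e3]
    rw [intervalIntegral.integral_const_mul]
    have e4 := e1 T
    have e5 := e1 (T - s)
    rw [sub_self] at e4
    rw [sub_sub_cancel] at e5
    rw [sub_zero, ← e4, ← e5]
    linear_combination (-Complex.exp (Complex.I * (k : ℂ) ^ 2 * T)) * h2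

/-! ### Scaling in ε. -/

theorem tendsto_mul_abs_log : Tendsto (fun ε : ℝ => ε * |Real.log ε|) (𝓝[>] 0) (𝓝 0) := by
  have h := ((Real.continuous_mul_log.tendsto 0).mono_left
    (nhdsWithin_le_nhds (s := Set.Ioi 0))).abs
  rw [zero_mul, abs_zero] at h
  refine h.congr' ?_
  filter_upwards [self_mem_nhdsWithin] with ε hε
  rw [abs_mul, abs_of_pos (show (0 : ℝ) < ε from hε)]

theorem rpow_neg_half_sq_mul {ε : ℝ} (hε : 0 < ε) : (ε ^ (-(1 / 2) : ℝ)) ^ 2 * ε = 1 := by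
  rw [← Real.rpow_natCast, ← Real.rpow_mul hε.le]
  norm_num
  rw [Real.rpow_neg_one, inv_mul_cancel₀ hε.ne']

/-- On the time scale `ε⁻¹ |log ε|`, the Fourier-Lebesgue norm of a solution of size `ε^{-1/2}` is
nearly conserved. -/
theorem eventually_fourierLebesgueNorm_le {z z' : ℝ} (hz : 0 ≤ z) (hzz : z < z') (C : ℝ) :
    ∀ᶠ ε in 𝓝[>] (0 : ℝ), ∀ (T : ℝ) (u : ℝ → L2Torus), 0 ≤ T → T ≤ C * (ε⁻¹ * |Real.log ε|) →
      IsMild (ε ^ 2) 0 T u → fourierLebesgueNorm (u 0) ≤ ENNReal.ofReal (z * ε ^ (-(1 / 2) : ℝ)) →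
      fourierLebesgueNorm (u T) ≤ ENNReal.ofReal (z' * ε ^ (-(1 / 2) : ℝ)) := by
  have hid : Tendsto (fun ε : ℝ => ε) (𝓝[>] 0) (𝓝 0) := nhdsWithin_le_nhds
  have h1 : Tendsto (fun ε : ℝ => 16 * Real.pi * z' ^ 2 * ε) (𝓝[>] 0) (𝓝 0) := by
    simpa using hid.const_mul (16 * Real.pi * z' ^ 2)
  have h2 : Tendsto (fun ε : ℝ => 200 * Real.pi * z' ^ 5 * C * (ε * |Real.log ε|)
      + 16 * Real.pi * z' ^ 3 * ε) (𝓝[>] 0) (𝓝 0) := by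
    simpa using (tendsto_mul_abs_log.const_mul (200 * Real.pi * z' ^ 5 * C)).add
      (hid.const_mul (16 * Real.pi * z' ^ 3))
  have hz' : 0 < z' := hz.trans_lt hzz
  filter_upwards [h1.eventually (gt_mem_nhds one_pos), h2.eventually (gt_mem_nhds (sub_pos.2 hzz)),
    self_mem_nhdsWithin] with ε hε1 hε2 hε T u hT hTC hu hu0
  have hε0 : (0 : ℝ) < ε := hε
  have hρ := rpow_neg_half_sq_mul hε0
  have hρ0 : 0 < ε ^ (-(1 / 2) : ℝ) := by positivity
  set ρ := ε ^ (-(1 / 2) : ℝ) with hρdef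
  have hεT : ε * T ≤ C * |Real.log ε| := by
    calc ε * T ≤ ε * (C * (ε⁻¹ * |Real.log ε|)) := by gcongr
      _ = _ := by field_simp
  -- With ρ²ε = 1, the factor κ²R⁵ is of order ερ, and another ε is absorbed by T. Relative to ρ the
  -- growth is of order ε |log ε|.
  have hg : 200 * Real.pi * (ε ^ 2) ^ 2 * (z' * ρ) ^ 5 * T
      ≤ 200 * Real.pi * z' ^ 5 * C * (ε * |Real.log ε|) * ρ := by
    have e : 200 * Real.pi * (ε ^ 2) ^ 2 * (z' * ρ) ^ 5 * T
        = 200 * Real.pi * z' ^ 5 * ρ * ε * (ρ ^ 2 * ε) ^ 2 * (ε * T) := by ring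
    rw [e, hρ]
    calc _ ≤ 200 * Real.pi * z' ^ 5 * ρ * ε * 1 ^ 2 * (C * |Real.log ε|) := by gcongr
      _ = _ := by ring
  have hl : ε ^ 2 * (2 * (z' * ρ)) ^ 3 * (2 * Real.pi) = 16 * Real.pi * z' ^ 3 * ε * ρ := by
    linear_combination (16 * Real.pi * z' ^ 3 * ε * ρ) * hρ
  have htot : z * ρ + 200 * Real.pi * (ε ^ 2) ^ 2 * (z' * ρ) ^ 5 * T
      + ε ^ 2 * (2 * (z' * ρ)) ^ 3 * (2 * Real.pi) ≤ z' * ρ := by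
    rw [hl]
    have := mul_le_mul_of_nonneg_right hε2.le hρ0.le
    linarith
  have hl0 : 0 ≤ ε ^ 2 * (2 * (z' * ρ)) ^ 3 * (2 * Real.pi) := by positivity
  refine (IsMild.fourierLebesgueNorm_le (sq_nonneg ε) hT (by positivity) hu
    (R := z' * ρ) (by positivity) ?_ (by linarith) hu0).trans (ENNReal.ofReal_le_ofReal htot)
  calc 16 * Real.pi * ε ^ 2 * (z' * ρ) ^ 2 = 16 * Real.pi * z' ^ 2 * ε * (ρ ^ 2 * ε) := by ring
    _ ≤ 1 := by rw [hρ, mul_one]; exact hε1.le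

/-- The reversed solution starts from conj u(T) and ends at conj u(0), and conjugation preserves the
norm. The hypothesis concerns only time T, so even finiteness at time 0 is a conclusion. -/
theorem eventually_fourierLebesgueNorm_zero_le {z z' : ℝ} (hz : 0 ≤ z) (hzz : z < z') (C : ℝ) :
    ∀ᶠ ε in 𝓝[>] (0 : ℝ), ∀ (T : ℝ) (u : ℝ → L2Torus), 0 ≤ T → T ≤ C * (ε⁻¹ * |Real.log ε|) →
      IsMild (ε ^ 2) 0 T u → fourierLebesgueNorm (u T) ≤ ENNReal.ofReal (z * ε ^ (-(1 / 2) : ℝ)) →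
      fourierLebesgueNorm (u 0) ≤ ENNReal.ofReal (z' * ε ^ (-(1 / 2) : ℝ)) := by
  filter_upwards [eventually_fourierLebesgueNorm_le hz hzz C] with ε hε T u hT hTC hu huT
  have := hε T _ hT hTC hu.reverse
  simp only [fourierLebesgueNorm_star, sub_zero, sub_self] at this
  exact this huT

theorem HasFourierData.fourierLebesgueNorm_eq {Ω : Type*} {c : ℤ → ℝ} {g : ℤ → Ω → ℂ} {ω : Ω}
    {f : L2Torus} (h : HasFourierData c (fun k => g k ω) f) :
    fourierLebesgueNorm f = randomNorm c g ω :=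
  tsum_congr fun k => by rw [h k]

theorem exists_eventually_le_of_isBigO {t : ℝ → ℝ}
    (htO : t =O[𝓝[>] (0 : ℝ)] fun ε => ε⁻¹ * |Real.log ε|) :
    ∃ C, ∀ᶠ ε in 𝓝[>] (0 : ℝ), t ε ≤ C * (ε⁻¹ * |Real.log ε|) := by
  obtain ⟨C, hC⟩ := htO.bound
  refine ⟨C, ?_⟩
  filter_upwards [hC, self_mem_nhdsWithin] with ε h hε
  have hε0 : (0 : ℝ) < ε := hε
  rw [Real.norm_of_nonneg (show 0 ≤ ε⁻¹ * |Real.log ε| by positivity)] at h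
  exact (le_abs_self _).trans h

/-! ### Large deviations of the solution. -/

section Comparison

variable {Ω : Type*} [MeasurableSpace Ω] {P : Measure Ω} {g : ℤ → Ω → ℂ} {c : ℤ → ℝ} {t : ℝ → ℝ}
  {u : ℝ → Ω → ℝ → L2Torus}

/-- If the data are slightly larger than the threshold, the solution exceeds the threshold. -/
theorem eventually_ae_lt_fourierLebesgueNorm (ht : ∀ ε > 0, 0 ≤ t ε)
    (htO : t =O[𝓝[>] (0 : ℝ)] fun ε => ε⁻¹ * |Real.log ε|)
    (hu : ∀ ε > 0, ∀ᵐ ω ∂P, IsSolution ε (t ε) (u ε ω) ∧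
      HasFourierData c (fun k => g k ω) (u ε ω 0)) {z z' : ℝ} (hz : 0 ≤ z) (hzz : z < z') :
    ∀ᶠ ε in 𝓝[>] (0 : ℝ), ∀ᵐ ω ∂P, ENNReal.ofReal (z' * ε ^ (-(1 / 2) : ℝ)) < randomNorm c g ω →
      ENNReal.ofReal (z * ε ^ (-(1 / 2) : ℝ)) < fourierLebesgueNorm (u ε ω (t ε)) := by
  obtain ⟨C, hC⟩ := exists_eventually_le_of_isBigO htO
  filter_upwards [hC, eventually_fourierLebesgueNorm_zero_le hz hzz C, self_mem_nhdsWithin] with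
    ε h1 h2 hε
  filter_upwards [hu ε hε] with ω hω
  contrapose!
  rw [← hω.2.fourierLebesgueNorm_eq]
  exact h2 _ _ (ht ε hε) h1 hω.1.isMild

/-- If the solution exceeds the threshold, the data are not much smaller than the threshold. -/
theorem eventually_ae_lt_randomNorm (ht : ∀ ε > 0, 0 ≤ t ε)
    (htO : t =O[𝓝[>] (0 : ℝ)] fun ε => ε⁻¹ * |Real.log ε|)
    (hu : ∀ ε > 0, ∀ᵐ ω ∂P, IsSolution ε (t ε) (u ε ω) ∧
      HasFourierData c (fun k => g k ω) (u ε ω 0)) {z z' : ℝ} (hz : 0 ≤ z) (hzz : z < z') :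
    ∀ᶠ ε in 𝓝[>] (0 : ℝ), ∀ᵐ ω ∂P,
      ENNReal.ofReal (z' * ε ^ (-(1 / 2) : ℝ)) < fourierLebesgueNorm (u ε ω (t ε)) →
      ENNReal.ofReal (z * ε ^ (-(1 / 2) : ℝ)) < randomNorm c g ω := by
  obtain ⟨C, hC⟩ := exists_eventually_le_of_isBigO htO
  filter_upwards [hC, eventually_fourierLebesgueNorm_le hz hzz C, self_mem_nhdsWithin] with
    ε h1 h2 hε
  filter_upwards [hu ε hε] with ω hω
  contrapose!
  rw [← hω.2.fourierLebesgueNorm_eq]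
  exact h2 _ _ (ht ε hε) h1 hω.1.isMild

variable [IsProbabilityMeasure P]

/-- Lower bound in the large deviation principle; it includes the positivity of the probability. -/
theorem eventually_le_mul_log_prob (hg : ∀ k, HasLaw (g k) stdComplexGaussian P)
    (hg_indep : iIndepFun g P) (hc : ∀ k, 0 ≤ c k) (hc_sq : Summable fun k => c k ^ 2)
    (hpos : 0 < ∑' k, c k ^ 2) (ht : ∀ ε > 0, 0 ≤ t ε)
    (htO : t =O[𝓝[>] (0 : ℝ)] fun ε => ε⁻¹ * |Real.log ε|)
    (hu : ∀ ε > 0, ∀ᵐ ω ∂P, IsSolution ε (t ε) (u ε ω) ∧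
      HasFourierData c (fun k => g k ω) (u ε ω 0)) {z z' : ℝ} (hz : 0 ≤ z) (hzz : z < z') :
    ∀ᶠ ε in 𝓝[>] (0 : ℝ),
      0 < P.real {ω | ENNReal.ofReal (z * ε ^ (-(1 / 2) : ℝ)) < fourierLebesgueNorm (u ε ω (t ε))} ∧
      -(z' ^ 2 / ∑' k, c k ^ 2) ≤ ε * Real.log (P.real {ω |
        ENNReal.ofReal (z * ε ^ (-(1 / 2) : ℝ)) < fourierLebesgueNorm (u ε ω (t ε))}) := by
  filter_upwards [eventually_ae_lt_fourierLebesgueNorm ht htO hu hz hzz, self_mem_nhdsWithin] with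
    ε hae hε
  have hε0 : (0 : ℝ) < ε := hε
  have hρ := rpow_neg_half_sq_mul hε0
  set ρ := ε ^ (-(1 / 2) : ℝ) with hρdef
  have hρ0 : 0 < ρ := by positivity
  have hz'0 : 0 < z' := hz.trans_lt hzz
  have h1 : ENNReal.ofReal (Real.exp (-((z' * ρ) ^ 2 / ∑' k, c k ^ 2)))
      ≤ P {ω | ENNReal.ofReal (z * ρ) < fourierLebesgueNorm (u ε ω (t ε))} :=
    (exp_neg_le_prob_randomNorm hg hg_indep hc hc_sq hpos (by positivity)).trans
      (measure_mono_ae hae)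
  rw [ENNReal.ofReal_le_iff_le_toReal (measure_ne_top _ _), ← measureReal_def] at h1
  have hp := (Real.exp_pos _).trans_le h1
  refine ⟨hp, ?_⟩
  rw [← Real.le_log_iff_exp_le hp] at h1
  refine le_trans (le_of_eq ?_) (mul_le_mul_of_nonneg_left h1 hε0.le)
  field_simp
  linear_combination hρ

/-- Upper bound in the large deviation principle. -/
theorem eventually_mul_log_prob_lt (hg : ∀ k, HasLaw (g k) stdComplexGaussian P)
    (hg_indep : iIndepFun g P) (hc : ∀ k, 0 ≤ c k) (hc_sq : Summable fun k => c k ^ 2)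
    (hc1 : Summable c) (hpos : 0 < ∑' k, c k ^ 2) (ht : ∀ ε > 0, 0 ≤ t ε)
    (htO : t =O[𝓝[>] (0 : ℝ)] fun ε => ε⁻¹ * |Real.log ε|)
    (hu : ∀ ε > 0, ∀ᵐ ω ∂P, IsSolution ε (t ε) (u ε ω) ∧
      HasFourierData c (fun k => g k ω) (u ε ω 0)) {z z' b : ℝ} (hz : 0 ≤ z) (hzz : z < z')
    (hb : -(z ^ 2 / ∑' k, c k ^ 2) < b) :
    ∀ᶠ ε in 𝓝[>] (0 : ℝ), ε * Real.log (P.real {ω |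
        ENNReal.ofReal (z' * ε ^ (-(1 / 2) : ℝ)) < fourierLebesgueNorm (u ε ω (t ε))}) < b := by
  set σ := ∑' k, c k ^ 2 with hσ
  have hlim : Tendsto (fun ε : ℝ => -(z ^ 2 / σ) + √Real.pi * (2 * z / σ) * (∑' k, c k) * √ε)
      (𝓝[>] 0) (𝓝 (-(z ^ 2 / σ))) := by
    have h0 : Tendsto (fun ε : ℝ => √ε) (𝓝[>] 0) (𝓝 0) := by
      have := (Real.continuous_sqrt.tendsto 0).mono_left (nhdsWithin_le_nhds (s := Set.Ioi 0))
      rwa [Real.sqrt_zero] at this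
    simpa using (h0.const_mul (√Real.pi * (2 * z / σ) * (∑' k, c k))).const_add (-(z ^ 2 / σ))
  filter_upwards [eventually_ae_lt_randomNorm ht htO hu hz hzz,
    -- Only positivity of the probability is taken from here: since `Real.log 0 = 0`, an upper bound
    -- on the probability bounds its logarithm only when it is nonzero.
    eventually_le_mul_log_prob hg hg_indep hc hc_sq hpos ht htO hu (hz.trans hzz.le) (lt_add_one z'),
    hlim.eventually (gt_mem_nhds hb), self_mem_nhdsWithin] with ε hae hp hεb hε
  have hε0 : (0 : ℝ) < ε := hε
  refine lt_of_le_of_lt ?_ hεb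
  replace hp := hp.1
  have hρ := rpow_neg_half_sq_mul hε0
  have hρs : ε * ε ^ (-(1 / 2) : ℝ) = √ε := by
    rw [Real.sqrt_eq_rpow, mul_comm, ← Real.rpow_add_one hε0.ne']
    norm_num
  set ρ := ε ^ (-(1 / 2) : ℝ) with hρdef
  have hρ0 : 0 < ρ := by positivity
  have h1 := (measure_mono_ae hae).trans (prob_randomNorm_le hg hg_indep hc hc_sq hc1
    -- The minimiser of -la + l²σ/4 is l = 2a/σ, with value -a²/σ. The remaining linear term is of
    -- order ρ, hence √ε after multiplication by ε.
    (a := z * ρ) (l := 2 * (z * ρ) / σ) (by positivity) (by positivity))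
  have h2 := ENNReal.toReal_mono ENNReal.ofReal_ne_top h1
  rw [ENNReal.toReal_ofReal (Real.exp_pos _).le] at h2
  have h3 := mul_le_mul_of_nonneg_left ((Real.log_le_iff_le_exp hp).2 h2) hε0.le
  refine h3.trans (le_of_eq ?_)
  rw [← hσ, ← hρs]
  field_simp
  linear_combination (-(4 * z ^ 2)) * hρ

theorem tendsto_mul_log_prob (hg : ∀ k, HasLaw (g k) stdComplexGaussian P)
    (hg_indep : iIndepFun g P) (hc : ∀ k, 0 ≤ c k) (hc_sq : Summable fun k => c k ^ 2)
    (hc1 : Summable c) (hpos : 0 < ∑' k, c k ^ 2) (ht : ∀ ε > 0, 0 ≤ t ε)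
    (htO : t =O[𝓝[>] (0 : ℝ)] fun ε => ε⁻¹ * |Real.log ε|)
    (hu : ∀ ε > 0, ∀ᵐ ω ∂P, IsSolution ε (t ε) (u ε ω) ∧
      HasFourierData c (fun k => g k ω) (u ε ω 0)) {z : ℝ} (hz : 0 < z) :
    Tendsto (fun ε : ℝ => ε * Real.log (P.real {ω |
        ENNReal.ofReal (z * ε ^ (-(1 / 2) : ℝ)) < fourierLebesgueNorm (u ε ω (t ε))}))
      (𝓝[>] (0 : ℝ)) (𝓝 (-(z ^ 2 / ∑' k, c k ^ 2))) := by
  have hcont : Continuous fun y : ℝ => -(y ^ 2 / ∑' k, c k ^ 2) := by fun_prop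
  refine tendsto_order.2 ⟨fun b hb => ?_, fun b hb => ?_⟩
  · obtain ⟨y, hyb, hy⟩ := (((hcont.tendsto z).mono_left nhdsWithin_le_nhds).eventually
      (lt_mem_nhds hb)).and (self_mem_nhdsWithin (s := Set.Ioi z)) |>.exists
    filter_upwards [eventually_le_mul_log_prob hg hg_indep hc hc_sq hpos ht htO hu hz.le hy] with ε hε
    exact lt_of_lt_of_le hyb hε.2
  · obtain ⟨y, hyb, hy⟩ := (((hcont.tendsto z).mono_left nhdsWithin_le_nhds).eventually
      (gt_mem_nhds hb)).and (Ioo_mem_nhdsLT hz) |>.exists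
    exact eventually_mul_log_prob_lt hg hg_indep hc hc_sq hc1 hpos ht htO hu hy.1.le hy.2 hyb

theorem eventually_prob_eq_one (hg : ∀ k, HasLaw (g k) stdComplexGaussian P)
    (hg_indep : iIndepFun g P) (hc : ∀ k, 0 ≤ c k) (hc_sq : Summable fun k => c k ^ 2)
    (hc1 : ¬ Summable c) (ht : ∀ ε > 0, 0 ≤ t ε)
    (htO : t =O[𝓝[>] (0 : ℝ)] fun ε => ε⁻¹ * |Real.log ε|)
    (hu : ∀ ε > 0, ∀ᵐ ω ∂P, IsSolution ε (t ε) (u ε ω) ∧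
      HasFourierData c (fun k => g k ω) (u ε ω 0)) {z : ℝ} (hz : 0 ≤ z) :
    ∀ᶠ ε in 𝓝[>] (0 : ℝ), P.real {ω |
        ENNReal.ofReal (z * ε ^ (-(1 / 2) : ℝ)) < fourierLebesgueNorm (u ε ω (t ε))} = 1 := by
  filter_upwards [eventually_ae_lt_fourierLebesgueNorm ht htO hu hz (lt_add_one z)] with ε hae
  have huniv : {ω | ENNReal.ofReal (z * ε ^ (-(1 / 2) : ℝ)) < fourierLebesgueNorm (u ε ω (t ε))}
      =ᵐ[P] Set.univ := by
    rw [eventuallyEq_univ]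
    filter_upwards [hae, ae_randomNorm_eq_top hg hg_indep hc hc_sq hc1] with ω h1 h2
    exact h1 (h2 ▸ ENNReal.ofReal_lt_top)
  rw [measureReal_congr huniv, probReal_univ]

end Comparison

end CubicNLS

end

theorem theorem1p1 {Ω : Type*} [MeasurableSpace Ω] (P : Measure Ω) [IsProbabilityMeasure P]
    (g : ℤ → Ω → ℂ) (hg : ∀ k, HasLaw (g k) CubicNLS.stdComplexGaussian P)
    (hg_indep : iIndepFun g P)
    (c : ℤ → ℝ) (hc : ∀ k, 0 ≤ c k) (hc_ne : c ≠ 0) (hc_sq : Summable fun k => c k ^ 2)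
    (t : ℝ → ℝ) (ht : ∀ ε > 0, 0 ≤ t ε)
    (htO : t =O[𝓝[>] (0 : ℝ)] fun ε => ε⁻¹ * |Real.log ε|)
    (u : ℝ → Ω → ℝ → CubicNLS.L2Torus)
    (hu : ∀ ε > 0, ∀ᵐ ω ∂P, CubicNLS.IsSolution ε (t ε) (u ε ω) ∧
      CubicNLS.HasFourierData c (fun k => g k ω) (u ε ω 0))
    (z₀ : ℝ) (hz₀ : 0 < z₀) :
    Tendsto (fun ε : ℝ => ε * Real.log (P.real {ω |
        ENNReal.ofReal (z₀ * ε ^ (-(1 / 2) : ℝ)) <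
          CubicNLS.fourierLebesgueNorm (u ε ω (t ε))}))
      (𝓝[>] (0 : ℝ)) (𝓝 (-(z₀ ^ 2 / ∑' k, c k ^ 2)))
    ↔ Summable c := by
  have hpos : 0 < ∑' k, c k ^ 2 := by
    obtain ⟨k, hk⟩ := Function.ne_iff.1 hc_ne
    exact hc_sq.tsum_pos (fun _ => sq_nonneg _) k (pow_pos ((hc k).lt_of_ne' hk) 2)
  refine ⟨fun h => ?_, fun hc1 =>
    CubicNLS.tendsto_mul_log_prob hg hg_indep hc hc_sq hc1 hpos ht htO hu hz₀⟩
  by_contra hc1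
  have h0 : Tendsto (fun ε : ℝ => ε * Real.log (P.real {ω |
        ENNReal.ofReal (z₀ * ε ^ (-(1 / 2) : ℝ)) <
          CubicNLS.fourierLebesgueNorm (u ε ω (t ε))})) (𝓝[>] (0 : ℝ)) (𝓝 0) := by
    refine tendsto_const_nhds.congr' ?_
    filter_upwards [CubicNLS.eventually_prob_eq_one hg hg_indep hc hc_sq hc1 ht htO hu hz₀.le]
      with ε hε
    rw [hε, Real.log_one, mul_zero]
  -- Outside ℓ¹ the limit is 0, which is incompatible with the strictly negative rate.
  have h1 := tendsto_nhds_unique h h0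
  have h2 : 0 < z₀ ^ 2 / ∑' k, c k ^ 2 := by positivity
  linarith
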